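/- For a metric space $(X,d_X)$ and an integer $q\ge 2$ let $$\mathrm{xt}_q(X)=\binom q2^{-1}\sup_{(x_1,\dots,x_q)\in X^q}\ \sum_{1\le i<j\le q} d_X(x_i,x_j)$$ denote its $q$-extent, and let $\bar B^X_\varepsilon(x)=\{y\in X: d_X(x,y)\le\varepsilon\}$ be the closed metric ball, equipped with the restriction of $d_X$. Let $n\ge 1$, let $(M,g)$ be a smooth $n$-dimensional Riemannian manifold, possibly with boundary, with Riemannian distance $d_M$ (the infimum of the lengths of paths), let $x$ be an interior point of $M$, and let $\operatorname{Scal}_g(x)$ be the scalar curvature at $x$ (the $g$-trace of the Ricci tensor, equal to $n(n-1)$ on the unit sphere $\mathbb S^n$). Then, as $\varepsilon\to 0^+$, $$\begin{aligned} \mathrm{xt}_{n+1}\big(\bar B^M_\varepsilon(x)\big) &=\mathrm{xt}_{n+1}\big(\bar B^{\mathbb R^n}_1(0)\big)\,\varepsilon-\frac16\sqrt{\frac{n+1}{2n^5}}\,\operatorname{Scal}_g(x)\,\varepsilon^3+O(\varepsilon^4)\\ &=\sqrt{\frac{2(n+1)}{n}}\;\varepsilon\left\{1-\frac{1}{12n^2}\operatorname{Scal}_g(x)\,\varepsilon^2+O(\varepsilon^3)\right\},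 \end{aligned}$$ where $\mathbb R^n$ carries the Euclidean distance, and the implied constants may depend on $(M,g)$ and $x$. -/

import Mathlib

open scoped ENNReal ContDiff Manifold Topology Bundle
open Asymptotics Bundle Filter Set

noncomputable section

/-- The `q`-extent of a metric space `X`: the largest possible mean of the pairwise distances of
`q` points of `X`, that is
`(q choose 2)⁻¹ * sup_{(x_1, …, x_q) ∈ X^q} ∑_{i < j} d(x_i, x_j)`.
It is defined for extended distances, so that `X` may be unbounded or disconnected. -/
def extent (q : ℕ) (X : Type*) [PseudoEMetricSpace X] : ℝ≥0∞ :=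
  ((q.choose 2 : ℕ) : ℝ≥0∞)⁻¹ *
    ⨆ p : Fin q → X, ∑ i : Fin q, ∑ j ∈ Finset.Ioi i, edist (p i) (p j)

/-! ### Scalar curvature in local coordinates

Let `M` be a manifold (possibly with boundary or corners) modelled on `ℝⁿ`, with a Riemannian
metric `g`. All quantities below are computed in the chart of `M` at a point `x`, as functions of
the coordinate `y` in the range of the model. Derivatives are taken within that range, which is a
neighbourhood of `y` as soon as `y` corresponds to an interior point. -/

namespace RiemannianCoord

variable {n : ℕ} {H : Type*} [TopologicalSpace H]
  (I : ModelWithCorners ℝ (EuclideanSpace ℝ (Fin n)) H)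
  {M : Type*} [TopologicalSpace M] [ChartedSpace H M]

/-- The partial derivative `∂_i f` at `y`, for `f` defined on the range of the model. -/
def pderiv (i : Fin n) (f : EuclideanSpace ℝ (Fin n) → ℝ) (y : EuclideanSpace ℝ (Fin n)) : ℝ :=
  fderivWithin ℝ f (range I) y (EuclideanSpace.single i 1)

/-- The coordinate vector field `∂_i` of the chart at `x`, at the point of coordinate `y`. -/
def coordField (x : M) (i : Fin n) (y : EuclideanSpace ℝ (Fin n)) :
    TangentSpace I ((extChartAt I x).symm y) :=
  mfderivWithin 𝓘(ℝ, EuclideanSpace ℝ (Fin n)) I (extChartAt I x).symm (range I) y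
    (EuclideanSpace.single i (1 : ℝ))

variable [RiemannianBundle (fun p : M ↦ TangentSpace I p)]

/-- The matrix `g_{ij}(y) = g(∂_i, ∂_j)` of the metric. -/
def metric (x : M) (y : EuclideanSpace ℝ (Fin n)) : Matrix (Fin n) (Fin n) ℝ :=
  Matrix.of fun i j ↦ inner ℝ (coordField I x i y) (coordField I x j y)

/-- The Christoffel symbols of the Levi-Civita connection,
`Γ^k_{ij} = ½ ∑_l g^{kl} (∂_i g_{jl} + ∂_j g_{il} - ∂_l g_{ij})`, where `∇_{∂_i} ∂_j = Γ^k_{ij} ∂_k`. -/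
def christoffel (x : M) (k i j : Fin n) (y : EuclideanSpace ℝ (Fin n)) : ℝ :=
  (1 / 2 : ℝ) * ∑ l, (metric I x y)⁻¹ k l *
    (pderiv I i (fun z ↦ metric I x z j l) y + pderiv I j (fun z ↦ metric I x z i l) y
      - pderiv I l (fun z ↦ metric I x z i j) y)

/-- The coefficient along `∂_l` of `R(∂_i, ∂_j) ∂_k`, where
`R(X, Y) Z = ∇_X ∇_Y Z - ∇_Y ∇_X Z - ∇_{[X, Y]} Z`. -/
def riemann (x : M) (l k i j : Fin n) (y : EuclideanSpace ℝ (Fin n)) : ℝ :=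
  pderiv I i (christoffel I x l j k) y - pderiv I j (christoffel I x l i k) y
    + ∑ m, (christoffel I x l i m y * christoffel I x m j k y
        - christoffel I x l j m y * christoffel I x m i k y)

/-- The Ricci tensor: `Ric(∂_j, ∂_k)` is the trace of `X ↦ R(X, ∂_j) ∂_k`. -/
def ricci (x : M) (j k : Fin n) (y : EuclideanSpace ℝ (Fin n)) : ℝ :=
  ∑ i, riemann I x i k i j y

end RiemannianCoord

/-- The scalar curvature at `x`, i.e. the trace `g^{jk} Ric_{jk}` of the Ricci tensor with respect
to the metric, computed in the chart at `x`. It is normalized so that the unit sphere of dimension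
`n` has scalar curvature `n (n - 1)`. -/
def scalarCurvature {n : ℕ} {H : Type*} [TopologicalSpace H]
    (I : ModelWithCorners ℝ (EuclideanSpace ℝ (Fin n)) H)
    {M : Type*} [TopologicalSpace M] [ChartedSpace H M]
    [RiemannianBundle (fun p : M ↦ TangentSpace I p)] (x : M) : ℝ :=
  ∑ j, ∑ k, (RiemannianCoord.metric I x (extChartAt I x x))⁻¹ j k *
    RiemannianCoord.ricci I x j k (extChartAt I x x)

end

/-!
In normal coordinates `ψ` at `x` the metric is `|w|² - R(w, z, z, w) / 3 + O(|z|³ |w|²)`, and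
comparing lengths of paths gives, uniformly for `|u|, |v| ≤ ρ`,
`d(ψ u, ψ v) = |v - u| - R(u, v, v, u) / (6 |v - u|) + O(ρ⁴)`,
the second term being absent for `u = v`: straight segments bound the distance from above, and
calibration by a corrected linear function bounds it from below. In a Euclidean ball of radius `ρ`
the sum of the distances between `n + 1` points is maximal at the vertices of a regular inscribed
simplex, with a quadratic deficit at other configurations, so that the curvature term, being of
order `ρ³`, moves the maximizers too little to change the sum to that order. At a regular simplex
it is determined by the scalar curvature, as the tensor `∑ i, vᵢ ⊗ vᵢ` of its vertices is a multiple
of the metric.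
-/

noncomputable section

/-! ### Taylor expansion -/

section Taylor

variable {E F : Type*} [NormedAddCommGroup E] [NormedSpace ℝ E]
  [NormedAddCommGroup F] [NormedSpace ℝ F]

theorem isBigO_norm_pow_succ_of_fderiv {f : E → F} {k : ℕ}
    (hf : ∀ᶠ z in 𝓝 (0 : E), DifferentiableAt ℝ f z) (h0 : f 0 = 0)
    (h : fderiv ℝ f =O[𝓝 0] fun z ↦ ‖z‖ ^ k) :
    f =O[𝓝 0] fun z ↦ ‖z‖ ^ (k + 1) := by
  have hrpow : fderiv ℝ f =O[𝓝 0] fun z ↦ ‖z - 0‖ ^ (k : ℝ) := by simpa using h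
  have := isBigO_norm_rpow_add_one_of_fderiv_of_apply_eq_zero k.cast_nonneg hf hrpow h0
  exact_mod_cast this.congr_right fun z ↦ by rw [sub_zero, ← Nat.cast_succ, Real.rpow_natCast]

theorem isBigO_sub_taylor_one {f : E → F} (hf : ContDiffAt ℝ 2 f 0) :
    (fun z ↦ f z - f 0 - fderiv ℝ f 0 z) =O[𝓝 0] fun z ↦ ‖z‖ ^ 2 := by
  have hdiff : ∀ᶠ z in 𝓝 (0 : E), DifferentiableAt ℝ f z :=
    (hf.eventually (by simp)).mono fun z hz ↦ hz.differentiableAt (by simp)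
  have hd : ContDiffAt ℝ 1 (fderiv ℝ f) 0 := hf.fderiv_right (by norm_num)
  refine isBigO_norm_pow_succ_of_fderiv (k := 1) (hdiff.mono fun z hz ↦ by fun_prop) (by simp) ?_
  have hO : (fun z ↦ fderiv ℝ f z - fderiv ℝ f 0) =O[𝓝 0] fun z ↦ ‖z‖ ^ 1 := by
    simpa using (hd.differentiableAt (by simp)).isBigO_sub.norm_right
  refine hO.congr' (hdiff.mono fun z hz ↦ ?_) EventuallyEq.rfl
  exact ((hz.hasFDerivAt.sub_const _).sub (fderiv ℝ f 0).hasFDerivAt).fderiv.symm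

theorem isBigO_sub_taylor_two {f : E → F} (hf : ContDiffAt ℝ 3 f 0) :
    (fun z ↦ f z - f 0 - fderiv ℝ f 0 z - (1 / 2 : ℝ) • fderiv ℝ (fderiv ℝ f) 0 z z)
      =O[𝓝 0] fun z ↦ ‖z‖ ^ 3 := by
  have hdiff : ∀ᶠ z in 𝓝 (0 : E), DifferentiableAt ℝ f z :=
    (hf.eventually (by simp)).mono fun z hz ↦ hz.differentiableAt (by simp)
  set D : E →L[ℝ] E →L[ℝ] F := fderiv ℝ (fderiv ℝ f) 0
  have hsymm : ∀ v w, D v w = D w v := fun v w ↦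
    (hf.isSymmSndFDerivAt (by simp; norm_num)).eq v w
  refine isBigO_norm_pow_succ_of_fderiv (k := 2) (hdiff.mono fun z hz ↦ by fun_prop) (by simp) ?_
  refine (isBigO_sub_taylor_one (hf.fderiv_right (m := 2) (by norm_num))).congr'
    (hdiff.mono fun z hz ↦ ?_) EventuallyEq.rfl
  have hquad : HasFDerivAt (fun z ↦ (1 / 2 : ℝ) • D z z) (D z) z := by
    refine ((D.hasFDerivAt.clm_apply (hasFDerivAt_id z)).const_smul (1 / 2 : ℝ)).congr_fderiv ?_
    ext v
    simp only [smul_apply, add_apply, ContinuousLinearMap.comp_apply,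
      ContinuousLinearMap.flip_apply, ContinuousLinearMap.id_apply, id, hsymm v z]
    module
  exact (((hz.hasFDerivAt.sub_const _).sub (fderiv ℝ f 0).hasFDerivAt).sub hquad).fderiv.symm

theorem isBigO_inv_smul {p : ℝ → F} {k : ℕ} (h : p =O[𝓝 0] fun t : ℝ ↦ t ^ (k + 1)) :
    (fun t : ℝ ↦ t⁻¹ • p t) =O[𝓝[≠] 0] fun t : ℝ ↦ t ^ k := by
  refine ((isBigO_refl (fun t : ℝ ↦ t⁻¹) _).smul (h.mono nhdsWithin_le_nhds)).congr'
    EventuallyEq.rfl ?_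
  filter_upwards [self_mem_nhdsWithin] with t ht
  rw [smul_eq_mul, pow_succ', inv_mul_cancel_left₀ ht]

omit [NormedSpace ℝ F] in
theorem eq_zero_of_isBigO_pow_succ {p : ℝ → F} {k : ℕ} (hp : Continuous p)
    (h : p =O[𝓝 0] fun t : ℝ ↦ t ^ (k + 1)) : p 0 = 0 := by
  have hlim : Tendsto (fun t : ℝ ↦ t ^ (k + 1)) (𝓝 0) (𝓝 0) := by
    simpa using (continuous_pow (k + 1) (M := ℝ)).tendsto 0
  exact tendsto_nhds_unique (hp.tendsto 0) (h.trans_tendsto hlim)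

theorem isBigO_pow_of_isBigO_smul {p : ℝ → F} {k : ℕ} (hp : Continuous p)
    (h : (fun t : ℝ ↦ t • p t) =O[𝓝 0] fun t : ℝ ↦ t ^ (k + 2)) :
    p =O[𝓝 0] fun t : ℝ ↦ t ^ (k + 1) := by
  have hne : p =O[𝓝[≠] 0] fun t : ℝ ↦ t ^ (k + 1) := by
    refine (isBigO_inv_smul h).congr' ?_ EventuallyEq.rfl
    filter_upwards [self_mem_nhdsWithin] with t ht
    exact inv_smul_smul₀ ht _
  have hlim : Tendsto (fun t : ℝ ↦ t ^ (k + 1)) (𝓝[≠] 0) (𝓝 0) := by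
    simpa using ((continuous_pow (k + 1) (M := ℝ)).tendsto 0).mono_left nhdsWithin_le_nhds
  have h0 : p 0 = 0 := tendsto_nhds_unique ((hp.tendsto 0).mono_left nhdsWithin_le_nhds)
    (hne.trans_tendsto hlim)
  rw [← nhdsNE_sup_pure (0 : ℝ), isBigO_sup]
  exact ⟨hne, isBigO_pure.2 fun _ ↦ h0⟩

theorem eq_zero_of_isBigO_cube {a b c : F}
    (h : (fun t : ℝ ↦ a + t • b + t ^ 2 • c) =O[𝓝 0] fun t : ℝ ↦ t ^ 3) :
    a = 0 ∧ b = 0 ∧ c = 0 := by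
  obtain rfl : a = 0 := by simpa using eq_zero_of_isBigO_pow_succ (by fun_prop) h
  have h₁ : (fun t : ℝ ↦ b + t • c) =O[𝓝 0] fun t : ℝ ↦ t ^ 2 :=
    isBigO_pow_of_isBigO_smul (by fun_prop) (h.congr_left fun t ↦ by module)
  obtain rfl : b = 0 := by simpa using eq_zero_of_isBigO_pow_succ (by fun_prop) h₁
  have h₂ : (fun _ : ℝ ↦ c) =O[𝓝 0] fun t : ℝ ↦ t ^ 1 :=
    isBigO_pow_of_isBigO_smul (by fun_prop) (h₁.congr_left fun t ↦ by module)
  exact ⟨rfl, rfl, eq_zero_of_isBigO_pow_succ continuous_const h₂⟩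

theorem isBigO_norm_pow_three_of_lines {f : E → F} (hf : ContDiffAt ℝ 3 f 0)
    (h : ∀ z, (fun t : ℝ ↦ f (t • z)) =O[𝓝 0] fun t : ℝ ↦ t ^ 3) :
    f =O[𝓝 0] fun z ↦ ‖z‖ ^ 3 := by
  have hTaylor := isBigO_sub_taylor_two hf
  have hjet : ∀ z, f 0 = 0 ∧ fderiv ℝ f 0 z = 0 ∧
      (1 / 2 : ℝ) • fderiv ℝ (fderiv ℝ f) 0 z z = 0 := by
    intro z
    have hcont : Continuous fun t : ℝ ↦ t • z := by fun_prop
    have hlim : Tendsto (fun t : ℝ ↦ t • z) (𝓝 0) (𝓝 0) := by simpa using hcont.tendsto 0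
    have hpow : (fun t : ℝ ↦ ‖t • z‖ ^ 3) =O[𝓝 0] fun t : ℝ ↦ t ^ 3 := by
      refine IsBigO.of_bound (‖z‖ ^ 3) (Eventually.of_forall fun t ↦ ?_)
      simp only [norm_smul, norm_pow, norm_mul, norm_norm]
      rw [mul_pow, mul_comm]
    refine eq_zero_of_isBigO_cube
      (((h z).sub ((hTaylor.comp_tendsto hlim).trans hpow)).congr_left fun t ↦ ?_)
    simp only [Function.comp_apply, map_smul, smul_apply]
    module
  refine hTaylor.congr_left fun z ↦ ?_
  rw [(hjet z).1, (hjet z).2.1, (hjet z).2.2]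
  simp

end Taylor

/-! ### Curvature of a metric jet -/

section FiniteDimensional

variable {E : Type*} [NormedAddCommGroup E] [InnerProductSpace ℝ E]

theorem linearMap_apply_eq_sum {F : Type*} [AddCommMonoid F] [Module ℝ F] {ι : Type*} [Fintype ι]
    (b : OrthonormalBasis ι ℝ E) (l : E →ₗ[ℝ] F) (v : E) :
    l v = ∑ i, inner ℝ (b i) v • l (b i) := by
  conv_lhs => rw [← b.sum_repr' v]
  simp only [map_sum, map_smul]

theorem abs_linearMap_apply_le {ι : Type*} [Fintype ι] (b : OrthonormalBasis ι ℝ E)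
    (l : E →ₗ[ℝ] ℝ) (v : E) : |l v| ≤ (∑ i, |l (b i)|) * ‖v‖ := by
  rw [linearMap_apply_eq_sum b l v, Finset.sum_mul]
  refine (Finset.abs_sum_le_sum_abs _ _).trans (Finset.sum_le_sum fun i _ ↦ ?_)
  rw [smul_eq_mul, abs_mul, mul_comm]
  gcongr
  simpa using abs_real_inner_le_norm (b i) v

variable [FiniteDimensional ℝ E] {F : Type*} [NormedAddCommGroup F] [NormedSpace ℝ F]

theorem contDiffAt_linearMap_apply {X : Type*} [NormedAddCommGroup X] [NormedSpace ℝ X] {x : X}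
    {l : X → E →ₗ[ℝ] F} {A : X → E} {k : ℕ∞ω} (hl : ∀ v, ContDiffAt ℝ k (fun z ↦ l z v) x)
    (hA : ContDiffAt ℝ k A x) : ContDiffAt ℝ k (fun z ↦ l z (A z)) x := by
  simp only [fun z ↦ linearMap_apply_eq_sum (stdOrthonormalBasis ℝ E) (l z) (A z)]
  exact ContDiffAt.sum fun i _ ↦ (contDiffAt_const.inner ℝ hA).smul (hl _)

theorem contDiff_linearMap_apply {X : Type*} [NormedAddCommGroup X] [NormedSpace ℝ X]
    {l : X → E →ₗ[ℝ] F} {A : X → E} {k : ℕ∞ω} (hl : ∀ v, ContDiff ℝ k fun z ↦ l z v)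
    (hA : ContDiff ℝ k A) : ContDiff ℝ k fun z ↦ l z (A z) :=
  contDiff_iff_contDiffAt.2 fun _ ↦
    contDiffAt_linearMap_apply (fun v ↦ (hl v).contDiffAt) hA.contDiffAt

theorem exists_bound_of_quadrilinear (R : E →ₗ[ℝ] E →ₗ[ℝ] E →ₗ[ℝ] E →ₗ[ℝ] ℝ) :
    ∃ C, 0 ≤ C ∧ ∀ a b c d, |R a b c d| ≤ C * ‖a‖ * ‖b‖ * ‖c‖ * ‖d‖ := by
  let e := stdOrthonormalBasis ℝ E
  refine ⟨∑ i, ∑ j, ∑ k, ∑ l, |R (e l) (e k) (e j) (e i)|, by positivity, fun a b c d ↦ ?_⟩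
  calc |R a b c d| ≤ (∑ i, |R a b c (e i)|) * ‖d‖ := abs_linearMap_apply_le e (R a b c) d
    _ ≤ (∑ i, (∑ j, |R a b (e j) (e i)|) * ‖c‖) * ‖d‖ := by
        gcongr with i
        exact abs_linearMap_apply_le e ((R a b).flip (e i)) c
    _ ≤ (∑ i, (∑ j, (∑ k, |R a (e k) (e j) (e i)|) * ‖b‖) * ‖c‖) * ‖d‖ := by
        gcongr with i _ j
        exact abs_linearMap_apply_le e (((R a).flip (e j)).flip (e i)) b
    _ ≤ (∑ i, (∑ j, (∑ k, (∑ l, |R (e l) (e k) (e j) (e i)|) * ‖a‖) * ‖b‖) * ‖c‖) * ‖d‖ := by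
        gcongr with i _ j _ k
        exact abs_linearMap_apply_le e (((R.flip (e k)).flip (e j)).flip (e i)) a
    _ = _ := by simp only [← Finset.sum_mul]

theorem exists_bound_of_quadratic_isBigO {X : Type*} {f : Filter X} {B : X → E →ₗ[ℝ] E →ₗ[ℝ] ℝ}
    {r : X → ℝ} (hr : ∀ z, 0 ≤ r z) (h : ∀ w, (fun z ↦ B z w w) =O[f] r) :
    ∃ C, 0 ≤ C ∧ ∀ᶠ z in f, ∀ w, |B z w w| ≤ C * r z * ‖w‖ ^ 2 := by
  let e := stdOrthonormalBasis ℝ E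
  let S : X → E →ₗ[ℝ] E →ₗ[ℝ] ℝ := fun z ↦ B z + (B z).flip
  have hpolar : ∀ v w, (fun z ↦ S z v w) =O[f] r := fun v w ↦ by
    refine (((h (v + w)).sub (h v)).sub (h w)).congr_left fun z ↦ ?_
    simp only [S, map_add, LinearMap.add_apply, LinearMap.flip_apply]
    ring
  have hsum : (fun z ↦ ∑ i, ∑ j, |S z (e j) (e i)|) =O[f] r :=
    IsBigO.fun_sum fun i _ ↦ IsBigO.fun_sum fun j _ ↦ (hpolar (e j) (e i)).abs_left
  obtain ⟨C, hC, hbound⟩ := hsum.exists_nonneg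
  refine ⟨C, hC, hbound.bound.mono fun z hz w ↦ ?_⟩
  rw [Real.norm_of_nonneg (by positivity), Real.norm_of_nonneg (hr z)] at hz
  have hS : |S z w w| ≤ C * r z * ‖w‖ ^ 2 := calc
    |S z w w| ≤ (∑ i, |S z w (e i)|) * ‖w‖ := abs_linearMap_apply_le e (S z w) w
    _ ≤ (∑ i, (∑ j, |S z (e j) (e i)|) * ‖w‖) * ‖w‖ := by
        gcongr with i
        exact abs_linearMap_apply_le e ((S z).flip (e i)) w
    _ = (∑ i, ∑ j, |S z (e j) (e i)|) * ‖w‖ ^ 2 := by rw [← Finset.sum_mul]; ring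
    _ ≤ _ := by gcongr
  have hdouble : |S z w w| = 2 * |B z w w| := by
    simp [S, ← two_mul, abs_mul]
  linarith [abs_nonneg (B z w w)]

end FiniteDimensional

section CurvatureTensor

variable {E : Type*} [NormedAddCommGroup E] [InnerProductSpace ℝ E] [FiniteDimensional ℝ E]

local notation "⟪" x "," y "⟫" => inner ℝ x y

/-- The vector representing a linear form through the inner product. -/
def sharp : (E →ₗ[ℝ] ℝ) →ₗ[ℝ] E where
  toFun l := ∑ i, l (stdOrthonormalBasis ℝ E i) • stdOrthonormalBasis ℝ E i
  map_add' l l' := by simp [add_smul, Finset.sum_add_distrib]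
  map_smul' c l := by simp [mul_smul, Finset.smul_sum]

theorem inner_sharp (l : E →ₗ[ℝ] ℝ) (v : E) : ⟪sharp l, v⟫ = l v := by
  rw [linearMap_apply_eq_sum (stdOrthonormalBasis ℝ E) l v]
  simp [sharp, sum_inner, inner_smul_left, mul_comm]

theorem contDiff_sharp {X : Type*} [NormedAddCommGroup X] [NormedSpace ℝ X] {k : ℕ∞ω}
    {l : X → E →ₗ[ℝ] ℝ} (hl : ∀ v, ContDiff ℝ k fun z ↦ l z v) :
    ContDiff ℝ k fun z ↦ sharp (l z) := by
  simp only [sharp, LinearMap.coe_mk, AddHom.coe_mk]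
  exact ContDiff.sum fun i _ ↦ (hl _).smul contDiff_const

/-- The Levi-Civita connection coefficients at a point where the metric is the inner product and
has first derivative `g₁`. -/
def leviCivita (g₁ : E →ₗ[ℝ] E →ₗ[ℝ] E →ₗ[ℝ] ℝ) : E →ₗ[ℝ] E →ₗ[ℝ] E :=
  LinearMap.mk₂ ℝ (fun a b ↦ sharp ((1 / 2 : ℝ) • (g₁ a b + g₁ b a - (g₁.flip a).flip b)))
    (fun a a' b ↦ by rw [← map_add]; congr 1; ext; simp; ring)
    (fun c a b ↦ by rw [← map_smul]; congr 1; ext; simp; ring)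
    (fun a b b' ↦ by rw [← map_add]; congr 1; ext; simp; ring)
    (fun c a b ↦ by rw [← map_smul]; congr 1; ext; simp; ring)

variable (g₁ : E →ₗ[ℝ] E →ₗ[ℝ] E →ₗ[ℝ] ℝ) (g₂ : E →ₗ[ℝ] E →ₗ[ℝ] E →ₗ[ℝ] E →ₗ[ℝ] ℝ)

theorem inner_leviCivita (a b c : E) :
    ⟪leviCivita g₁ a b, c⟫ = 1 / 2 * (g₁ a b c + g₁ b a c - g₁ c a b) := by
  rw [leviCivita, LinearMap.mk₂_apply, inner_sharp]
  simp

variable {g₁} in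
theorem leviCivita_comm (h₁ : ∀ a v w, g₁ a v w = g₁ a w v) (a b : E) :
    leviCivita g₁ a b = leviCivita g₁ b a := by
  refine ext_inner_right ℝ fun c ↦ ?_
  rw [inner_leviCivita, inner_leviCivita, h₁ c a b]
  ring

variable {g₁} in
theorem inner_leviCivita_add (h₁ : ∀ a v w, g₁ a v w = g₁ a w v) (a b c : E) :
    ⟪leviCivita g₁ a b, c⟫ + ⟪leviCivita g₁ a c, b⟫ = g₁ a b c := by
  rw [inner_leviCivita, inner_leviCivita, h₁ a c b, h₁ c a b, h₁ b a c]
  ring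

/-- The Riemann tensor at a point where the metric is the inner product and has first and second
derivatives `g₁` and `g₂`. -/
def curvatureOfJet : E →ₗ[ℝ] E →ₗ[ℝ] E →ₗ[ℝ] E →ₗ[ℝ] ℝ :=
  LinearMap.mk₂ ℝ (fun i j ↦ LinearMap.mk₂ ℝ
    (fun k p ↦ 1 / 2 * (g₂ i k j p - g₂ i p j k - g₂ j k i p + g₂ j p i k)
      - ⟪leviCivita g₁ j k, leviCivita g₁ i p⟫ + ⟪leviCivita g₁ i k, leviCivita g₁ j p⟫)
    (by intros; simp [inner_add_left]; ring) (by intros; simp [inner_smul_left]; ring)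
    (by intros; simp [inner_add_right]; ring) (by intros; simp [inner_smul_right]; ring))
    (by intros; ext; simp [inner_add_left, inner_add_right]; ring)
    (by intros; ext; simp [inner_smul_left, inner_smul_right]; ring)
    (by intros; ext; simp [inner_add_left, inner_add_right]; ring)
    (by intros; ext; simp [inner_smul_left, inner_smul_right]; ring)

theorem curvatureOfJet_apply (i j k p : E) :
    curvatureOfJet g₁ g₂ i j k p = 1 / 2 * (g₂ i k j p - g₂ i p j k - g₂ j k i p + g₂ j p i k)
      - ⟪leviCivita g₁ j k, leviCivita g₁ i p⟫ + ⟪leviCivita g₁ i k, leviCivita g₁ j p⟫ :=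
  rfl

/-- The antisymmetries of a Riemann curvature tensor in its first and last two arguments. -/
structure IsCurvatureLike {V : Type*} [AddCommGroup V] [Module ℝ V]
    (R : V →ₗ[ℝ] V →ₗ[ℝ] V →ₗ[ℝ] V →ₗ[ℝ] ℝ) : Prop where
  anti₁₂ : ∀ a b c d, R a b c d = -R b a c d
  anti₃₄ : ∀ a b c d, R a b c d = -R a b d c

namespace IsCurvatureLike

variable {V : Type*} [AddCommGroup V] [Module ℝ V] {R : V →ₗ[ℝ] V →ₗ[ℝ] V →ₗ[ℝ] V →ₗ[ℝ] ℝ}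

theorem self₁₂ (hR : IsCurvatureLike R) (a c d : V) : R a a c d = 0 := by
  linarith [hR.anti₁₂ a a c d]

theorem self₃₄ (hR : IsCurvatureLike R) (a b c : V) : R a b c c = 0 := by
  linarith [hR.anti₃₄ a b c c]

end IsCurvatureLike

theorem isCurvatureLike_curvatureOfJet : IsCurvatureLike (curvatureOfJet g₁ g₂) where
  anti₁₂ a b c d := by simp only [curvatureOfJet_apply]; ring
  anti₃₄ a b c d := by
    simp only [curvatureOfJet_apply]
    rw [real_inner_comm (leviCivita g₁ b c), real_inner_comm (leviCivita g₁ b d)]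
    ring

end CurvatureTensor

/-! ### Normal coordinates -/

section NormalCoordinates

variable {E : Type*} [NormedAddCommGroup E] [InnerProductSpace ℝ E]

local notation "⟪" x "," y "⟫" => inner ℝ x y

/-- The first and second derivatives `g₁`, `g₂` at `0` of a `C³` field `G` of symmetric bilinear
forms which is the inner product at `0`, such as a metric in a frame that is orthonormal there. -/
structure HasMetricJet (G : E → E →ₗ[ℝ] E →ₗ[ℝ] ℝ) (g₁ : E →ₗ[ℝ] E →ₗ[ℝ] E →ₗ[ℝ] ℝ)
    (g₂ : E →ₗ[ℝ] E →ₗ[ℝ] E →ₗ[ℝ] E →ₗ[ℝ] ℝ) : Prop where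
  contDiffAt : ∀ v w, ContDiffAt ℝ 3 (fun z ↦ G z v w) 0
  symm : ∀ z v w, G z v w = G z w v
  zero : ∀ v w, G 0 v w = ⟪v, w⟫
  fderiv : ∀ a v w, fderiv ℝ (fun z ↦ G z v w) 0 a = g₁ a v w
  fderiv₂ : ∀ a b v w, _root_.fderiv ℝ (_root_.fderiv ℝ fun z ↦ G z v w) 0 a b = g₂ a b v w

variable {g₁ : E →ₗ[ℝ] E →ₗ[ℝ] E →ₗ[ℝ] ℝ} {g₂ : E →ₗ[ℝ] E →ₗ[ℝ] E →ₗ[ℝ] E →ₗ[ℝ] ℝ}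
  {G : E → E →ₗ[ℝ] E →ₗ[ℝ] ℝ}

namespace HasMetricJet

theorem symm₁ (hG : HasMetricJet G g₁ g₂) (a v w : E) : g₁ a v w = g₁ a w v := by
  rw [← hG.fderiv, ← hG.fderiv, funext fun z ↦ hG.symm z v w]

theorem symm₂ (hG : HasMetricJet G g₁ g₂) (a b v w : E) : g₂ a b v w = g₂ a b w v := by
  rw [← hG.fderiv₂, ← hG.fderiv₂, funext fun z ↦ hG.symm z v w]

theorem comm₂ (hG : HasMetricJet G g₁ g₂) (a b v w : E) : g₂ a b v w = g₂ b a v w := by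
  rw [← hG.fderiv₂, ← hG.fderiv₂]
  exact ((hG.contDiffAt v w).isSymmSndFDerivAt (by simp; norm_num)).eq a b

end HasMetricJet

variable [FiniteDimensional ℝ E] (g₁ g₂)

/-- The linear form dual to the cubic term of normal coordinates. -/
def cubicForm (z : E) : E →ₗ[ℝ] ℝ :=
  (-(1 / 6) : ℝ) • (g₂ z z z - (1 / 2 : ℝ) • ((g₂ z).flip z).flip z
    - (innerₗ E (leviCivita g₁ z z)).comp (leviCivita g₁ z)
    - (3 : ℝ) • innerₗ E (leviCivita g₁ z (leviCivita g₁ z z)))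

theorem cubicForm_apply (z p : E) :
    cubicForm g₁ g₂ z p = -(1 / 6) * (g₂ z z z p - 1 / 2 * g₂ z p z z
      - ⟪leviCivita g₁ z z, leviCivita g₁ z p⟫
      - 3 * ⟪leviCivita g₁ z (leviCivita g₁ z z), p⟫) := by
  simp [cubicForm]

/-- The derivative of `cubicForm` in the direction `w`. -/
def cubicFormDeriv (z w p : E) : ℝ :=
  -(1 / 6) * (g₂ w z z p + g₂ z w z p + g₂ z z w p
    - 1 / 2 * (g₂ w p z z + g₂ z p w z + g₂ z p z w)
    - (⟪leviCivita g₁ w z + leviCivita g₁ z w, leviCivita g₁ z p⟫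
      + ⟪leviCivita g₁ z z, leviCivita g₁ w p⟫)
    - 3 * ⟪leviCivita g₁ w (leviCivita g₁ z z)
      + leviCivita g₁ z (leviCivita g₁ w z + leviCivita g₁ z w), p⟫)

theorem cubicForm_line (z w p : E) (s : ℝ) :
    cubicForm g₁ g₂ (z + s • w) p = cubicForm g₁ g₂ z p + s * cubicFormDeriv g₁ g₂ z w p
      + s ^ 2 * cubicFormDeriv g₁ g₂ w z p + s ^ 3 * cubicForm g₁ g₂ w p := by
  simp only [cubicForm_apply, cubicFormDeriv, map_add, map_smul, LinearMap.add_apply,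
    LinearMap.smul_apply, inner_add_left, inner_add_right, inner_smul_left, inner_smul_right,
    smul_eq_mul, conj_trivial, smul_add]
  ring

/-- Normal coordinates up to order three: the Taylor polynomial at `0` of the exponential map of a
metric with derivatives `g₁` and `g₂`. -/
def normalMap (z : E) : E :=
  z - (1 / 2 : ℝ) • leviCivita g₁ z z + sharp (cubicForm g₁ g₂ z)

variable {k : ℕ∞ω}

theorem contDiff_leviCivita_left (v : E) : ContDiff ℝ k fun z ↦ leviCivita g₁ z v :=
  contDiff_linearMap_apply (l := fun _ ↦ (leviCivita g₁).flip v) (fun _ ↦ contDiff_const)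
    contDiff_id

theorem contDiff_leviCivita_diag : ContDiff ℝ k fun z ↦ leviCivita g₁ z z :=
  contDiff_linearMap_apply (contDiff_leviCivita_left g₁) contDiff_id

theorem contDiff_cubicForm (p : E) : ContDiff ℝ k fun z ↦ cubicForm g₁ g₂ z p := by
  have hg₂ : ContDiff ℝ k fun z ↦ g₂ z z z p :=
    contDiff_linearMap_apply (l := fun z ↦ (g₂ z z).flip p) (fun c ↦
      contDiff_linearMap_apply (l := fun z ↦ ((g₂ z).flip c).flip p) (fun b ↦
        contDiff_linearMap_apply (l := fun _ ↦ ((g₂.flip b).flip c).flip p)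
        (fun _ ↦ contDiff_const) contDiff_id) contDiff_id) contDiff_id
  have hg₂' : ContDiff ℝ k fun z ↦ g₂ z p z z :=
    contDiff_linearMap_apply (l := fun z ↦ g₂ z p z) (fun c ↦
      contDiff_linearMap_apply (l := fun z ↦ (g₂ z p).flip c) (fun b ↦
        contDiff_linearMap_apply (l := fun _ ↦ ((g₂.flip p).flip b).flip c)
        (fun _ ↦ contDiff_const) contDiff_id) contDiff_id) contDiff_id
  have hΓΓ : ContDiff ℝ k fun z ↦ leviCivita g₁ z (leviCivita g₁ z z) :=
    contDiff_linearMap_apply (contDiff_leviCivita_left g₁) (contDiff_leviCivita_diag g₁)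
  simp only [cubicForm_apply]
  exact contDiff_const.mul (((hg₂.sub (contDiff_const.mul hg₂')).sub
    ((contDiff_leviCivita_diag g₁).inner ℝ (contDiff_leviCivita_left g₁ p))).sub
    (contDiff_const.mul (hΓΓ.inner ℝ contDiff_const)))

theorem contDiff_normalMap : ContDiff ℝ k (normalMap g₁ g₂) :=
  (contDiff_id.sub ((contDiff_leviCivita_diag g₁).const_smul (1 / 2 : ℝ))).add
    (contDiff_sharp (contDiff_cubicForm g₁ g₂))

theorem hasDerivAt_cubic_zero (a b c d : ℝ) :
    HasDerivAt (fun s : ℝ ↦ a + s * b + s ^ 2 * c + s ^ 3 * d) b 0 := by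
  have h := ((((hasDerivAt_id (0 : ℝ)).mul_const b).const_add a).fun_add
    (((hasDerivAt_id (0 : ℝ)).fun_pow 2).mul_const c)).fun_add
    (((hasDerivAt_id (0 : ℝ)).fun_pow 3).mul_const d)
  simpa using h

variable {g₁}

theorem inner_fderiv_normalMap (h₁ : ∀ a v w, g₁ a v w = g₁ a w v) (y w p : E) :
    ⟪fderiv ℝ (normalMap g₁ g₂) y w, p⟫
      = ⟪w, p⟫ - ⟪leviCivita g₁ y w, p⟫ + cubicFormDeriv g₁ g₂ y w p := by
  have hline : HasDerivAt (fun s : ℝ ↦ y + s • w) w 0 := by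
    simpa using ((hasDerivAt_id (0 : ℝ)).smul_const w).const_add y
  have hφ : HasFDerivAt (normalMap g₁ g₂) (fderiv ℝ (normalMap g₁ g₂) y) (y + (0 : ℝ) • w) := by
    simpa using ((contDiff_normalMap g₁ g₂ (k := 1)).differentiable (by simp) y).hasFDerivAt
  have hchain := (hφ.comp_hasDerivAt 0 hline).inner ℝ (hasDerivAt_const (0 : ℝ) p)
  have hexpand : HasDerivAt (fun s : ℝ ↦ ⟪normalMap g₁ g₂ (y + s • w), p⟫)
      (⟪w, p⟫ - ⟪leviCivita g₁ y w, p⟫ + cubicFormDeriv g₁ g₂ y w p) 0 := by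
    refine (hasDerivAt_cubic_zero ⟪normalMap g₁ g₂ y, p⟫ _
      (-(1 / 2) * ⟪leviCivita g₁ w w, p⟫ + cubicFormDeriv g₁ g₂ w y p)
      (cubicForm g₁ g₂ w p)).congr_of_eventuallyEq (Eventually.of_forall fun s ↦ ?_)
    simp only [normalMap, inner_add_left, inner_sub_left, inner_sharp, cubicForm_line,
      map_add, map_smul, LinearMap.add_apply, LinearMap.smul_apply, inner_smul_left,
      leviCivita_comm h₁ w y, conj_trivial]
    ring
  simpa using hchain.unique hexpand

theorem fderiv_normalMap_zero (h₁ : ∀ a v w, g₁ a v w = g₁ a w v) :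
    fderiv ℝ (normalMap g₁ g₂) 0 = ContinuousLinearMap.id ℝ E := by
  ext1 w
  refine ext_inner_right ℝ fun p ↦ ?_
  rw [inner_fderiv_normalMap g₂ h₁]
  simp [cubicFormDeriv]

theorem fderiv_normalMap_smul (h₁ : ∀ a v w, g₁ a v w = g₁ a w v) (z w : E) :
    ∃ X : E, (∀ p, ⟪X, p⟫ = cubicFormDeriv g₁ g₂ z w p) ∧
      ∀ t : ℝ, fderiv ℝ (normalMap g₁ g₂) (t • z) w
        = w + t • (-leviCivita g₁ z w) + t ^ 2 • X := by
  refine ⟨fderiv ℝ (normalMap g₁ g₂) z w - (w - leviCivita g₁ z w), fun p ↦ ?_, fun t ↦ ?_⟩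
  · rw [inner_sub_left, inner_fderiv_normalMap g₂ h₁, inner_sub_left]; ring
  · refine ext_inner_right ℝ fun p ↦ ?_
    rw [inner_fderiv_normalMap g₂ h₁, inner_add_left _ (t ^ 2 • _), inner_smul_left,
      inner_sub_left (fderiv ℝ _ _ _), inner_fderiv_normalMap g₂ h₁]
    simp only [cubicFormDeriv, map_smul, map_add, LinearMap.smul_apply, smul_eq_mul, inner_add_left,
      inner_sub_left, inner_smul_left, inner_smul_right, inner_neg_left, conj_trivial, smul_neg]
    ring

variable (g₁)

theorem normalMap_zero : normalMap g₁ g₂ 0 = 0 := by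
  refine ext_inner_right ℝ fun p ↦ ?_
  simp [normalMap, inner_sharp, cubicForm_apply]

theorem normalMap_smul (t : ℝ) (z : E) :
    normalMap g₁ g₂ (t • z) = t • z + t ^ 2 • (-(1 / 2 : ℝ) • leviCivita g₁ z z)
      + t ^ 3 • sharp (cubicForm g₁ g₂ z) := by
  refine ext_inner_right ℝ fun p ↦ ?_
  simp only [normalMap, inner_add_left, inner_sub_left, inner_sharp, cubicForm_apply, map_smul,
    LinearMap.smul_apply, smul_eq_mul, inner_smul_left, inner_smul_right, conj_trivial]
  ring

variable {g₁ g₂}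

theorem metric_jet_one_add_normalMap (h₁ : ∀ a v w, g₁ a v w = g₁ a w v) (z w : E) :
    g₁ z w w + 2 * ⟪w, -leviCivita g₁ z w⟫ = 0 := by
  rw [← inner_leviCivita_add h₁ z w w, inner_neg_right, real_inner_comm]
  ring

theorem metric_jet_two_add_normalMap (h₁ : ∀ a v w, g₁ a v w = g₁ a w v)
    (h₂ : ∀ a b v w, g₂ a b v w = g₂ b a v w) (h₂' : ∀ a b v w, g₂ a b v w = g₂ a b w v)
    (z w : E) :
    g₁ (-(1 / 2 : ℝ) • leviCivita g₁ z z) w w + 1 / 2 * g₂ z z w w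
      + 2 * g₁ z w (-leviCivita g₁ z w) + ⟪-leviCivita g₁ z w, -leviCivita g₁ z w⟫
      + 2 * cubicFormDeriv g₁ g₂ z w w = -curvatureOfJet g₁ g₂ w z z w / 3 := by
  rw [map_smul, LinearMap.smul_apply, LinearMap.smul_apply, smul_eq_mul, map_neg, inner_neg_neg,
    ← inner_leviCivita_add h₁ (leviCivita g₁ z z) w w,
    ← inner_leviCivita_add h₁ z w (leviCivita g₁ z w), cubicFormDeriv, curvatureOfJet_apply,
    leviCivita_comm h₁ w z, leviCivita_comm h₁ w (leviCivita g₁ z z), h₂ w z z w, h₂' z w z w]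
  simp only [inner_add_left, map_add]
  ring

end NormalCoordinates

section MetricExpansion

variable {V : Type*} [AddCommGroup V] [Module ℝ V]

theorem isBigO_pow_mul {q : ℝ → ℝ} (hq : Continuous q) (k : ℕ) :
    (fun t : ℝ ↦ t ^ k * q t) =O[𝓝 0] fun t : ℝ ↦ t ^ k := by
  simpa using (isBigO_refl (fun t : ℝ ↦ t ^ k) (𝓝 0)).mul ((hq.tendsto 0).isBigO_one ℝ)

theorem isBigO_bilinear_curve {e : ℝ → V →ₗ[ℝ] V →ₗ[ℝ] ℝ}
    (he : ∀ v w, (fun t ↦ e t v w) =O[𝓝 0] fun t : ℝ ↦ t ^ 3) (w p X : V) :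
    (fun t ↦ e t (w + t • p + t ^ 2 • X) (w + t • p + t ^ 2 • X))
      =O[𝓝 0] fun t : ℝ ↦ t ^ 3 := by
  have hmul : ∀ (q : ℝ → ℝ) (v v' : V), Continuous q →
      (fun t ↦ q t * e t v v') =O[𝓝 0] fun t : ℝ ↦ t ^ 3 := fun q v v' hq ↦
    (((hq.tendsto 0).isBigO_one ℝ).mul (he v v')).congr_right fun t ↦ one_mul _
  have hleft : ∀ v, (fun t ↦ e t v (w + t • p + t ^ 2 • X)) =O[𝓝 0] fun t : ℝ ↦ t ^ 3 := by
    intro v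
    refine (((he v w).add (hmul (fun t ↦ t) v p (by fun_prop))).add
      (hmul (fun t ↦ t ^ 2) v X (by fun_prop))).congr_left fun t ↦ ?_
    simp only [map_add, map_smul, smul_eq_mul]
  have hmul' : ∀ (q : ℝ → ℝ) (v : V), Continuous q →
      (fun t ↦ q t * e t v (w + t • p + t ^ 2 • X)) =O[𝓝 0] fun t : ℝ ↦ t ^ 3 := fun q v hq ↦
    (((hq.tendsto 0).isBigO_one ℝ).mul (hleft v)).congr_right fun t ↦ one_mul _
  refine (((hleft w).add (hmul' (fun t ↦ t) p (by fun_prop))).add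
    (hmul' (fun t ↦ t ^ 2) X (by fun_prop))).congr_left fun t ↦ ?_
  simp only [map_add, map_smul, LinearMap.add_apply, LinearMap.smul_apply, smul_eq_mul]
  ring

theorem isBigO_quadratic_curve {B₀ B₁ B₂ : V →ₗ[ℝ] V →ₗ[ℝ] ℝ}
    (h₀ : ∀ v w, B₀ v w = B₀ w v) (h₁ : ∀ v w, B₁ v w = B₁ w v) (w p X : V) :
    (fun t : ℝ ↦ (B₀ + t • B₁ + t ^ 2 • B₂) (w + t • p + t ^ 2 • X) (w + t • p + t ^ 2 • X)
      - (B₀ w w + t * (B₁ w w + 2 * B₀ w p)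
        + t ^ 2 * (B₂ w w + 2 * B₁ w p + B₀ p p + 2 * B₀ w X)))
      =O[𝓝 0] fun t : ℝ ↦ t ^ 3 := by
  refine (isBigO_pow_mul (q := fun t ↦ B₂ w p + B₂ p w + B₁ p p + 2 * B₁ w X + 2 * B₀ p X
    + t * (B₂ p p + B₂ w X + B₂ X w + 2 * B₁ p X + B₀ X X)
    + t ^ 2 * (B₂ p X + B₂ X p + B₁ X X) + t ^ 3 * B₂ X X) (by fun_prop) 3).congr_left fun t ↦ ?_
  simp only [map_add, map_smul, LinearMap.add_apply, LinearMap.smul_apply, smul_eq_mul,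
    h₀ p w, h₀ X w, h₀ X p, h₁ p w, h₁ X w, h₁ X p]
  ring

variable {E : Type*} [NormedAddCommGroup E] [InnerProductSpace ℝ E]
  {g₁ : E →ₗ[ℝ] E →ₗ[ℝ] E →ₗ[ℝ] ℝ} {g₂ : E →ₗ[ℝ] E →ₗ[ℝ] E →ₗ[ℝ] E →ₗ[ℝ] ℝ}
  {G : E → E →ₗ[ℝ] E →ₗ[ℝ] ℝ}

local notation "⟪" x "," y "⟫" => inner ℝ x y

theorem isBigO_norm_curve_pow_three (z b c : E) :
    (fun t : ℝ ↦ ‖t • z + t ^ 2 • b + t ^ 3 • c‖ ^ 3) =O[𝓝 0] fun t : ℝ ↦ t ^ 3 := by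
  refine (IsBigO.norm_left ?_).pow 3
  have hcont : Continuous fun t : ℝ ↦ z + t • b + t ^ 2 • c := by fun_prop
  have h : (fun t : ℝ ↦ t • (z + t • b + t ^ 2 • c)) =O[𝓝 0] fun t : ℝ ↦ t • (1 : ℝ) :=
    (isBigO_refl (fun t : ℝ ↦ t) (𝓝 0)).smul (hcont.continuousAt.isBigO_one ℝ)
  exact h.congr (fun t ↦ by module) (fun t ↦ by simp)

theorem HasMetricJet.curve_expansion (hG : HasMetricJet G g₁ g₂) (z b c v w : E) :
    (fun t : ℝ ↦ G (t • z + t ^ 2 • b + t ^ 3 • c) v w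
      - (⟪v, w⟫ + t * g₁ z v w + t ^ 2 * (g₁ b v w + 1 / 2 * g₂ z z v w)))
      =O[𝓝 0] fun t : ℝ ↦ t ^ 3 := by
  have hcont : Continuous (fun t : ℝ ↦ t • z + t ^ 2 • b + t ^ 3 • c) := by fun_prop
  have hlim : Tendsto (fun t : ℝ ↦ t • z + t ^ 2 • b + t ^ 3 • c) (𝓝 0) (𝓝 0) := by
    simpa using hcont.tendsto 0
  have hTaylor := ((isBigO_sub_taylor_two (hG.contDiffAt v w)).comp_tendsto hlim).trans
    (isBigO_norm_curve_pow_three z b c)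
  refine (hTaylor.add (isBigO_pow_mul (q := fun t ↦ g₁ c v w
    + 1 / 2 * (g₂ z b v w + g₂ b z v w)
    + t * (1 / 2 * (g₂ b b v w + g₂ z c v w + g₂ c z v w))
    + t ^ 2 * (1 / 2 * (g₂ b c v w + g₂ c b v w))
    + t ^ 3 * (1 / 2 * g₂ c c v w)) (by fun_prop) 3)).congr_left fun t ↦ ?_
  simp only [Function.comp_apply, hG.fderiv, hG.fderiv₂, hG.zero, map_add, map_smul,
    LinearMap.add_apply, LinearMap.smul_apply, smul_eq_mul]
  ring

variable [FiniteDimensional ℝ E]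

/-- The deviation of the metric `G`, pulled back by `normalMap`, from its expansion
`δ - R(·, z, z, ·) / 3` in normal coordinates. -/
def normalMapDefect (G : E → E →ₗ[ℝ] E →ₗ[ℝ] ℝ) (g₁ : E →ₗ[ℝ] E →ₗ[ℝ] E →ₗ[ℝ] ℝ)
    (g₂ : E →ₗ[ℝ] E →ₗ[ℝ] E →ₗ[ℝ] E →ₗ[ℝ] ℝ) (z : E) : E →ₗ[ℝ] E →ₗ[ℝ] ℝ :=
  (G (normalMap g₁ g₂ z)).compl₁₂ (fderiv ℝ (normalMap g₁ g₂) z : E →ₗ[ℝ] E)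
      (fderiv ℝ (normalMap g₁ g₂) z : E →ₗ[ℝ] E)
    - (innerₗ E - (1 / 3 : ℝ) • ((curvatureOfJet g₁ g₂).flip z).flip z)

theorem normalMapDefect_self (z w : E) : normalMapDefect G g₁ g₂ z w w
    = G (normalMap g₁ g₂ z) (fderiv ℝ (normalMap g₁ g₂) z w) (fderiv ℝ (normalMap g₁ g₂) z w)
      - (‖w‖ ^ 2 - curvatureOfJet g₁ g₂ w z z w / 3) := by
  simp [normalMapDefect]
  ring

theorem contDiffAt_normalMapDefect (hG : HasMetricJet G g₁ g₂) (w : E) :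
    ContDiffAt ℝ 3 (fun z ↦ normalMapDefect G g₁ g₂ z w w) 0 := by
  have hφ : ContDiff ℝ 4 (normalMap g₁ g₂) := contDiff_normalMap g₁ g₂
  have hDφ : ContDiffAt ℝ 3 (fun z ↦ fderiv ℝ (normalMap g₁ g₂) z w) 0 :=
    (hφ.contDiffAt.fderiv_right (m := 3) (by norm_num)).clm_apply contDiffAt_const
  have hGφ : ∀ v w, ContDiffAt ℝ 3 (fun z ↦ G (normalMap g₁ g₂ z) v w) 0 := fun v w ↦
    ContDiffAt.comp (g := fun z ↦ G z v w) 0 (by rw [normalMap_zero]; exact hG.contDiffAt v w)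
      (hφ.contDiffAt.of_le (by norm_num))
  have hpull : ContDiffAt ℝ 3 (fun z ↦ G (normalMap g₁ g₂ z) (fderiv ℝ (normalMap g₁ g₂) z w)
      (fderiv ℝ (normalMap g₁ g₂) z w)) 0 :=
    contDiffAt_linearMap_apply (fun v ↦
      contDiffAt_linearMap_apply (l := fun z ↦ (G (normalMap g₁ g₂ z)).flip v)
        (fun v' ↦ hGφ v' v) hDφ) hDφ
  have hR : ContDiffAt ℝ 3 (fun z ↦ curvatureOfJet g₁ g₂ w z z w) 0 :=
    contDiffAt_linearMap_apply (l := fun z ↦ (curvatureOfJet g₁ g₂ w z).flip w) (fun v ↦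
      contDiffAt_linearMap_apply (l := fun _ ↦ ((curvatureOfJet g₁ g₂ w).flip v).flip w)
        (fun _ ↦ contDiffAt_const) contDiffAt_id) contDiffAt_id
  simp only [normalMapDefect_self]
  exact hpull.sub (contDiffAt_const.sub (hR.div_const 3))

theorem isBigO_normalMapDefect_line (hG : HasMetricJet G g₁ g₂) (z w : E) :
    (fun t : ℝ ↦ normalMapDefect G g₁ g₂ (t • z) w w) =O[𝓝 0] fun t : ℝ ↦ t ^ 3 := by
  obtain ⟨X, hX, hDφ⟩ := fderiv_normalMap_smul g₂ hG.symm₁ z w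
  set p := -leviCivita g₁ z w with hp
  set b := -(1 / 2 : ℝ) • leviCivita g₁ z z with hb
  let B₂ : E →ₗ[ℝ] E →ₗ[ℝ] ℝ := g₁ b + (1 / 2 : ℝ) • g₂ z z
  have herr := isBigO_bilinear_curve
    (e := fun t ↦ G (normalMap g₁ g₂ (t • z)) - (innerₗ E + t • g₁ z + t ^ 2 • B₂))
    (fun v v' ↦ (hG.curve_expansion z b (sharp (cubicForm g₁ g₂ z)) v v').congr_left
      fun t ↦ by
        simp only [normalMap_smul, ← hb, B₂, LinearMap.sub_apply, LinearMap.add_apply,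
          LinearMap.smul_apply, innerₗ_apply_apply, smul_eq_mul]) w p X
  have hpoly := isBigO_quadratic_curve (B₀ := innerₗ E) (B₁ := g₁ z) (B₂ := B₂)
    (fun v v' ↦ real_inner_comm v' v) (hG.symm₁ z) w p X
  refine (herr.add hpoly).congr_left fun t ↦ ?_
  have hjet₁ := metric_jet_one_add_normalMap hG.symm₁ z w
  have hjet₂ := metric_jet_two_add_normalMap hG.symm₁ hG.comm₂ hG.symm₂ z w
  rw [← hX, real_inner_comm w X, ← hp, ← hb] at hjet₂
  rw [normalMapDefect_self, hDφ]
  simp only [B₂, map_smul, LinearMap.smul_apply, LinearMap.add_apply, LinearMap.sub_apply,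
    innerₗ_apply_apply, smul_eq_mul, real_inner_self_eq_norm_sq w]
  linear_combination (-t) * hjet₁ - t ^ 2 * hjet₂

theorem exists_normalMap_metric_expansion (hG : HasMetricJet G g₁ g₂) :
    ∃ C, 0 ≤ C ∧ ∀ᶠ z in 𝓝 0, ∀ w,
      |G (normalMap g₁ g₂ z) (fderiv ℝ (normalMap g₁ g₂) z w) (fderiv ℝ (normalMap g₁ g₂) z w)
        - (‖w‖ ^ 2 - curvatureOfJet g₁ g₂ w z z w / 3)| ≤ C * ‖z‖ ^ 3 * ‖w‖ ^ 2 := by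
  simp only [← normalMapDefect_self]
  exact exists_bound_of_quadratic_isBigO (fun z ↦ by positivity) fun w ↦
    isBigO_norm_pow_three_of_lines (contDiffAt_normalMapDefect hG w) fun z ↦
      isBigO_normalMapDefect_line hG z w

end MetricExpansion

/-! ### Lengths of paths in coordinates -/

section MatrixForm

variable {n : ℕ}

/-- The bilinear form of a matrix on Euclidean space. -/
def matrixBilin (m : Matrix (Fin n) (Fin n) ℝ) :
    EuclideanSpace ℝ (Fin n) →ₗ[ℝ] EuclideanSpace ℝ (Fin n) →ₗ[ℝ] ℝ :=
  Matrix.toBilin (EuclideanSpace.basisFun (Fin n) ℝ).toBasis m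

theorem matrixBilin_apply (m : Matrix (Fin n) (Fin n) ℝ) (v w : EuclideanSpace ℝ (Fin n)) :
    matrixBilin m v w = ∑ i, ∑ j, m i j * v i * w j := by
  simp only [matrixBilin, Matrix.toBilin_apply, OrthonormalBasis.coe_toBasis_repr_apply,
    EuclideanSpace.basisFun_repr]
  exact Finset.sum_congr rfl fun i _ ↦ Finset.sum_congr rfl fun j _ ↦ by ring

theorem matrixBilin_self_eq_dotProduct (m : Matrix (Fin n) (Fin n) ℝ)
    (v : EuclideanSpace ℝ (Fin n)) :
    matrixBilin m v v = star v.ofLp ⬝ᵥ Matrix.mulVec m v.ofLp := by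
  simp only [matrixBilin_apply, dotProduct, Matrix.mulVec, Finset.mul_sum, star_trivial]
  exact Finset.sum_congr rfl fun i _ ↦ Finset.sum_congr rfl fun j _ ↦ by ring

end MatrixForm

section ManifoldMetric

open RiemannianCoord

variable {n : ℕ} {H : Type*} [TopologicalSpace H]
  {I : ModelWithCorners ℝ (EuclideanSpace ℝ (Fin n)) H}
  {M : Type*} [TopologicalSpace M] [ChartedSpace H M]

local notation "𝔼" => EuclideanSpace ℝ (Fin n)

theorem eq_zero_of_mfderivWithin_extChartAt_symm_eq_zero [IsManifold I 1 M] (x : M) {y : 𝔼}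
    (hy : y ∈ (extChartAt I x).target) {v : 𝔼}
    (hv : mfderivWithin 𝓘(ℝ, 𝔼) I (extChartAt I x).symm (range I) y v = 0) : v = 0 := by
  have hinv : mfderiv I 𝓘(ℝ, 𝔼) (extChartAt I x) ((extChartAt I x).symm y)
      (mfderivWithin 𝓘(ℝ, 𝔼) I (extChartAt I x).symm (range I) y v) = v :=
    DFunLike.congr_fun (mfderiv_extChartAt_comp_mfderivWithin_extChartAt_symm (I := I) hy) v
  rw [hv, map_zero] at hinv
  exact hinv.symm

theorem contMDiffWithinAt_coordField {k : ℕ∞ω} [IsManifold I 1 M] [IsManifold I (k + 1) M] (x : M)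
    {y : 𝔼} (hy : y ∈ interior (extChartAt I x).target) (i : Fin n) :
    ContMDiffWithinAt 𝓘(ℝ, 𝔼) I.tangent k
      (fun z ↦ (⟨(extChartAt I x).symm z, coordField I x i z⟩ : TangentBundle I M))
      (interior (extChartAt I x).target) y := by
  set s := interior (extChartAt I x).target
  have hs : IsOpen s := isOpen_interior
  have hsymm : ContMDiffOn 𝓘(ℝ, 𝔼) I (k + 1) (extChartAt I x).symm s :=
    (contMDiffOn_extChartAt_symm x).mono interior_subset
  have htangent := hsymm.contMDiffOn_tangentMapWithin (m := k) le_rfl hs.uniqueMDiffOn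
  have hconst : ContMDiffWithinAt 𝓘(ℝ, 𝔼) (𝓘(ℝ, 𝔼)).tangent k
      (fun z ↦ (⟨z, (EuclideanSpace.single i (1 : ℝ) : 𝔼)⟩ : TangentBundle 𝓘(ℝ, 𝔼) 𝔼)) s y :=
    contMDiffWithinAt_vectorSpace_iff_contDiffWithinAt.2 contDiffWithinAt_const
  refine ((htangent ⟨y, (EuclideanSpace.single i (1 : ℝ) : 𝔼)⟩ hy).comp y hconst
    fun z hz ↦ hz).congr_of_mem (fun z hz ↦ ?_) hy
  have hrange : range I ∈ 𝓝 z :=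
    mem_of_superset (hs.mem_nhds hz) (interior_subset.trans (extChartAt_target_subset_range x))
  simp only [Function.comp_apply, tangentMapWithin, coordField]
  rw [mfderivWithin_of_mem_nhds (hs.mem_nhds hz), mfderivWithin_of_mem_nhds hrange]

theorem mfderivWithin_extChartAt_symm_eq_sum (x : M) (y v : 𝔼) :
    mfderivWithin 𝓘(ℝ, 𝔼) I (extChartAt I x).symm (range I) y v
      = ∑ i, v i • coordField I x i y := by
  have h := linearMap_apply_eq_sum (EuclideanSpace.basisFun (Fin n) ℝ)
    (mfderivWithin 𝓘(ℝ, 𝔼) I (extChartAt I x).symm (range I) y :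
      𝔼 →L[ℝ] TangentSpace I ((extChartAt I x).symm y)).toLinearMap v
  simp only [EuclideanSpace.basisFun_apply, EuclideanSpace.inner_single_left, map_one,
    one_mul] at h
  exact h

variable [RiemannianBundle (fun p : M ↦ TangentSpace I p)]

theorem metric_symm (x : M) (y : 𝔼) (i j : Fin n) : metric I x y i j = metric I x y j i := by
  simp only [metric, Matrix.of_apply, real_inner_comm]

theorem norm_sq_mfderivWithin_extChartAt_symm (x : M) (y v : 𝔼) :
    ‖mfderivWithin 𝓘(ℝ, 𝔼) I (extChartAt I x).symm (range I) y v‖ ^ 2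
      = matrixBilin (metric I x y) v v := by
  rw [mfderivWithin_extChartAt_symm_eq_sum, ← real_inner_self_eq_norm_sq, sum_inner,
    matrixBilin_apply]
  refine Finset.sum_congr rfl fun i _ ↦ ?_
  rw [inner_sum]
  refine Finset.sum_congr rfl fun j _ ↦ ?_
  rw [inner_smul_left, inner_smul_right, metric, Matrix.of_apply, conj_trivial]
  ring

theorem posDef_metric [IsManifold I 1 M] (x : M) {y : 𝔼} (hy : y ∈ (extChartAt I x).target) :
    (metric I x y).PosDef := by
  refine Matrix.PosDef.of_dotProduct_mulVec_pos ?_ fun v hv ↦ ?_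
  · ext i j
    exact metric_symm x y j i
  · rw [← WithLp.ofLp_toLp 2 v, ← matrixBilin_self_eq_dotProduct,
      ← norm_sq_mfderivWithin_extChartAt_symm]
    refine pow_pos (norm_pos_iff.2 fun h ↦ hv ?_) 2
    simpa using congrArg WithLp.ofLp (eq_zero_of_mfderivWithin_extChartAt_symm_eq_zero x hy h)

theorem contDiffAt_metric {k : ℕ∞ω} [IsManifold I 1 M] [IsManifold I (k + 1) M]
    [IsContMDiffRiemannianBundle I k 𝔼 (fun p : M ↦ TangentSpace I p)]
    (x : M) {y : 𝔼} (hy : y ∈ interior (extChartAt I x).target) (i j : Fin n) :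
    ContDiffAt ℝ k (fun z ↦ metric I x z i j) y := by
  have hinner := (contMDiffWithinAt_coordField (k := k) x hy i).inner_bundle
    (contMDiffWithinAt_coordField (k := k) x hy j)
  exact (contMDiffWithinAt_iff_contDiffWithinAt.1 hinner).contDiffAt (isOpen_interior.mem_nhds hy)

/-- The squared length of the image of the vector `w` at `z` under the parametrization
`(extChartAt I x).symm ∘ Φ` of `M`. -/
def pullbackForm (I : ModelWithCorners ℝ 𝔼 H) {M : Type*} [TopologicalSpace M] [ChartedSpace H M]
    [RiemannianBundle (fun p : M ↦ TangentSpace I p)] (x : M) (Φ : 𝔼 → 𝔼) (z w : 𝔼) : ℝ :=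
  matrixBilin (metric I x (Φ z)) (fderiv ℝ Φ z w) (fderiv ℝ Φ z w)

end ManifoldMetric

section ManifoldPaths

open RiemannianCoord MeasureTheory Manifold

variable {n : ℕ} {H : Type*} [TopologicalSpace H]
  {I : ModelWithCorners ℝ (EuclideanSpace ℝ (Fin n)) H} {M : Type*}

local notation "𝔼" => EuclideanSpace ℝ (Fin n)

section Length

variable [TopologicalSpace M] [ChartedSpace H M] [IsManifold I 1 M]

theorem mfderivWithin_extChartAt_symm_comp (x : M) {y : ℝ → 𝔼}
    (hy : ContDiffOn ℝ 1 y (Icc 0 1)) (hyt : ∀ t ∈ Icc (0 : ℝ) 1, y t ∈ (extChartAt I x).target)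
    {t : ℝ} (ht : t ∈ Icc (0 : ℝ) 1) :
    mfderivWithin 𝓘(ℝ, ℝ) I ((extChartAt I x).symm ∘ y) (Icc 0 1) t (1 : ℝ)
      = mfderivWithin 𝓘(ℝ, 𝔼) I (extChartAt I x).symm (range I) (y t)
        (derivWithin y (Icc 0 1) t) := by
  have hu : UniqueDiffWithinAt ℝ (Icc (0 : ℝ) 1) t := uniqueDiffOn_Icc zero_lt_one t ht
  have hcomp : mfderivWithin 𝓘(ℝ, ℝ) I ((extChartAt I x).symm ∘ y) (Icc 0 1) t =
      (mfderivWithin 𝓘(ℝ, 𝔼) I (extChartAt I x).symm (range I) (y t)) ∘L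
        (mfderivWithin 𝓘(ℝ, ℝ) 𝓘(ℝ, 𝔼) y (Icc 0 1) t) :=
    mfderivWithin_comp _ (mdifferentiableWithinAt_extChartAt_symm (hyt t ht))
      (hy.differentiableOn one_ne_zero t ht).mdifferentiableWithinAt
      (fun s hs ↦ extChartAt_target_subset_range x (hyt s hs))
      (uniqueMDiffWithinAt_iff_uniqueDiffWithinAt.2 hu)
  rw [hcomp, mfderivWithin_eq_fderivWithin]
  rfl

/-- `ζ` is a `C¹` inverse, defined on `U`, of the parametrization `(extChartAt I x).symm ∘ Φ` of
`M`. -/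
structure IsParamInverse (x : M) (Φ : 𝔼 → 𝔼) (ζ : M → 𝔼) (U : Set M) : Prop where
  contMDiffOn : ContMDiffOn I 𝓘(ℝ, 𝔼) 1 ζ U
  mem_target : ∀ p ∈ U, Φ (ζ p) ∈ (extChartAt I x).target
  symm_apply : ∀ p ∈ U, (extChartAt I x).symm (Φ (ζ p)) = p

theorem exists_isParamInverse (x : M) (hx : I.IsInteriorPoint x) {Φ : 𝔼 → 𝔼}
    (hΦ : ContDiff ℝ 1 Φ) (hΦ₀ : Φ 0 = extChartAt I x x) {Φ' : 𝔼 ≃L[ℝ] 𝔼}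
    (hΦ' : fderiv ℝ Φ 0 = Φ') {r : ℝ} (hr : 0 < r) :
    ∃ ζ : M → 𝔼, ∃ U ∈ 𝓝 x, IsParamInverse (I := I) x Φ ζ U ∧ (∀ p ∈ U, ‖ζ p‖ < r) ∧
      ∀ᶠ z in 𝓝 0, ζ ((extChartAt I x).symm (Φ z)) = z := by
  have hcd : ContDiffAt ℝ 1 Φ 0 := hΦ.contDiffAt
  have hfd : HasFDerivAt Φ (Φ' : 𝔼 →L[ℝ] 𝔼) 0 :=
    hΦ' ▸ (hΦ.differentiable one_ne_zero 0).hasFDerivAt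
  have hstrict := hcd.hasStrictFDerivAt' hfd one_ne_zero
  set η := hcd.localInverse hfd one_ne_zero
  have hη : ContDiffAt ℝ 1 η (extChartAt I x x) := hΦ₀ ▸ hcd.to_localInverse hfd one_ne_zero
  have hη₀ : η (extChartAt I x x) = 0 := hΦ₀ ▸ hcd.localInverse_apply_image hfd one_ne_zero
  have hright : ∀ᶠ y in 𝓝 (extChartAt I x x), Φ (η y) = y :=
    hΦ₀ ▸ hstrict.eventually_right_inverse
  have hleft : ∀ᶠ z in 𝓝 0, η (Φ z) = z := hstrict.eventually_left_inverse
  have hsmall : ∀ᶠ y in 𝓝 (extChartAt I x x), ‖η y‖ < r :=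
    hη.continuousAt.norm.eventually (gt_mem_nhds (by simpa only [hη₀, norm_zero]))
  have htarget : ∀ᶠ z in 𝓝 0, Φ z ∈ (extChartAt I x).target :=
    hΦ.continuous.continuousAt.eventually_mem
      (hΦ₀ ▸ mem_interior_iff_mem_nhds.1 (I.isInteriorPoint_iff.1 hx))
  refine ⟨η ∘ extChartAt I x, _, inter_mem (extChartAt_source_mem_nhds (I := I) x)
    ((continuousAt_extChartAt x).eventually
      (hright.and (hsmall.and (hη.eventually (by simp))))), ⟨?_, ?_, ?_⟩, ?_, ?_⟩
  · rintro p ⟨hp, -, -, hηp⟩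
    exact (hηp.contMDiffAt.comp p (contMDiffAt_extChartAt' (by simpa using hp))).contMDiffWithinAt
  · rintro p ⟨hp, hΦη, -⟩
    simpa only [Function.comp_apply, hΦη] using (extChartAt I x).map_source hp
  · rintro p ⟨hp, hΦη, -⟩
    rw [Function.comp_apply, hΦη, (extChartAt I x).left_inv hp]
  · exact fun p hp ↦ hp.2.2.1
  · filter_upwards [hleft, htarget] with z hz hzt
    rw [Function.comp_apply, (extChartAt I x).right_inv hzt, hz]

variable [RiemannianBundle (fun p : M ↦ TangentSpace I p)]

theorem norm_sq_mfderivWithin_extChartAt_symm_comp (x : M) {y : ℝ → 𝔼}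
    (hy : ContDiffOn ℝ 1 y (Icc 0 1)) (hyt : ∀ t ∈ Icc (0 : ℝ) 1, y t ∈ (extChartAt I x).target)
    {t : ℝ} (ht : t ∈ Icc (0 : ℝ) 1) :
    ‖mfderivWithin 𝓘(ℝ, ℝ) I ((extChartAt I x).symm ∘ y) (Icc 0 1) t (1 : ℝ)‖ ^ 2
      = matrixBilin (metric I x (y t)) (derivWithin y (Icc 0 1) t) (derivWithin y (Icc 0 1) t) := by
  rw [mfderivWithin_extChartAt_symm_comp x hy hyt ht]
  exact norm_sq_mfderivWithin_extChartAt_symm x (y t) _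

theorem pathELength_parametrized_curve (x : M) {Φ : 𝔼 → 𝔼} (hΦ : ContDiff ℝ 1 Φ)
    {z : ℝ → 𝔼} (hz : ContDiffOn ℝ 1 z (Icc 0 1))
    (hzt : ∀ t ∈ Icc (0 : ℝ) 1, Φ (z t) ∈ (extChartAt I x).target) :
    pathELength I ((extChartAt I x).symm ∘ Φ ∘ z) 0 1 = ∫⁻ t in Icc (0 : ℝ) 1,
      ENNReal.ofReal √(pullbackForm I x Φ (z t) (derivWithin z (Icc 0 1) t)) := by
  rw [pathELength_eq_lintegral_mfderivWithin_Icc]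
  refine setLIntegral_congr_fun measurableSet_Icc fun t ht ↦ ?_
  have hchain : derivWithin (Φ ∘ z) (Icc 0 1) t = fderiv ℝ Φ (z t) (derivWithin z (Icc 0 1) t) :=
    (((hΦ.differentiable one_ne_zero (z t)).hasFDerivAt).comp_hasDerivWithinAt t
      ((hz.differentiableOn one_ne_zero t ht).hasDerivWithinAt)).derivWithin
      (uniqueDiffOn_Icc zero_lt_one t ht)
  rw [pullbackForm, ← hchain, ← Function.comp_apply (f := Φ),
    ← norm_sq_mfderivWithin_extChartAt_symm_comp x (hΦ.comp_contDiffOn hz) hzt ht,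
    Real.sqrt_sq (norm_nonneg _)]
  exact (ofReal_norm _).symm

/-- The calibration argument: a function of the parameter whose differential is at most `Λ` on
unit vectors increases along a path by at most `Λ` times its length. -/
theorem IsParamInverse.abs_sub_le_mul_pathELength {x : M} {Φ : 𝔼 → 𝔼} (hΦ : ContDiff ℝ 1 Φ)
    {ζ : M → 𝔼} {U : Set M} (hζ : IsParamInverse (I := I) x Φ ζ U) {γ : ℝ → M}
    (hγ : ContMDiffOn 𝓘(ℝ, ℝ) I 1 γ (Icc 0 1)) (hγU : MapsTo γ (Icc 0 1) U)
    {f : 𝔼 → ℝ} (hf : ContDiff ℝ 1 f) {Λ : ℝ} (hΛ : 0 ≤ Λ)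
    (hbound : ∀ t ∈ Icc (0 : ℝ) 1, ∀ w,
      |fderiv ℝ f (ζ (γ t)) w| ≤ Λ * √(pullbackForm I x Φ (ζ (γ t)) w)) :
    ENNReal.ofReal |f (ζ (γ 1)) - f (ζ (γ 0))| ≤ ENNReal.ofReal Λ * pathELength I γ 0 1 := by
  have hz : ContDiffOn ℝ 1 (ζ ∘ γ) (Icc 0 1) :=
    contMDiffOn_iff_contDiffOn.1 (hζ.contMDiffOn.comp hγ hγU)
  have hγz : EqOn γ ((extChartAt I x).symm ∘ Φ ∘ ζ ∘ γ) (Icc 0 1) := fun t ht ↦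
    (hζ.symm_apply _ (hγU ht)).symm
  rw [pathELength_congr hγz, pathELength_parametrized_curve x hΦ hz
    fun t ht ↦ hζ.mem_target _ (hγU ht), ← lintegral_const_mul' _ _ ENNReal.ofReal_ne_top,
    ← Real.norm_eq_abs, ofReal_norm]
  refine (enorm_sub_le_lintegral_derivWithin_Icc_of_contDiffOn_Icc (hf.comp_contDiffOn hz)
    zero_le_one).trans (setLIntegral_mono' measurableSet_Icc fun t ht ↦ ?_)
  have hchain : derivWithin (f ∘ ζ ∘ γ) (Icc 0 1) t
      = fderiv ℝ f (ζ (γ t)) (derivWithin (ζ ∘ γ) (Icc 0 1) t) :=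
    (((hf.differentiable one_ne_zero _).hasFDerivAt).comp_hasDerivWithinAt t
      ((hz.differentiableOn one_ne_zero t ht).hasDerivWithinAt)).derivWithin
      (uniqueDiffOn_Icc zero_lt_one t ht)
  rw [hchain, ← ofReal_norm, ← ENNReal.ofReal_mul hΛ, Real.norm_eq_abs]
  exact ENNReal.ofReal_le_ofReal (hbound t ht _)

end Length

variable [PseudoEMetricSpace M] [ChartedSpace H M] [IsManifold I 1 M]
  [RiemannianBundle (fun p : M ↦ TangentSpace I p)]

theorem edist_le_of_pullbackForm_le [IsRiemannianManifold I M] (x : M) {Φ : 𝔼 → 𝔼}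
    (hΦ : ContDiff ℝ 1 Φ) {u v : 𝔼} {m : ℝ} (hm : 0 ≤ m)
    (htarget : ∀ t ∈ Icc (0 : ℝ) 1, Φ (u + t • (v - u)) ∈ (extChartAt I x).target)
    (hle : ∀ t ∈ Icc (0 : ℝ) 1, pullbackForm I x Φ (u + t • (v - u)) (v - u) ≤ m ^ 2) :
    edist ((extChartAt I x).symm (Φ u)) ((extChartAt I x).symm (Φ v)) ≤ ENNReal.ofReal m := by
  set z : ℝ → 𝔼 := fun t ↦ u + t • (v - u)
  have hz : ContDiff ℝ 1 z := by fun_prop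
  have hderiv : ∀ t ∈ Icc (0 : ℝ) 1, derivWithin z (Icc 0 1) t = v - u := fun t ht ↦ by
    have h := ((hasDerivAt_id t).smul_const (v - u)).const_add u
    rw [one_smul] at h
    exact h.hasDerivWithinAt.derivWithin (uniqueDiffOn_Icc zero_lt_one t ht)
  have hγ : ContMDiffOn 𝓘(ℝ, ℝ) I 1 ((extChartAt I x).symm ∘ Φ ∘ z) (Icc 0 1) :=
    (contMDiffOn_extChartAt_symm x).comp (hΦ.comp hz).contMDiff.contMDiffOn htarget
  rw [IsRiemannianManifold.out (I := I)]
  refine (riemannianEDist_le_pathELength hγ (by simp [z]) (by simp [z]) zero_le_one).trans ?_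
  rw [pathELength_parametrized_curve x hΦ hz.contDiffOn htarget]
  calc ∫⁻ t in Icc (0 : ℝ) 1, ENNReal.ofReal √(pullbackForm I x Φ (z t) (derivWithin z (Icc 0 1) t))
      ≤ ∫⁻ _ in Icc (0 : ℝ) 1, ENNReal.ofReal m := by
        refine setLIntegral_mono' measurableSet_Icc fun t ht ↦ ENNReal.ofReal_le_ofReal ?_
        rw [hderiv t ht]
        exact Real.sqrt_le_iff.2 ⟨hm, hle t ht⟩
    _ = ENNReal.ofReal m := by simp

end ManifoldPaths

/-! ### Calibration -/

section PlaneWave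

variable {E : Type*} [NormedAddCommGroup E] [InnerProductSpace ℝ E]

local notation "⟪" x "," y "⟫" => inner ℝ x y

/-- An approximate solution of the eikonal equation `‖∇f‖ = 1` for a metric with curvature `R` at
the origin of normal coordinates; its level sets approximate wave fronts moving in direction
`a`. -/
def planeWave (R : E →ₗ[ℝ] E →ₗ[ℝ] E →ₗ[ℝ] E →ₗ[ℝ] ℝ) (a z : E) : ℝ :=
  ⟪a, z⟫ * (1 - R z a a z / 6)

variable {R : E →ₗ[ℝ] E →ₗ[ℝ] E →ₗ[ℝ] E →ₗ[ℝ] ℝ}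

theorem planeWave_add_smul_sub (hR : IsCurvatureLike R) {a : E} (ha : ‖a‖ = 1) (u : E) (t : ℝ) :
    planeWave R a (u + t • a) - planeWave R a u = t * (1 - R a u u a / 6) := by
  have hswap : R u a a u = R a u u a := by rw [hR.anti₁₂, hR.anti₃₄, neg_neg]
  simp only [planeWave, inner_add_right, inner_smul_right, inner_self_eq_one_of_norm_eq_one ha,
    map_add, map_smul, LinearMap.add_apply, LinearMap.smul_apply, smul_eq_mul, hR.self₁₂,
    hR.self₃₄, hswap]
  ring

/-- The elementary inequality behind `sq_fderiv_planeWave_le`, in terms of the components `α` and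
`β` of a vector along and across the direction of a plane wave. -/
theorem sq_mul_sub_le {α β k m c q e h : ℝ} (hβ : 0 ≤ β) (hq : q ≤ 1 / 2) (hk : |k| ≤ q)
    (hm : |m| ≤ q * β) (hc : |c| ≤ 2 * q * |α| * β + q * β ^ 2)
    (hh : α ^ 2 + β ^ 2 - (α ^ 2 * k + c) / 3 - e * (α ^ 2 + β ^ 2) ≤ h) :
    (α * (1 - k / 6) - m) ^ 2 ≤ h + (13 * q ^ 2 + e) * (α ^ 2 + β ^ 2) := by
  have hq₀ : 0 ≤ q := (abs_nonneg k).trans hk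
  have hk₂ : α ^ 2 * k ^ 2 ≤ α ^ 2 * q ^ 2 := by rw [← sq_abs k]; gcongr
  have hm₂ : m ^ 2 ≤ q ^ 2 * β ^ 2 := by rw [← sq_abs m, ← mul_pow]; gcongr
  have hcross : -(2 * α * (1 - k / 6) * m) ≤ 4 * q * |α| * β := by
    have hk' : |1 - k / 6| ≤ 2 := by
      rw [abs_le] at hk ⊢
      constructor <;> linarith [hk.1, hk.2]
    calc -(2 * α * (1 - k / 6) * m) ≤ |2 * α * (1 - k / 6) * m| := neg_le_abs _
      _ = 2 * |α| * |1 - k / 6| * |m| := by simp [abs_mul]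
      _ ≤ 2 * |α| * 2 * (q * β) := by gcongr
      _ = 4 * q * |α| * β := by ring
  have hamgm : 5 * q * |α| * β ≤ β ^ 2 / 2 + 25 / 2 * q ^ 2 * α ^ 2 := by
    rw [← sq_abs α]
    linarith [sq_nonneg (β - 5 * q * |α|)]
  have hβ₂ : q ^ 2 * β ^ 2 + q * β ^ 2 / 3 ≤ β ^ 2 / 2 := by
    have : q ^ 2 ≤ 1 / 4 := by nlinarith
    nlinarith [sq_nonneg β]
  have hqα : 0 ≤ q * |α| * β := by positivity
  have hqβ : 0 ≤ q ^ 2 * β ^ 2 := by positivity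
  have hqα₂ : 0 ≤ α ^ 2 * q ^ 2 := by positivity
  linarith [le_of_abs_le hc]

variable [FiniteDimensional ℝ E]

theorem contDiff_planeWave (a : E) {k : ℕ∞ω} : ContDiff ℝ k (planeWave R a) := by
  have hquad : ContDiff ℝ k fun z ↦ R z a a z :=
    contDiff_linearMap_apply (l := fun z ↦ R z a a) (fun v ↦
      contDiff_linearMap_apply (l := fun _ ↦ ((R.flip a).flip a).flip v)
        (fun _ ↦ contDiff_const) contDiff_id) contDiff_id
  exact (contDiff_const.inner ℝ contDiff_id).mul (contDiff_const.sub (hquad.div_const 6))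

theorem fderiv_planeWave (a z w : E) :
    fderiv ℝ (planeWave R a) z w
      = ⟪a, w⟫ * (1 - R z a a z / 6) - ⟪a, z⟫ * (R w a a z + R z a a w) / 6 := by
  have hpoly : (fun s : ℝ ↦ planeWave R a (z + s • w)) = fun s ↦ (⟪a, z⟫ + s * ⟪a, w⟫) *
      (1 - (R z a a z + s * (R w a a z + R z a a w) + s ^ 2 * R w a a w) / 6) := by
    funext s
    simp only [planeWave, inner_add_right, inner_smul_right, map_add, map_smul,
      LinearMap.add_apply, LinearMap.smul_apply, smul_eq_mul]
    ring
  have hline : HasDerivAt (fun s : ℝ ↦ planeWave R a (z + s • w)) (fderiv ℝ (planeWave R a) z w)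
      0 := by
    refine HasFDerivAt.comp_hasDerivAt_of_eq 0 (((contDiff_planeWave a).differentiable
      one_ne_zero z).hasFDerivAt) ?_ (by simp)
    simpa using ((hasDerivAt_id (0 : ℝ)).smul_const w).const_add z
  have hlin (c : ℝ) : HasDerivAt (fun s : ℝ ↦ s * c) c 0 := by
    simpa using (hasDerivAt_id (0 : ℝ)).mul_const c
  have hsq (c : ℝ) : HasDerivAt (fun s : ℝ ↦ s ^ 2 * c) 0 0 := by
    simpa using (hasDerivAt_pow 2 (0 : ℝ)).mul_const c
  rw [hpoly] at hline
  rw [hline.unique (((hlin _).const_add _).fun_mul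
    (((((hlin _).const_add _).fun_add (hsq _)).div_const 6).const_sub 1))]
  ring

theorem sq_fderiv_planeWave_le (hR : IsCurvatureLike R) {C : ℝ}
    (hbound : ∀ a b c d, |R a b c d| ≤ C * ‖a‖ * ‖b‖ * ‖c‖ * ‖d‖) {a z w : E} (ha : ‖a‖ = 1)
    (hsmall : C * ‖z‖ ^ 2 ≤ 1 / 2) {e h : ℝ}
    (hh : ‖w‖ ^ 2 - R w z z w / 3 - e * ‖w‖ ^ 2 ≤ h) :
    fderiv ℝ (planeWave R a) z w ^ 2 ≤ h + (13 * (C * ‖z‖ ^ 2) ^ 2 + e) * ‖w‖ ^ 2 := by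
  have haa := inner_self_eq_one_of_norm_eq_one (𝕜 := ℝ) ha
  obtain ⟨α, b, rfl, hab⟩ : ∃ (α : ℝ) (b : E), w = α • a + b ∧ ⟪a, b⟫ = 0 :=
    ⟨⟪a, w⟫, w - ⟪a, w⟫ • a, by abel, by rw [inner_sub_right, inner_smul_right, haa]; ring⟩
  have hnorm : ‖α • a + b‖ ^ 2 = α ^ 2 + ‖b‖ ^ 2 := by
    rw [norm_add_sq_real, inner_smul_left, hab, norm_smul, ha]; simp
  have hfderiv : fderiv ℝ (planeWave R a) z (α • a + b)
      = α * (1 - R z a a z / 6) - ⟪a, z⟫ * (R b a a z + R z a a b) / 6 := by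
    rw [fderiv_planeWave]
    simp only [inner_add_right, inner_smul_right, haa, hab, map_add, map_smul,
      LinearMap.add_apply, LinearMap.smul_apply, smul_eq_mul, hR.self₁₂, hR.self₃₄]
    ring
  have hcurv : R (α • a + b) z z (α • a + b)
      = α ^ 2 * R z a a z + (α * (R a z z b + R b z z a) + R b z z b) := by
    have hswap : R a z z a = R z a a z := by rw [hR.anti₁₂, hR.anti₃₄, neg_neg]
    simp only [map_add, map_smul, LinearMap.add_apply, LinearMap.smul_apply, smul_eq_mul, hswap]
    ring
  have hinner : |⟪a, z⟫| ≤ ‖z‖ := by simpa [ha] using abs_real_inner_le_norm a z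
  rw [hnorm, hcurv] at hh
  rw [hfderiv, hnorm]
  refine sq_mul_sub_le (norm_nonneg b) hsmall ((hbound z a a z).trans_eq ?_) ?_ ?_ hh
  · rw [ha]; ring
  · have hsum : |R b a a z + R z a a b| ≤ 2 * (C * ‖z‖ * ‖b‖) :=
      (abs_add_le _ _).trans (by
        have := hbound b a a z; have := hbound z a a b; rw [ha] at *; linarith)
    rw [abs_div, abs_mul, abs_of_pos (by norm_num : (0 : ℝ) < 6)]
    have := mul_le_mul hinner hsum (abs_nonneg _) (norm_nonneg z)
    nlinarith [abs_nonneg (R b a a z + R z a a b), norm_nonneg z]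
  · have hsum : |R a z z b + R b z z a| ≤ 2 * (C * ‖z‖ ^ 2) * ‖b‖ :=
      (abs_add_le _ _).trans (by
        have := hbound a z z b; have := hbound b z z a; rw [ha] at *; linarith)
    calc |α * (R a z z b + R b z z a) + R b z z b|
        ≤ |α| * |R a z z b + R b z z a| + |R b z z b| := by rw [← abs_mul]; exact abs_add_le _ _
      _ ≤ |α| * (2 * (C * ‖z‖ ^ 2) * ‖b‖) + C * ‖b‖ * ‖z‖ * ‖z‖ * ‖b‖ := by
          gcongr
          exact hbound b z z b
      _ = _ := by ring

theorem abs_fderiv_planeWave_le (hR : IsCurvatureLike R) {C : ℝ}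
    (hbound : ∀ a b c d, |R a b c d| ≤ C * ‖a‖ * ‖b‖ * ‖c‖ * ‖d‖) {C₀ : ℝ} (hC₀ : 0 ≤ C₀)
    {a z w : E} (ha : ‖a‖ = 1) (hz : ‖z‖ ≤ 1) (hsmall : C * ‖z‖ ^ 2 ≤ 1 / 2) {h : ℝ}
    (hh : ‖w‖ ^ 2 - R w z z w / 3 - C₀ * ‖z‖ ^ 3 * ‖w‖ ^ 2 ≤ h) (hh' : ‖w‖ ^ 2 / 4 ≤ h) :
    |fderiv ℝ (planeWave R a) z w| ≤ (1 + 4 * (13 * C ^ 2 + C₀) * ‖z‖ ^ 3) * √h := by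
  have hh₀ : 0 ≤ h := le_trans (by positivity) hh'
  set K := (13 * C ^ 2 + C₀) * ‖z‖ ^ 3
  have hK₀ : 0 ≤ K := by positivity
  have hz₄ : (C * ‖z‖ ^ 2) ^ 2 ≤ C ^ 2 * ‖z‖ ^ 3 := by
    rw [mul_pow, ← pow_mul]
    gcongr 1
    exact pow_le_pow_of_le_one (norm_nonneg z) hz (by norm_num)
  have hsq : fderiv ℝ (planeWave R a) z w ^ 2 ≤ ((1 + 4 * K) * √h) ^ 2 := calc
    _ ≤ h + (13 * (C * ‖z‖ ^ 2) ^ 2 + C₀ * ‖z‖ ^ 3) * ‖w‖ ^ 2 :=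
      sq_fderiv_planeWave_le hR hbound ha hsmall hh
    _ ≤ h + K * (4 * h) := by
      gcongr <;> linarith
    _ ≤ ((1 + 4 * K) * √h) ^ 2 := by
      rw [mul_pow, Real.sq_sqrt hh₀]
      nlinarith [mul_nonneg hK₀ hh₀, mul_nonneg (mul_nonneg hK₀ hK₀) hh₀]
  rw [mul_assoc 4]
  exact abs_le_of_sq_le_sq hsq (by positivity)

end PlaneWave

/-! ### Expansion of the distance -/

section DistExpansion

variable {E : Type*} [NormedAddCommGroup E] [InnerProductSpace ℝ E]
  {R : E →ₗ[ℝ] E →ₗ[ℝ] E →ₗ[ℝ] E →ₗ[ℝ] ℝ} {C : ℝ}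

/-- The distance between the points of normal coordinates `u` and `v`, up to an error of higher
order; the junk value `0` of the quotient at `u = v` is the correct one. -/
def distExpansion (R : E →ₗ[ℝ] E →ₗ[ℝ] E →ₗ[ℝ] E →ₗ[ℝ] ℝ) (u v : E) : ℝ :=
  ‖v - u‖ - R (v - u) u u (v - u) / (6 * ‖v - u‖)

theorem distExpansion_self (u : E) : distExpansion R u u = 0 := by simp [distExpansion]

/-- A Riemannian metric in coordinates, `z ↦ G z`, has the expansion of normal coordinates with
curvature `R` on the ball of radius `r`. The constant `C` bounds both the curvature and the error,
and `r` is so small that the metric remains comparable with the Euclidean one. -/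
structure IsNormalMetric (G : E → E → ℝ) (R : E →ₗ[ℝ] E →ₗ[ℝ] E →ₗ[ℝ] E →ₗ[ℝ] ℝ) (C r : ℝ) :
    Prop where
  isCurvatureLike : IsCurvatureLike R
  nonneg : 0 ≤ C
  bound : ∀ a b c d, |R a b c d| ≤ C * ‖a‖ * ‖b‖ * ‖c‖ * ‖d‖
  radius_le_one : r ≤ 1
  mul_radius_sq_le : C * r ^ 2 ≤ 1 / 4
  expansion : ∀ z, ‖z‖ < r → ∀ w,
    |G z w - (‖w‖ ^ 2 - R w z z w / 3)| ≤ C * ‖z‖ ^ 3 * ‖w‖ ^ 2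

theorem abs_distExpansion_sub_norm_le
    (hbound : ∀ a b c d, |R a b c d| ≤ C * ‖a‖ * ‖b‖ * ‖c‖ * ‖d‖) (u v : E) :
    |distExpansion R u v - ‖v - u‖| ≤ C * ‖u‖ ^ 2 * ‖v - u‖ / 6 := by
  rcases eq_or_ne v u with rfl | hvu
  · simp [distExpansion]
  have hpos : 0 < ‖v - u‖ := norm_pos_iff.2 (sub_ne_zero.2 hvu)
  rw [distExpansion, sub_sub_cancel_left, abs_neg, abs_div,
    abs_of_pos (by positivity : 0 < 6 * ‖v - u‖), div_le_iff₀ (by positivity)]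
  linarith [hbound (v - u) u u (v - u)]

theorem exists_unit_smul_eq_sub {u v : E} (h : v ≠ u) :
    ∃ a : E, ‖a‖ = 1 ∧ v - u = ‖v - u‖ • a := by
  have hne : ‖v - u‖ ≠ 0 := norm_ne_zero_iff.2 (sub_ne_zero.2 h)
  exact ⟨‖v - u‖⁻¹ • (v - u), norm_smul_inv_norm (𝕜 := ℝ) (sub_ne_zero.2 h), by
    rw [smul_smul, mul_inv_cancel₀ hne, one_smul]⟩

theorem distExpansion_eq_planeWave_sub (hR : IsCurvatureLike R) {u v a : E} (ha : ‖a‖ = 1)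
    (hvu : v - u = ‖v - u‖ • a) : distExpansion R u v = planeWave R a v - planeWave R a u := by
  have hwave := planeWave_add_smul_sub hR ha u ‖v - u‖
  rw [← hvu, add_sub_cancel] at hwave
  have hcurv : R (v - u) u u (v - u) = ‖v - u‖ ^ 2 * R a u u a := by
    rw [hvu, map_smul, norm_smul, norm_norm, ha, mul_one]
    simp only [LinearMap.smul_apply, map_smul, smul_eq_mul]
    ring
  rw [hwave, distExpansion, hcurv]
  field

namespace IsNormalMetric

variable {G : E → E → ℝ} {r : ℝ}

theorem mul_sq_le (h : IsNormalMetric G R C r) {ρ : ℝ} (hρ₀ : 0 ≤ ρ) (hρ : ρ ≤ r) :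
    C * ρ ^ 2 ≤ 1 / 4 := by
  have := h.nonneg
  exact le_trans (by gcongr) h.mul_radius_sq_le

theorem mul_cube_le (h : IsNormalMetric G R C r) {ρ : ℝ} (hρ₀ : 0 ≤ ρ) (hρ : ρ ≤ r) :
    C * ρ ^ 3 ≤ 1 / 4 := by
  refine le_trans (mul_le_mul_of_nonneg_left ?_ h.nonneg) (h.mul_sq_le hρ₀ hρ)
  exact pow_le_pow_of_le_one hρ₀ (hρ.trans h.radius_le_one) (by norm_num)

theorem norm_sq_le (h : IsNormalMetric G R C r) {z : E} (hz : ‖z‖ < r) (w : E) :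
    ‖w‖ ^ 2 / 4 ≤ G z w := by
  have hexp := (abs_le.1 (h.expansion z hz w)).1
  have hcurv := le_of_abs_le (h.bound w z z w)
  have hsq := mul_le_mul_of_nonneg_right (h.mul_sq_le (norm_nonneg z) hz.le) (sq_nonneg ‖w‖)
  have hcube := mul_le_mul_of_nonneg_right (h.mul_cube_le (norm_nonneg z) hz.le) (sq_nonneg ‖w‖)
  nlinarith

theorem distExpansion_mem_Icc (h : IsNormalMetric G R C r) {u : E} (hu : ‖u‖ ≤ r) (v : E) :
    distExpansion R u v ∈ Icc (‖v - u‖ / 2) (3 / 2 * ‖v - u‖) := by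
  have hsub := abs_le.1 (abs_distExpansion_sub_norm_le h.bound u v)
  have hsq := mul_le_mul_of_nonneg_right (h.mul_sq_le (norm_nonneg u) hu) (norm_nonneg (v - u))
  constructor <;> linarith [norm_nonneg (v - u)]

theorem segment_le (h : IsNormalMetric G R C r) {ρ : ℝ} (hρ : ρ < r) {u v : E} (hu : ‖u‖ ≤ ρ)
    {t : ℝ} (ht : ‖u + t • (v - u)‖ ≤ ρ) :
    G (u + t • (v - u)) (v - u) ≤ (distExpansion R u v + C * ρ ^ 3 * ‖v - u‖) ^ 2 := by
  have hC := h.nonneg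
  have hρ₀ : 0 ≤ ρ := (norm_nonneg u).trans hu
  have hcurv : R (v - u) (u + t • (v - u)) (u + t • (v - u)) (v - u)
      = R (v - u) u u (v - u) := by
    simp only [map_add, map_smul, LinearMap.add_apply, LinearMap.smul_apply, smul_eq_mul,
      h.isCurvatureLike.self₁₂, h.isCurvatureLike.self₃₄]
    ring
  have hexp := (abs_le.1 (h.expansion _ (ht.trans_lt hρ) (v - u))).2
  rw [hcurv] at hexp
  have herr : C * ‖u + t • (v - u)‖ ^ 3 * ‖v - u‖ ^ 2 ≤ C * ρ ^ 3 * ‖v - u‖ ^ 2 := by gcongr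
  have hsq : ‖v - u‖ ^ 2 - R (v - u) u u (v - u) / 3 ≤ distExpansion R u v ^ 2 := by
    rcases eq_or_ne v u with rfl | hvu
    · simpa using sq_nonneg (distExpansion R v v)
    have hpos : 0 < ‖v - u‖ := norm_pos_iff.2 (sub_ne_zero.2 hvu)
    have hsquare : distExpansion R u v ^ 2 = ‖v - u‖ ^ 2 - R (v - u) u u (v - u) / 3
        + (R (v - u) u u (v - u) / (6 * ‖v - u‖)) ^ 2 := by
      rw [distExpansion]; field
    linarith [sq_nonneg (R (v - u) u u (v - u) / (6 * ‖v - u‖))]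
  have hD := (h.distExpansion_mem_Icc (hu.trans hρ.le) v).1
  have hcross : C * ρ ^ 3 * ‖v - u‖ ^ 2 ≤ 2 * distExpansion R u v * (C * ρ ^ 3 * ‖v - u‖) := by
    have := mul_le_mul_of_nonneg_right hD (by positivity : 0 ≤ C * ρ ^ 3 * ‖v - u‖)
    linarith
  linarith [sq_nonneg (C * ρ ^ 3 * ‖v - u‖)]

end IsNormalMetric

/-- `ψ` parametrizes a neighbourhood of `ψ 0` in such a way that the distance between the points
of parameters `u` and `v` in the ball of radius `ρ ≤ r` is `distExpansion R u v`, up to an error of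
relative size `C * ρ ^ 3`. -/
structure HasDistExpansion {X : Type*} [PseudoEMetricSpace X] (ψ : E → X)
    (R : E →ₗ[ℝ] E →ₗ[ℝ] E →ₗ[ℝ] E →ₗ[ℝ] ℝ) (C r : ℝ) : Prop where
  image_ball_mem_nhds : ∀ ρ > 0, ψ '' Metric.ball 0 ρ ∈ 𝓝 (ψ 0)
  edist_ne_top : ∀ u v, ‖u‖ ≤ r → ‖v‖ ≤ r → edist (ψ u) (ψ v) ≠ ⊤
  abs_sub_le : ∀ ρ ≤ r, ∀ u v, ‖u‖ ≤ ρ → ‖v‖ ≤ ρ →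
    |(edist (ψ u) (ψ v)).toReal - distExpansion R u v| ≤ C * ρ ^ 3 * ‖v - u‖

end DistExpansion

section RiemannianDistance

open RiemannianCoord MeasureTheory Manifold

variable {n : ℕ} {H : Type*} [TopologicalSpace H]
  {I : ModelWithCorners ℝ (EuclideanSpace ℝ (Fin n)) H} {M : Type*} [PseudoEMetricSpace M]
  [ChartedSpace H M] [RiemannianBundle (fun p : M ↦ TangentSpace I p)]
  {R : EuclideanSpace ℝ (Fin n) →ₗ[ℝ] EuclideanSpace ℝ (Fin n) →ₗ[ℝ]
    EuclideanSpace ℝ (Fin n) →ₗ[ℝ] EuclideanSpace ℝ (Fin n) →ₗ[ℝ] ℝ}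
  {x : M} {Φ : EuclideanSpace ℝ (Fin n) → EuclideanSpace ℝ (Fin n)} {C r : ℝ}

local notation "𝔼" => EuclideanSpace ℝ (Fin n)

theorem edist_le_pathELength [IsRiemannianManifold I M] {γ : ℝ → M}
    (hγ : ContMDiffOn 𝓘(ℝ, ℝ) I 1 γ (Icc 0 1)) {t : ℝ} (ht : t ∈ Icc (0 : ℝ) 1) :
    edist (γ 0) (γ t) ≤ pathELength I γ 0 1 := by
  rw [IsRiemannianManifold.out (I := I)]
  exact (riemannianEDist_le_pathELength (hγ.mono (Icc_subset_Icc_right ht.2)) rfl rfl ht.1).trans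
    (pathELength_mono le_rfl ht.2)

variable [IsManifold I 1 M]

theorem IsNormalMetric.ofReal_norm_sub_le_mul_pathELength
    (h : IsNormalMetric (pullbackForm I x Φ) R C r) (hΦ : ContDiff ℝ 1 Φ) {ζ : M → 𝔼} {U : Set M}
    (hζ : IsParamInverse (I := I) x Φ ζ U) (hζr : ∀ p ∈ U, ‖ζ p‖ < r) {γ : ℝ → M}
    (hγ : ContMDiffOn 𝓘(ℝ, ℝ) I 1 γ (Icc 0 1)) (hγU : MapsTo γ (Icc 0 1) U) :
    ENNReal.ofReal ‖ζ (γ 1) - ζ (γ 0)‖ ≤ ENNReal.ofReal 2 * pathELength I γ 0 1 := by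
  rcases eq_or_ne (ζ (γ 1)) (ζ (γ 0)) with heq | hne
  · simp [heq]
  obtain ⟨a, ha, hsub⟩ := exists_unit_smul_eq_sub hne
  have hinner : ‖ζ (γ 1) - ζ (γ 0)‖ = innerSL ℝ a (ζ (γ 1)) - innerSL ℝ a (ζ (γ 0)) := by
    rw [← map_sub, hsub, map_smul, innerSL_apply_apply, inner_self_eq_one_of_norm_eq_one ha,
      norm_smul, ha]
    simp
  rw [hinner]
  refine (ENNReal.ofReal_le_ofReal (le_abs_self _)).trans
    (hζ.abs_sub_le_mul_pathELength hΦ hγ hγU (innerSL ℝ a).contDiff zero_le_two fun t ht w ↦ ?_)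
  rw [ContinuousLinearMap.fderiv]
  calc |innerSL ℝ a w| ≤ ‖w‖ := by simpa [ha] using abs_real_inner_le_norm a w
    _ = 2 * (‖w‖ / 2) := by ring
    _ ≤ _ := by
      gcongr
      refine Real.le_sqrt_of_sq_le ?_
      linarith [h.norm_sq_le (hζr _ (hγU ht)) w]

theorem IsNormalMetric.ofReal_distExpansion_le_mul_pathELength
    (h : IsNormalMetric (pullbackForm I x Φ) R C r) (hΦ : ContDiff ℝ 1 Φ) {ζ : M → 𝔼} {U : Set M}
    (hζ : IsParamInverse (I := I) x Φ ζ U) {γ : ℝ → M}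
    (hγ : ContMDiffOn 𝓘(ℝ, ℝ) I 1 γ (Icc 0 1)) (hγU : MapsTo γ (Icc 0 1) U) {ρ : ℝ} (hρ : ρ < r)
    (hγρ : ∀ t ∈ Icc (0 : ℝ) 1, ‖ζ (γ t)‖ ≤ ρ) :
    ENNReal.ofReal (distExpansion R (ζ (γ 0)) (ζ (γ 1)))
      ≤ ENNReal.ofReal (1 + 4 * (13 * C ^ 2 + C) * ρ ^ 3) * pathELength I γ 0 1 := by
  have hC := h.nonneg
  have hρ₀ : 0 ≤ ρ := (norm_nonneg _).trans (hγρ 0 (left_mem_Icc.2 zero_le_one))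
  rcases eq_or_ne (ζ (γ 1)) (ζ (γ 0)) with heq | hne
  · simp [heq, distExpansion_self]
  obtain ⟨a, ha, hsub⟩ := exists_unit_smul_eq_sub hne
  rw [distExpansion_eq_planeWave_sub h.isCurvatureLike ha hsub]
  refine (ENNReal.ofReal_le_ofReal (le_abs_self _)).trans (hζ.abs_sub_le_mul_pathELength hΦ hγ hγU
    (contDiff_planeWave a) (by positivity) fun t ht w ↦ ?_)
  have hz := hγρ t ht
  have hzr : ‖ζ (γ t)‖ < r := hz.trans_lt hρ
  refine (abs_fderiv_planeWave_le h.isCurvatureLike h.bound hC ha (hzr.le.trans h.radius_le_one)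
    (by linarith [h.mul_sq_le (norm_nonneg _) hzr.le])
    (by linarith [(abs_le.1 (h.expansion _ hzr w)).1]) (h.norm_sq_le hzr w)).trans ?_
  gcongr

variable [IsRiemannianManifold I M]

theorem IsNormalMetric.edist_le_distExpansion (h : IsNormalMetric (pullbackForm I x Φ) R C r)
    (hΦ : ContDiff ℝ 1 Φ) (htarget : ∀ z, ‖z‖ < r → Φ z ∈ (extChartAt I x).target)
    {ρ : ℝ} (hρ : ρ < r) {u v : 𝔼} (hu : ‖u‖ ≤ ρ) (hv : ‖v‖ ≤ ρ) :
    edist ((extChartAt I x).symm (Φ u)) ((extChartAt I x).symm (Φ v))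
      ≤ ENNReal.ofReal (distExpansion R u v + C * ρ ^ 3 * ‖v - u‖) := by
  have hC := h.nonneg
  have hρ₀ : 0 ≤ ρ := (norm_nonneg u).trans hu
  have hseg : ∀ t ∈ Icc (0 : ℝ) 1, ‖u + t • (v - u)‖ ≤ ρ := fun t ht ↦ by
    simpa using (convex_closedBall (0 : 𝔼) ρ).add_smul_sub_mem (by simpa using hu)
      (by simpa using hv) ht
  have hD : 0 ≤ distExpansion R u v :=
    le_trans (by positivity) (h.distExpansion_mem_Icc (hu.trans hρ.le) v).1
  exact edist_le_of_pullbackForm_le x hΦ (by positivity)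
    (fun t ht ↦ htarget _ ((hseg t ht).trans_lt hρ)) fun t ht ↦ h.segment_le hρ hu (hseg t ht)

theorem IsNormalMetric.edist_le_two_mul (h : IsNormalMetric (pullbackForm I x Φ) R C r)
    (hΦ : ContDiff ℝ 1 Φ) (htarget : ∀ z, ‖z‖ < r → Φ z ∈ (extChartAt I x).target)
    {u v : 𝔼} (hu : ‖u‖ < r) (hv : ‖v‖ < r) :
    edist ((extChartAt I x).symm (Φ u)) ((extChartAt I x).symm (Φ v))
      ≤ ENNReal.ofReal (2 * ‖v - u‖) := by
  refine (h.edist_le_distExpansion hΦ htarget (max_lt hu hv) (le_max_left _ _)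
    (le_max_right _ _)).trans (ENNReal.ofReal_le_ofReal ?_)
  have hcube := mul_le_mul_of_nonneg_right (h.mul_cube_le ((norm_nonneg u).trans (le_max_left _ _))
    (max_lt hu hv).le) (norm_nonneg (v - u))
  linarith [(h.distExpansion_mem_Icc hu.le v).2, norm_nonneg (v - u)]

/-- Paths issued from `x` of length less than `δ` cannot leave `U`, so their lengths bound the
coordinates of their endpoints. -/
theorem IsNormalMetric.norm_le_two_mul (h : IsNormalMetric (pullbackForm I x Φ) R C r)
    (hΦ : ContDiff ℝ 1 Φ) {ζ : M → 𝔼} {U : Set M} (hζ : IsParamInverse (I := I) x Φ ζ U)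
    (hζr : ∀ p ∈ U, ‖ζ p‖ < r) (hζx : ζ x = 0) {c : ℝ} (hc : 0 ≤ c)
    (hcU : Metric.eball x (ENNReal.ofReal c) ⊆ U) {p : M} (hp : edist x p < ENNReal.ofReal c) :
    ‖ζ p‖ ≤ 2 * c := by
  rw [IsRiemannianManifold.out (I := I)] at hp
  obtain ⟨γ, hγ₀, hγ₁, hγ, hlength⟩ := exists_lt_of_riemannianEDist_lt hp
  have hγU : MapsTo γ (Icc 0 1) U := fun t ht ↦ hcU <| by
    rw [Metric.mem_eball, edist_comm, ← hγ₀]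
    exact (edist_le_pathELength hγ ht).trans_lt hlength
  have hnorm := h.ofReal_norm_sub_le_mul_pathELength hΦ hζ hζr hγ hγU
  rw [hγ₀, hγ₁, hζx, sub_zero] at hnorm
  refine (ENNReal.ofReal_le_ofReal_iff (by positivity)).1 (hnorm.trans ?_)
  rw [ENNReal.ofReal_mul zero_le_two]
  gcongr

theorem IsNormalMetric.distExpansion_le_mul_of_edist_lt
    (h : IsNormalMetric (pullbackForm I x Φ) R C r) (hΦ : ContDiff ℝ 1 Φ)
    (hΦ₀ : Φ 0 = extChartAt I x x) (htarget : ∀ z, ‖z‖ < r → Φ z ∈ (extChartAt I x).target)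
    {ζ : M → 𝔼} {U : Set M} (hζ : IsParamInverse (I := I) x Φ ζ U) (hζr : ∀ p ∈ U, ‖ζ p‖ < r)
    {ρ : ℝ} (hρ : 0 < ρ) (hρr : 16 * ρ < r) (hρU : Metric.eball x (ENNReal.ofReal (8 * ρ)) ⊆ U)
    (hleft : ∀ z, ‖z‖ ≤ ρ → ζ ((extChartAt I x).symm (Φ z)) = z) {u v : 𝔼} (hu : ‖u‖ ≤ ρ)
    (hv : ‖v‖ ≤ ρ) {c : ℝ} (hc : 0 < c) (hcρ : c < 5 * ρ)
    (hedist : edist ((extChartAt I x).symm (Φ u)) ((extChartAt I x).symm (Φ v))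
      < ENNReal.ofReal c) :
    distExpansion R u v ≤ (1 + 4 * (13 * C ^ 2 + C) * (16 * ρ) ^ 3) * c := by
  have hC := h.nonneg
  have hψ₀ : (extChartAt I x).symm (Φ 0) = x := by simp [hΦ₀]
  rw [IsRiemannianManifold.out (I := I)] at hedist
  obtain ⟨γ, hγ₀, hγ₁, hγ, hlength⟩ := exists_lt_of_riemannianEDist_lt hedist
  have hγx : ∀ t ∈ Icc (0 : ℝ) 1, edist x (γ t) < ENNReal.ofReal (8 * ρ) := fun t ht ↦ calc
    edist x (γ t) ≤ edist x (γ 0) + edist (γ 0) (γ t) := edist_triangle _ _ _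
    _ ≤ ENNReal.ofReal (2 * ρ) + ENNReal.ofReal c := by
      gcongr
      · have hxu := h.edist_le_two_mul hΦ htarget (u := 0) (v := u) (by rw [norm_zero]; linarith)
          (by linarith)
        rw [hψ₀, sub_zero] at hxu
        rw [hγ₀]
        exact hxu.trans (by gcongr)
      · exact (edist_le_pathELength hγ ht).trans hlength.le
    _ = ENNReal.ofReal (2 * ρ + c) := (ENNReal.ofReal_add (by positivity) hc.le).symm
    _ < ENNReal.ofReal (8 * ρ) :=
      (ENNReal.ofReal_lt_ofReal_iff (by positivity)).2 (by linarith)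
  have hγU : MapsTo γ (Icc 0 1) U := fun t ht ↦ hρU (by
    rw [Metric.mem_eball, edist_comm]
    exact hγx t ht)
  have hζx : ζ x = 0 := by simpa only [hψ₀] using hleft 0 (by simpa using hρ.le)
  have hγζ : ∀ t ∈ Icc (0 : ℝ) 1, ‖ζ (γ t)‖ ≤ 16 * ρ := fun t ht ↦
    (h.norm_le_two_mul hΦ hζ hζr hζx (by positivity) hρU (hγx t ht)).trans_eq (by ring)
  have hle := h.ofReal_distExpansion_le_mul_pathELength hΦ hζ hγ hγU hρr hγζ
  rw [hγ₀, hγ₁, hleft u hu, hleft v hv] at hle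
  refine (ENNReal.ofReal_le_ofReal_iff (by positivity)).1 (hle.trans ?_)
  rw [ENNReal.ofReal_mul (by positivity)]
  gcongr

theorem IsNormalMetric.abs_edist_sub_distExpansion_le
    (h : IsNormalMetric (pullbackForm I x Φ) R C r) (hΦ : ContDiff ℝ 1 Φ)
    (hΦ₀ : Φ 0 = extChartAt I x x) (htarget : ∀ z, ‖z‖ < r → Φ z ∈ (extChartAt I x).target)
    {ζ : M → 𝔼} {U : Set M} (hζ : IsParamInverse (I := I) x Φ ζ U) (hζr : ∀ p ∈ U, ‖ζ p‖ < r)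
    {ρ : ℝ} (hρ : 0 < ρ) (hρr : 16 * ρ < r) (hρU : Metric.eball x (ENNReal.ofReal (8 * ρ)) ⊆ U)
    (hleft : ∀ z, ‖z‖ ≤ ρ → ζ ((extChartAt I x).symm (Φ z)) = z) {u v : 𝔼} (hu : ‖u‖ ≤ ρ)
    (hv : ‖v‖ ≤ ρ) :
    |(edist ((extChartAt I x).symm (Φ u)) ((extChartAt I x).symm (Φ v))).toReal
      - distExpansion R u v| ≤ (C + 8 * (13 * C ^ 2 + C) * 16 ^ 3) * ρ ^ 3 * ‖v - u‖ := by
  have hC := h.nonneg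
  set d := edist ((extChartAt I x).symm (Φ u)) ((extChartAt I x).symm (Φ v))
  have hd₂ : d ≤ ENNReal.ofReal (2 * ‖v - u‖) :=
    h.edist_le_two_mul hΦ htarget (by linarith) (by linarith)
  have hd_top : d ≠ ⊤ := ne_top_of_le_ne_top ENNReal.ofReal_ne_top hd₂
  have hd₂' : d.toReal ≤ 2 * ‖v - u‖ := ENNReal.toReal_le_of_le_ofReal (by positivity) hd₂
  have hupper : d.toReal ≤ distExpansion R u v + C * ρ ^ 3 * ‖v - u‖ := by
    have hD := (h.distExpansion_mem_Icc (u := u) (by linarith) v).1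
    exact ENNReal.toReal_le_of_le_ofReal (add_nonneg (le_trans (by positivity) hD) (by positivity))
      (h.edist_le_distExpansion hΦ htarget (by linarith) hu hv)
  set K := 4 * (13 * C ^ 2 + C) * (16 * ρ) ^ 3 with hK
  have hK₀ : 0 ≤ K := by positivity
  have hlower : distExpansion R u v ≤ (1 + K) * d.toReal := by
    have hlim : Tendsto (fun c ↦ (1 + K) * c) (𝓝[>] d.toReal) (𝓝 ((1 + K) * d.toReal)) :=
      tendsto_nhdsWithin_of_tendsto_nhds ((continuous_const_mul _).tendsto _)
    refine ge_of_tendsto hlim ?_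
    have hd₅ : d.toReal < 5 * ρ := by linarith [norm_sub_le v u]
    filter_upwards [Ioo_mem_nhdsGT hd₅] with c ⟨hdc, hcρ⟩
    refine h.distExpansion_le_mul_of_edist_lt hΦ hΦ₀ htarget hζ hζr hρ hρr hρU hleft hu hv
      (ENNReal.toReal_nonneg.trans_lt hdc) hcρ ?_
    exact (ENNReal.lt_ofReal_iff_toReal_lt hd_top).2 hdc
  have hKd := mul_le_mul_of_nonneg_left hd₂' hK₀
  have hKN : 0 ≤ K * ‖v - u‖ := by positivity
  have hC₀ : 0 ≤ C * ρ ^ 3 * ‖v - u‖ := by positivity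
  rw [show (C + 8 * (13 * C ^ 2 + C) * 16 ^ 3) * ρ ^ 3 * ‖v - u‖
    = C * ρ ^ 3 * ‖v - u‖ + 2 * (K * ‖v - u‖) by rw [hK]; ring, abs_le]
  constructor <;> linarith

theorem exists_isNormalMetric {G : 𝔼 → 𝔼 → ℝ} (hR : IsCurvatureLike R) {C₀ : ℝ} (hC₀ : 0 ≤ C₀)
    (hexp : ∀ᶠ z in 𝓝 0, ∀ w, |G z w - (‖w‖ ^ 2 - R w z z w / 3)| ≤ C₀ * ‖z‖ ^ 3 * ‖w‖ ^ 2)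
    {r₁ : ℝ} (hr₁ : 0 < r₁) : ∃ C, ∃ r > 0, r ≤ r₁ ∧ IsNormalMetric G R C r := by
  obtain ⟨C₁, hC₁, hbound⟩ := exists_bound_of_quadrilinear R
  obtain ⟨r₂, hr₂, hball⟩ := Metric.eventually_nhds_iff_ball.1 hexp
  set C := C₁ + C₀
  have hC : 0 ≤ C := by positivity
  obtain ⟨r₃, hr₃, hr₃C⟩ : ∃ r₃ > 0, C * r₃ ^ 2 ≤ 1 / 4 := by
    have hcont : Tendsto (fun r : ℝ ↦ C * r ^ 2) (𝓝[>] 0) (𝓝 0) :=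
      Continuous.tendsto' (by fun_prop) _ _ (by simp) |>.mono_left inf_le_left
    exact ((hcont.eventually_le_const (by norm_num : (0 : ℝ) < 1 / 4)).and
      self_mem_nhdsWithin).exists.imp fun r hr ↦ hr.symm
  set r := min (min r₁ 1) (min r₂ r₃)
  have hr₀ : 0 < r := by positivity
  have hr_le₃ : r ≤ r₃ := (min_le_right _ _).trans (min_le_right _ _)
  refine ⟨C, r, hr₀, (min_le_left _ _).trans (min_le_left _ _), hR, hC, fun a b c d ↦ ?_,
    (min_le_left _ _).trans (min_le_right _ _), le_trans (by gcongr) hr₃C, fun z hz w ↦ ?_⟩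
  · refine (hbound a b c d).trans ?_
    gcongr
    exact le_add_of_nonneg_right hC₀
  · refine (hball z ?_ w).trans ?_
    · simpa using hz.trans_le ((min_le_right _ _).trans (min_le_left _ _))
    · gcongr
      exact le_add_of_nonneg_left hC₁

theorem exists_hasDistExpansion (hx : I.IsInteriorPoint x) (hΦ : ContDiff ℝ 1 Φ)
    (hΦ₀ : Φ 0 = extChartAt I x x) {Φ' : 𝔼 ≃L[ℝ] 𝔼} (hΦ' : fderiv ℝ Φ 0 = Φ')
    (hR : IsCurvatureLike R) {C₀ : ℝ} (hC₀ : 0 ≤ C₀)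
    (hexp : ∀ᶠ z in 𝓝 0, ∀ w, |pullbackForm I x Φ z w - (‖w‖ ^ 2 - R w z z w / 3)|
      ≤ C₀ * ‖z‖ ^ 3 * ‖w‖ ^ 2) :
    ∃ C, 0 ≤ C ∧ ∃ r > 0, HasDistExpansion (fun z ↦ (extChartAt I x).symm (Φ z)) R C r := by
  have hψ₀ : (extChartAt I x).symm (Φ 0) = x := by simp [hΦ₀]
  have htarget : ∀ᶠ z in 𝓝 0, Φ z ∈ (extChartAt I x).target :=
    hΦ.continuous.continuousAt.eventually_mem
      (hΦ₀ ▸ mem_interior_iff_mem_nhds.1 (I.isInteriorPoint_iff.1 hx))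
  obtain ⟨r₁, hr₁, hball⟩ := Metric.eventually_nhds_iff_ball.1 htarget
  obtain ⟨C, r, hr, hrr₁, h⟩ := exists_isNormalMetric hR hC₀ hexp hr₁
  have htarget' : ∀ z, ‖z‖ < r → Φ z ∈ (extChartAt I x).target := fun z hz ↦
    hball z (by simpa using hz.trans_le hrr₁)
  obtain ⟨ζ, U, hU, hζ, hζr, hleft⟩ := exists_isParamInverse x hx hΦ hΦ₀ hΦ' hr
  obtain ⟨r₂, hr₂, hleft₂⟩ := Metric.eventually_nhds_iff_ball.1 hleft
  obtain ⟨δ, hδ, hδU⟩ := EMetric.mem_nhds_iff.1 hU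
  obtain ⟨δ', hδ', hδδ'⟩ := ENNReal.lt_iff_exists_nnreal_btwn.1 hδ
  have hδ'₀ : (0 : ℝ) < δ' := by exact_mod_cast hδ'
  set r₀ := min (r / 17) (min (δ' / 8) (r₂ / 2))
  have hr₀ : 0 < r₀ := by positivity
  have hr₀r : r₀ ≤ r / 17 := min_le_left _ _
  have hr₀δ : r₀ ≤ δ' / 8 := (min_le_right _ _).trans (min_le_left _ _)
  have hr₀₂ : r₀ ≤ r₂ / 2 := (min_le_right _ _).trans (min_le_right _ _)
  have hC := h.nonneg
  refine ⟨C + 8 * (13 * C ^ 2 + C) * 16 ^ 3, by positivity, r₀, hr₀, fun ρ hρ ↦ ?_,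
    fun u v hu hv ↦ ne_top_of_le_ne_top ENNReal.ofReal_ne_top
      (h.edist_le_two_mul hΦ htarget' (by linarith) (by linarith)), fun ρ hρ u v hu hv ↦ ?_⟩
  · have hζx : ζ x = 0 := by simpa only [hψ₀] using hleft.self_of_nhds
    have hcont : ContinuousAt ζ x := (hζ.contMDiffOn.contMDiffAt hU).continuousAt
    simp only [hψ₀]
    filter_upwards [hU, hcont.eventually_mem (Metric.ball_mem_nhds (ζ x) hρ)] with p hp hζp
    rw [hζx] at hζp
    exact ⟨ζ p, hζp, hζ.symm_apply p hp⟩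
  · rcases ((norm_nonneg u).trans hu).eq_or_lt with rfl | hρ₀
    · simp [norm_le_zero_iff.1 hu, norm_le_zero_iff.1 hv, distExpansion_self]
    refine h.abs_edist_sub_distExpansion_le hΦ hΦ₀ htarget' hζ hζr hρ₀ (by linarith)
      ((Metric.eball_subset_eball ?_).trans hδU) (fun z hz ↦ hleft₂ z (by simp; linarith)) hu hv
    refine (ENNReal.ofReal_le_ofReal (by linarith : 8 * ρ ≤ (δ' : ℝ))).trans ?_
    rw [ENNReal.ofReal_coe_nnreal]
    exact hδδ'.le

end RiemannianDistance

/-! ### Regular simplices and the extent -/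

section Extent

theorem sum_sum_Ioi_eq_half {q : ℕ} {f : Fin q → Fin q → ℝ} (hsymm : ∀ i j, f i j = f j i)
    (hdiag : ∀ i, f i i = 0) :
    ∑ i, ∑ j ∈ Finset.Ioi i, f i j = 1 / 2 * ∑ i, ∑ j, f i j := by
  have hsplit : ∀ i, ∑ j, f i j = ∑ j ∈ Finset.Ioi i, f i j + ∑ j ∈ Finset.Iio i, f i j := by
    intro i
    have hnot : Finset.univ.filter (¬ i < ·) = insert i (Finset.Iio i) := by
      ext j
      simp [le_iff_eq_or_lt]
    rw [← Finset.sum_filter_add_sum_filter_not Finset.univ (i < ·), hnot,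
      Finset.sum_insert (by simp), hdiag, zero_add, Finset.filter_lt_eq_Ioi]
  have hswap : ∑ i, ∑ j ∈ Finset.Iio i, f i j = ∑ i, ∑ j ∈ Finset.Ioi i, f i j := by
    rw [Finset.sum_comm' (t' := Finset.univ) (s' := fun j ↦ Finset.Ioi j) (by simp)]
    simp only [hsymm]
  simp_rw [hsplit, Finset.sum_add_distrib, hswap]
  ring

variable {X : Type*} [PseudoEMetricSpace X] {q : ℕ} {B : ℝ}

theorem sum_sum_Ioi_edist {p : Fin q → X} (hp : ∀ i j, edist (p i) (p j) ≠ ⊤) :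
    ∑ i, ∑ j ∈ Finset.Ioi i, edist (p i) (p j)
      = ENNReal.ofReal (1 / 2 * ∑ i, ∑ j, (edist (p i) (p j)).toReal) := by
  rw [← sum_sum_Ioi_eq_half (fun i j ↦ by rw [edist_comm]) (by simp),
    ENNReal.ofReal_sum_of_nonneg fun _ _ ↦ Finset.sum_nonneg fun _ _ ↦ ENNReal.toReal_nonneg]
  refine Finset.sum_congr rfl fun i _ ↦ ?_
  rw [ENNReal.ofReal_sum_of_nonneg fun _ _ ↦ ENNReal.toReal_nonneg]
  simp only [ENNReal.ofReal_toReal (hp i _)]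

theorem inv_choose_two_mul_sum_edist (hq : 2 ≤ q) {p : Fin q → X}
    (hp : ∀ i j, edist (p i) (p j) ≠ ⊤) :
    ((q.choose 2 : ℕ) : ℝ≥0∞)⁻¹ * ∑ i, ∑ j ∈ Finset.Ioi i, edist (p i) (p j)
      = ENNReal.ofReal ((∑ i, ∑ j, (edist (p i) (p j)).toReal) / (q * (q - 1))) := by
  have hpos : (0 : ℝ) < (q.choose 2 : ℕ) := by exact_mod_cast Nat.choose_pos hq
  rw [sum_sum_Ioi_edist hp, ← ENNReal.ofReal_natCast, ← ENNReal.ofReal_inv_of_pos hpos,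
    ← ENNReal.ofReal_mul (by positivity), Nat.cast_choose_two]
  congr 1
  field

theorem toReal_extent_le [Nonempty X] (hq : 2 ≤ q)
    (hX : ∀ p : Fin q → X, ∀ i j, edist (p i) (p j) ≠ ⊤)
    (hB : ∀ p : Fin q → X, (∑ i, ∑ j, (edist (p i) (p j)).toReal) / (q * (q - 1)) ≤ B) :
    extent q X ≠ ⊤ ∧ (extent q X).toReal ≤ B := by
  have hle : extent q X ≤ ENNReal.ofReal B := by
    rw [extent, ENNReal.mul_iSup]
    refine iSup_le fun p ↦ ?_
    rw [inv_choose_two_mul_sum_edist hq (hX p)]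
    exact ENNReal.ofReal_le_ofReal (hB p)
  have hB₀ : 0 ≤ B := by simpa using hB fun _ ↦ Classical.arbitrary X
  exact ⟨ne_top_of_le_ne_top ENNReal.ofReal_ne_top hle, ENNReal.toReal_le_of_le_ofReal hB₀ hle⟩

theorem le_toReal_extent (hq : 2 ≤ q) (hX : extent q X ≠ ⊤) {p : Fin q → X}
    (hp : ∀ i j, edist (p i) (p j) ≠ ⊤) :
    (∑ i, ∑ j, (edist (p i) (p j)).toReal) / (q * (q - 1)) ≤ (extent q X).toReal := by
  rw [← ENNReal.ofReal_le_iff_le_toReal hX, extent, ENNReal.mul_iSup,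
    ← inv_choose_two_mul_sum_edist hq hp]
  exact le_iSup (fun p : Fin q → X ↦ _ * ∑ i, ∑ j ∈ Finset.Ioi i, edist (p i) (p j)) p

end Extent

section Simplex

variable {n : ℕ}

/-- The edge length of a regular `n`-simplex inscribed in the unit sphere of `ℝⁿ`. -/
def simplexEdge (n : ℕ) : ℝ := √(2 * (((n : ℝ) + 1) / n))

theorem simplexEdge_sq : simplexEdge n ^ 2 = 2 * (((n : ℝ) + 1) / n) :=
  Real.sq_sqrt (by positivity)

theorem simplexEdge_pos (hn : 1 ≤ n) : 0 < simplexEdge n := by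
  have : (0 : ℝ) < n := by exact_mod_cast hn
  exact Real.sqrt_pos.2 (by positivity)

theorem simplexEdge_le_two (hn : 1 ≤ n) : simplexEdge n ≤ 2 := by
  have : (1 : ℝ) ≤ n := by exact_mod_cast hn
  refine abs_le_of_sq_le_sq' ?_ zero_le_two |>.2
  rw [simplexEdge_sq, ← mul_div_assoc, div_le_iff₀ (by linarith)]
  linarith

variable {V : Type*} [NormedAddCommGroup V] [InnerProductSpace ℝ V]

/-- The vertices of a regular `n`-simplex inscribed in the unit sphere, described by their Gram
matrix. -/
def IsRegularSimplex (b : Fin (n + 1) → V) : Prop :=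
  ∀ i j, inner ℝ (b i) (b j) = if i = j then 1 else -1 / (n : ℝ)

theorem IsRegularSimplex.norm_eq_one {b : Fin (n + 1) → V} (hb : IsRegularSimplex b)
    (i : Fin (n + 1)) : ‖b i‖ = 1 := by
  have hinner := hb i i
  rwa [if_pos rfl, real_inner_self_eq_norm_sq, pow_eq_one_iff_of_nonneg (norm_nonneg _)
    two_ne_zero] at hinner

theorem IsRegularSimplex.sum_norm_sub (hn : 1 ≤ n) {b : Fin (n + 1) → V}
    (hb : IsRegularSimplex b) : ∑ i, ∑ j, ‖b j - b i‖ = n * (n + 1) * simplexEdge n := by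
  have : (0 : ℝ) < n := by exact_mod_cast hn
  have hnorm : ∀ i j, ‖b j - b i‖ = simplexEdge n - if i = j then simplexEdge n else 0 := by
    intro i j
    split_ifs with hij
    · simp [hij]
    · rw [sub_zero, ← sq_eq_sq₀ (norm_nonneg _) (simplexEdge_pos hn).le, simplexEdge_sq,
        norm_sub_sq_real, hb.norm_eq_one, hb.norm_eq_one, hb, if_neg (Ne.symm hij)]
      field
  simp only [hnorm, Finset.sum_sub_distrib, Finset.sum_const, Finset.sum_ite_eq, Finset.mem_univ,
    if_true, Finset.card_univ, Fintype.card_fin, nsmul_eq_mul]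
  push_cast
  ring

/-- The simplex is the rescaled orthogonal projection of the standard basis of `ℝⁿ⁺¹` to the
hyperplane orthogonal to `(1, …, 1)`. -/
theorem exists_isRegularSimplex (hn : 1 ≤ n) :
    ∃ b : Fin (n + 1) → EuclideanSpace ℝ (Fin n), IsRegularSimplex b := by
  have : (0 : ℝ) < n := by exact_mod_cast hn
  let o : EuclideanSpace ℝ (Fin (n + 1)) := WithLp.toLp 2 fun _ ↦ 1
  let s : Fin (n + 1) → EuclideanSpace ℝ (Fin (n + 1)) := fun i ↦ EuclideanSpace.single i 1
  have hoo : inner ℝ o o = (n : ℝ) + 1 := by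
    rw [real_inner_self_eq_norm_sq, EuclideanSpace.norm_sq_eq]
    simp [o]
  have hos : ∀ i, inner ℝ o (s i) = 1 := by simp [o, s, EuclideanSpace.inner_single_right]
  have hso : ∀ i, inner ℝ (s i) o = 1 := fun i ↦ by rw [real_inner_comm, hos]
  have hss : ∀ i j, inner ℝ (s i) (s j) = if i = j then (1 : ℝ) else 0 := by
    simp [s, EuclideanSpace.inner_single_left]
  have ho : o ≠ 0 := by
    rintro ho
    rw [ho, inner_zero_left] at hoo
    linarith
  have : Fact (Module.finrank ℝ (EuclideanSpace ℝ (Fin (n + 1))) = n + 1) := ⟨by simp⟩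
  have hdim : Module.finrank ℝ (ℝ ∙ o)ᗮ = n := Submodule.finrank_orthogonal_span_singleton ho
  let e := ((stdOrthonormalBasis ℝ (ℝ ∙ o)ᗮ).reindex (finCongr hdim)).repr
  let t : Fin (n + 1) → (ℝ ∙ o)ᗮ := fun i ↦ ⟨s i - ((n : ℝ) + 1)⁻¹ • o, by
    rw [Submodule.mem_orthogonal_singleton_iff_inner_right, inner_sub_right, inner_smul_right,
      hos, hoo, inv_mul_cancel₀ (by positivity), sub_self]⟩
  refine ⟨fun i ↦ √(((n : ℝ) + 1) / n) • e (t i), fun i j ↦ ?_⟩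
  rw [inner_smul_left, inner_smul_right, LinearIsometryEquiv.inner_map_map, Submodule.coe_inner,
    ← mul_assoc, conj_trivial, Real.mul_self_sqrt (by positivity)]
  simp only [t, inner_sub_left, inner_sub_right, inner_smul_left, inner_smul_right, hoo, hos, hso,
    hss, conj_trivial]
  split_ifs <;> field

theorem norm_sum_sq_eq_sum_inner {ι : Type*} [Fintype ι] (v : ι → V) :
    ‖∑ i, v i‖ ^ 2 = ∑ i, ∑ j, inner ℝ (v i) (v j) := by
  simp_rw [← real_inner_self_eq_norm_sq, sum_inner, inner_sum]

/-- The defect of the sum of the distances of `n + 1` points from that of a regular simplex,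
multiplied by twice the edge length in order to become a sum of squares. -/
def simplexDefect (v : Fin (n + 1) → V) : ℝ :=
  2 * simplexEdge n * (n * (n + 1) * simplexEdge n - ∑ i, ∑ j, ‖v j - v i‖)

theorem IsRegularSimplex.simplexDefect_eq_zero (hn : 1 ≤ n) {b : Fin (n + 1) → V}
    (hb : IsRegularSimplex b) : simplexDefect b = 0 := by
  rw [simplexDefect, hb.sum_norm_sub hn, sub_self, mul_zero]

theorem simplexDefect_eq (hn : 1 ≤ n) (v : Fin (n + 1) → V) :
    simplexDefect v = 2 * (n + 1) * ∑ i, (1 - ‖v i‖ ^ 2) + 2 * ‖∑ i, v i‖ ^ 2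
      + ∑ i, ∑ j, (if i = j then 0 else (simplexEdge n - ‖v j - v i‖) ^ 2) := by
  have : (0 : ℝ) < n := by exact_mod_cast hn
  have hsq : ∀ i j, (if i = j then 0 else (simplexEdge n - ‖v j - v i‖) ^ 2)
      = (simplexEdge n ^ 2 - 2 * simplexEdge n * ‖v j - v i‖ + ‖v j‖ ^ 2
        - 2 * inner ℝ (v i) (v j) + ‖v i‖ ^ 2) - (if i = j then simplexEdge n ^ 2 else 0) := by
    intro i j
    split_ifs with hij
    · subst hij
      rw [sub_self, norm_zero, real_inner_self_eq_norm_sq]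
      ring
    · rw [sub_zero, real_inner_comm]
      linear_combination norm_sub_sq_real (v j) (v i)
  have hedge : (n : ℝ) * simplexEdge n ^ 2 = 2 * (n + 1) := by
    rw [simplexEdge_sq]
    field
  simp only [hsq, simplexDefect, norm_sum_sq_eq_sum_inner, Finset.sum_sub_distrib,
    Finset.sum_add_distrib, ← Finset.mul_sum, Finset.sum_const, Finset.sum_ite_eq,
    Finset.mem_univ, if_true, Finset.card_univ, Fintype.card_fin, nsmul_eq_mul]
  push_cast
  linear_combination ((n : ℝ) + 1) * hedge

section UnitBall

variable {v : Fin (n + 1) → V}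

theorem one_sub_norm_sq_mem_Icc {V : Type*} [SeminormedAddCommGroup V] {a : V}
    (ha : ‖a‖ ≤ 1) : 1 - ‖a‖ ^ 2 ∈ Icc (0 : ℝ) 1 := by
  constructor <;> nlinarith [norm_nonneg a]

theorem simplexDefect_nonneg (hn : 1 ≤ n) (hv : ∀ i, ‖v i‖ ≤ 1) : 0 ≤ simplexDefect v := by
  have hnorm : 0 ≤ ∑ i, (1 - ‖v i‖ ^ 2) :=
    Finset.sum_nonneg fun i _ ↦ (one_sub_norm_sq_mem_Icc (hv i)).1
  rw [simplexDefect_eq hn]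
  positivity

theorem sq_simplexEdge_sub_le_simplexDefect (hn : 1 ≤ n) (hv : ∀ i, ‖v i‖ ≤ 1)
    {i j : Fin (n + 1)} (hij : i ≠ j) :
    (simplexEdge n - ‖v j - v i‖) ^ 2 ≤ simplexDefect v := by
  set f : Fin (n + 1) → Fin (n + 1) → ℝ :=
    fun i j ↦ if i = j then 0 else (simplexEdge n - ‖v j - v i‖) ^ 2 with hf
  have hf₀ : ∀ i j, 0 ≤ f i j := fun i j ↦ by positivity
  have hle : f i j ≤ ∑ i, ∑ j, f i j :=
    (Finset.single_le_sum (fun j _ ↦ hf₀ i j) (Finset.mem_univ j)).trans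
      (Finset.single_le_sum (f := fun i ↦ ∑ j, f i j)
        (fun i _ ↦ Finset.sum_nonneg fun j _ ↦ hf₀ i j) (Finset.mem_univ i))
  have hnorm : 0 ≤ 2 * ((n : ℝ) + 1) * ∑ i, (1 - ‖v i‖ ^ 2) :=
    mul_nonneg (by positivity) (Finset.sum_nonneg fun i _ ↦ (one_sub_norm_sq_mem_Icc (hv i)).1)
  rw [simplexDefect_eq hn]
  simp only [hf, if_neg hij] at hle
  linarith [sq_nonneg ‖∑ i, v i‖]

theorem one_sub_norm_sq_le_simplexDefect (hn : 1 ≤ n) (hv : ∀ i, ‖v i‖ ≤ 1) (i : Fin (n + 1)) :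
    1 - ‖v i‖ ^ 2 ≤ simplexDefect v := by
  have hnorm : ∀ i, 0 ≤ 1 - ‖v i‖ ^ 2 := fun i ↦ (one_sub_norm_sq_mem_Icc (hv i)).1
  have hle : 1 - ‖v i‖ ^ 2 ≤ ∑ i, (1 - ‖v i‖ ^ 2) :=
    Finset.single_le_sum (f := fun i ↦ 1 - ‖v i‖ ^ 2) (fun i _ ↦ hnorm i) (Finset.mem_univ i)
  have hpairs : 0 ≤ ∑ i, ∑ j, (if i = j then 0 else (simplexEdge n - ‖v j - v i‖) ^ 2) := by
    positivity
  have : (0 : ℝ) ≤ n := n.cast_nonneg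
  rw [simplexDefect_eq hn]
  nlinarith [sq_nonneg ‖∑ i, v i‖, hnorm i]

theorem sq_one_sub_norm_sq_le_simplexDefect (hn : 1 ≤ n) (hv : ∀ i, ‖v i‖ ≤ 1)
    (i : Fin (n + 1)) : (1 - ‖v i‖ ^ 2) ^ 2 ≤ simplexDefect v := by
  obtain ⟨h₀, h₁⟩ := one_sub_norm_sq_mem_Icc (hv i)
  exact (pow_le_of_le_one h₀ h₁ two_ne_zero).trans (one_sub_norm_sq_le_simplexDefect hn hv i)

theorem sq_inner_sub_le_simplexDefect (hn : 1 ≤ n) (hv : ∀ i, ‖v i‖ ≤ 1) (i j : Fin (n + 1)) :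
    (inner ℝ (v i) (v j) - if i = j then 1 else -1 / (n : ℝ)) ^ 2 ≤ 36 * simplexDefect v := by
  have : (0 : ℝ) < n := by exact_mod_cast hn
  have hi := sq_one_sub_norm_sq_le_simplexDefect hn hv i
  have hj := sq_one_sub_norm_sq_le_simplexDefect hn hv j
  split_ifs with hij
  · subst hij
    rw [real_inner_self_eq_norm_sq]
    linarith [simplexDefect_nonneg hn hv]
  have hpair := sq_simplexEdge_sub_le_simplexDefect hn hv hij
  have hd : ‖v j - v i‖ ≤ 2 := (norm_sub_le _ _).trans (by linarith [hv i, hv j])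
  have hsum : (simplexEdge n + ‖v j - v i‖) ^ 2 ≤ 4 ^ 2 := by
    have hL := simplexEdge_pos hn
    gcongr
    linarith [simplexEdge_le_two hn]
  set X := (simplexEdge n - ‖v j - v i‖) * (simplexEdge n + ‖v j - v i‖) with hX
  have hX₂ : X ^ 2 ≤ simplexDefect v * 4 ^ 2 := by
    rw [hX, mul_pow]
    exact mul_le_mul hpair hsum (sq_nonneg _) (simplexDefect_nonneg hn hv)
  have hinner : inner ℝ (v i) (v j) - -1 / (n : ℝ)
      = 1 / 2 * (X - (1 - ‖v i‖ ^ 2) - (1 - ‖v j‖ ^ 2)) := by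
    have hnorm := norm_sub_sq_real (v j) (v i)
    have hedge : simplexEdge n ^ 2 = 2 + 2 * (1 / n) := by
      rw [simplexEdge_sq]
      field
    rw [real_inner_comm]
    linear_combination -1 / 2 * hedge + 1 / 2 * hnorm
  rw [hinner]
  nlinarith [sq_nonneg (X + (1 - ‖v i‖ ^ 2)), sq_nonneg (X + (1 - ‖v j‖ ^ 2)),
    sq_nonneg ((1 - ‖v i‖ ^ 2) - (1 - ‖v j‖ ^ 2))]

end UnitBall

end Simplex

section Moment

theorem sum_sq_sum_mul_eq_sum_sq_inner {ι κ : Type*} [Fintype ι] [Fintype κ]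
    (v : ι → EuclideanSpace ℝ κ) :
    ∑ a, ∑ b, (∑ i, v i a * v i b) ^ 2 = ∑ i, ∑ j, (inner ℝ (v i) (v j) : ℝ) ^ 2 := by
  simp_rw [PiLp.inner_apply, sq, Finset.sum_mul_sum]
  calc ∑ a, ∑ b, ∑ i, ∑ j, v i a * v i b * (v j a * v j b)
      = ∑ a, ∑ i, ∑ j, ∑ b, v i a * v i b * (v j a * v j b) :=
        Finset.sum_congr rfl fun a _ ↦ by
          rw [Finset.sum_comm]
          exact Finset.sum_congr rfl fun i _ ↦ Finset.sum_comm
    _ = ∑ i, ∑ j, ∑ a, ∑ b, v i a * v i b * (v j a * v j b) := by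
        rw [Finset.sum_comm]
        exact Finset.sum_congr rfl fun i _ ↦ Finset.sum_comm
    _ = _ := by
        refine Finset.sum_congr rfl fun i _ ↦ Finset.sum_congr rfl fun j _ ↦
          Finset.sum_congr rfl fun a _ ↦ Finset.sum_congr rfl fun b _ ↦ ?_
        simp only [RCLike.inner_apply, conj_trivial]
        ring

variable {n : ℕ} {v : Fin (n + 1) → EuclideanSpace ℝ (Fin n)}

/-- The second moment tensor `∑ vᵢ ⊗ vᵢ` minus its value on a regular simplex. -/
def momentDefect (v : Fin (n + 1) → EuclideanSpace ℝ (Fin n)) (a b : Fin n) : ℝ :=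
  ∑ i, v i a * v i b - if a = b then ((n : ℝ) + 1) / n else 0

theorem sum_sq_momentDefect (hn : 1 ≤ n) (v : Fin (n + 1) → EuclideanSpace ℝ (Fin n)) :
    ∑ a, ∑ b, momentDefect v a b ^ 2 = ∑ i, ∑ j,
      (inner ℝ (v i) (v j) - if i = j then 1 else -1 / (n : ℝ)) ^ 2
        - 2 / n * ‖∑ i, v i‖ ^ 2 := by
  have : (0 : ℝ) < n := by exact_mod_cast hn
  have htrace : ∑ a, ∑ i, v i a * v i a = ∑ i, inner ℝ (v i) (v i) := by
    rw [Finset.sum_comm]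
    simp_rw [PiLp.inner_apply, RCLike.inner_apply, conj_trivial]
  have hleft : ∀ a b, momentDefect v a b ^ 2 = (∑ i, v i a * v i b) ^ 2
      + (if a = b then (((n : ℝ) + 1) / n) ^ 2 - 2 * (((n : ℝ) + 1) / n) * ∑ i, v i a * v i b
        else 0) := by
    intro a b
    rw [momentDefect]
    split_ifs <;> ring
  have hright : ∀ i j, (inner ℝ (v i) (v j) - if i = j then 1 else -1 / (n : ℝ)) ^ 2
      = inner ℝ (v i) (v j) ^ 2 + 2 / n * inner ℝ (v i) (v j) + 1 / n ^ 2
        + if i = j then 1 - 1 / n ^ 2 - 2 * (((n : ℝ) + 1) / n) * inner ℝ (v i) (v j) else 0 := by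
    intro i j
    split_ifs <;> field
  simp only [hleft, hright, Finset.sum_add_distrib, norm_sum_sq_eq_sum_inner,
    sum_sq_sum_mul_eq_sum_sq_inner, Finset.sum_ite_eq, Finset.mem_univ, if_true,
    Finset.sum_sub_distrib, ← Finset.mul_sum, htrace, Finset.sum_const, Finset.card_univ,
    Fintype.card_fin, nsmul_eq_mul]
  push_cast
  field

theorem abs_momentDefect_le (hn : 1 ≤ n) (hv : ∀ i, ‖v i‖ ≤ 1) (a b : Fin n) :
    |momentDefect v a b| ≤ 6 * (n + 1) * √(simplexDefect v) := by
  refine abs_le_of_sq_le_sq ?_ (by positivity)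
  rw [mul_pow, Real.sq_sqrt (simplexDefect_nonneg hn hv)]
  calc momentDefect v a b ^ 2 ≤ ∑ a, ∑ b, momentDefect v a b ^ 2 :=
        (Finset.single_le_sum (fun b _ ↦ sq_nonneg (momentDefect v a b)) (Finset.mem_univ b)).trans
          (Finset.single_le_sum (f := fun a ↦ ∑ b, momentDefect v a b ^ 2)
            (fun _ _ ↦ Finset.sum_nonneg fun _ _ ↦ sq_nonneg _) (Finset.mem_univ a))
    _ ≤ ∑ i, ∑ j, (inner ℝ (v i) (v j) - if i = j then 1 else -1 / (n : ℝ)) ^ 2 := by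
        rw [sum_sq_momentDefect hn, sub_le_self_iff]
        positivity
    _ ≤ ∑ _i : Fin (n + 1), ∑ _j : Fin (n + 1), 36 * simplexDefect v :=
        Finset.sum_le_sum fun i _ ↦ Finset.sum_le_sum fun j _ ↦
          sq_inner_sub_le_simplexDefect hn hv i j
    _ = (6 * (n + 1)) ^ 2 * simplexDefect v := by
        simp only [Finset.sum_const, Finset.card_univ, Fintype.card_fin, nsmul_eq_mul]
        push_cast
        ring

theorem sum_bilin_eq_momentDefect
    (B : EuclideanSpace ℝ (Fin n) →ₗ[ℝ] EuclideanSpace ℝ (Fin n) →ₗ[ℝ] ℝ)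
    (v : Fin (n + 1) → EuclideanSpace ℝ (Fin n)) :
    ∑ i, B (v i) (v i) - ((n : ℝ) + 1) / n
        * ∑ a, B (EuclideanSpace.single a 1) (EuclideanSpace.single a 1)
      = ∑ a, ∑ b, momentDefect v a b
        * B (EuclideanSpace.single a 1) (EuclideanSpace.single b 1) := by
  have hB : ∀ i, B (v i) (v i) = ∑ a, ∑ b, v i a * v i b
      * B (EuclideanSpace.single a 1) (EuclideanSpace.single b 1) := by
    intro i
    rw [linearMap_apply_eq_sum (EuclideanSpace.basisFun (Fin n) ℝ) B (v i), LinearMap.sum_apply]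
    refine Finset.sum_congr rfl fun a _ ↦ ?_
    rw [LinearMap.smul_apply,
      linearMap_apply_eq_sum (EuclideanSpace.basisFun (Fin n) ℝ) (B _) (v i), Finset.smul_sum]
    simp [EuclideanSpace.inner_single_left, mul_assoc]
  simp_rw [hB, momentDefect, sub_mul, Finset.sum_sub_distrib, Finset.sum_mul, ite_mul, zero_mul,
    Finset.sum_ite_eq, Finset.mem_univ, if_true, ← Finset.mul_sum]
  rw [Finset.sum_comm]
  exact congrArg (· - _) (Finset.sum_congr rfl fun a _ ↦ Finset.sum_comm)

end Moment

/-! ### Curvature sums over simplices -/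

theorem abs_sum_le_card_mul {ι : Type*} [Fintype ι] {f : ι → ℝ} {c : ℝ} (h : ∀ i, |f i| ≤ c) :
    |∑ i, f i| ≤ Fintype.card ι * c := by
  simpa using norm_sum_le_of_le (f := f) Finset.univ fun i _ ↦ h i

section CurvatureSum

variable {n : ℕ} {R : EuclideanSpace ℝ (Fin n) →ₗ[ℝ] EuclideanSpace ℝ (Fin n) →ₗ[ℝ]
  EuclideanSpace ℝ (Fin n) →ₗ[ℝ] EuclideanSpace ℝ (Fin n) →ₗ[ℝ] ℝ}
  {v : Fin (n + 1) → EuclideanSpace ℝ (Fin n)}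

local notation "𝔼" => EuclideanSpace ℝ (Fin n)

/-- The full contraction of `R` with respect to the Euclidean metric; for the curvature tensor it
is the scalar curvature. -/
def scalarContraction (R : 𝔼 →ₗ[ℝ] 𝔼 →ₗ[ℝ] 𝔼 →ₗ[ℝ] 𝔼 →ₗ[ℝ] ℝ) : ℝ :=
  ∑ a, ∑ b, R (EuclideanSpace.single a 1) (EuclideanSpace.single b 1)
    (EuclideanSpace.single b 1) (EuclideanSpace.single a 1)

theorem abs_sum_bilin_sub_le (hn : 1 ≤ n) (hv : ∀ i, ‖v i‖ ≤ 1) {B : 𝔼 →ₗ[ℝ] 𝔼 →ₗ[ℝ] ℝ} {c : ℝ}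
    (hB : ∀ a b, |B (EuclideanSpace.single a 1) (EuclideanSpace.single b 1)| ≤ c) :
    |∑ i, B (v i) (v i) - ((n : ℝ) + 1) / n
        * ∑ a, B (EuclideanSpace.single a 1) (EuclideanSpace.single a 1)|
      ≤ n * (n * (6 * (n + 1) * √(simplexDefect v) * c)) := by
  rw [sum_bilin_eq_momentDefect]
  refine (abs_sum_le_card_mul fun a ↦ abs_sum_le_card_mul fun b ↦ ?_).trans_eq
    (by rw [Fintype.card_fin])
  rw [abs_mul]
  exact mul_le_mul (abs_momentDefect_le hn hv a b) (hB a b) (abs_nonneg _) (by positivity)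

/-- Both sums over the vertices are replaced by traces, one after the other. -/
theorem exists_abs_sum_sub_scalarContraction_le (hn : 1 ≤ n)
    (R : 𝔼 →ₗ[ℝ] 𝔼 →ₗ[ℝ] 𝔼 →ₗ[ℝ] 𝔼 →ₗ[ℝ] ℝ) :
    ∃ C, 0 ≤ C ∧ ∀ v : Fin (n + 1) → 𝔼, (∀ i, ‖v i‖ ≤ 1) →
      |∑ i, ∑ j, R (v j) (v i) (v i) (v j) - (((n : ℝ) + 1) / n) ^ 2 * scalarContraction R|
        ≤ C * √(simplexDefect v) := by
  obtain ⟨K, hK, hbound⟩ := exists_bound_of_quadrilinear R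
  set c : ℝ := ((n : ℝ) + 1) / n
  refine ⟨(n + 1 + c * n) * (n * (n * (6 * (n + 1) * K))), by positivity, fun v hv ↦ ?_⟩
  set Q := √(simplexDefect v)
  let e : Fin n → 𝔼 := fun a ↦ EuclideanSpace.single a 1
  have houter : ∀ i, |∑ j, R (v j) (v i) (v i) (v j) - c * ∑ a, R (e a) (v i) (v i) (e a)|
      ≤ n * (n * (6 * (n + 1) * Q * K)) := fun i ↦
    abs_sum_bilin_sub_le hn hv (B := (R.flip (v i)).flip (v i)) fun a b ↦ by
      refine (hbound (e a) (v i) (v i) (e b)).trans ?_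
      rw [PiLp.norm_single, PiLp.norm_single, norm_one, mul_one, mul_one, mul_assoc]
      exact mul_le_of_le_one_right hK (mul_le_one₀ (hv i) (norm_nonneg _) (hv i))
  have hinner : ∀ a, |∑ i, R (e a) (v i) (v i) (e a) - c * ∑ b, R (e a) (e b) (e b) (e a)|
      ≤ n * (n * (6 * (n + 1) * Q * K)) := fun a ↦
    abs_sum_bilin_sub_le hn hv (B := (R (e a)).compr₂ (LinearMap.applyₗ (e a))) fun b d ↦ by
      simpa [e] using hbound (e a) (e b) (e d) (e a)
  have hsplit : ∑ i, ∑ j, R (v j) (v i) (v i) (v j) - c ^ 2 * scalarContraction R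
      = ∑ i, (∑ j, R (v j) (v i) (v i) (v j) - c * ∑ a, R (e a) (v i) (v i) (e a))
        + c * ∑ a, (∑ i, R (e a) (v i) (v i) (e a) - c * ∑ b, R (e a) (e b) (e b) (e a)) := by
    simp_rw [Finset.sum_sub_distrib, ← Finset.mul_sum, scalarContraction, e]
    rw [Finset.sum_comm (f := fun i a ↦ R (EuclideanSpace.single a 1) (v i) (v i)
      (EuclideanSpace.single a 1))]
    ring
  rw [hsplit]
  refine (abs_add_le _ _).trans ?_
  rw [abs_mul, abs_of_nonneg (by positivity : 0 ≤ c)]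
  calc _ ≤ Fintype.card (Fin (n + 1)) * (n * (n * (6 * (n + 1) * Q * K)))
        + c * (Fintype.card (Fin n) * (n * (n * (6 * (n + 1) * Q * K)))) := by
        gcongr
        · exact abs_sum_le_card_mul houter
        · exact abs_sum_le_card_mul hinner
    _ = _ := by
        simp only [Fintype.card_fin]
        push_cast
        ring

end CurvatureSum

section DistExpansionSum

variable {E : Type*} [NormedAddCommGroup E] [InnerProductSpace ℝ E]
  {R : E →ₗ[ℝ] E →ₗ[ℝ] E →ₗ[ℝ] E →ₗ[ℝ] ℝ}

theorem IsCurvatureLike.sub_outer (hR : IsCurvatureLike R) (u v : E) :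
    R (v - u) u u (v - u) = R v u u v := by
  calc R (v - u) u u (v - u) = R (v - u) u u v := by rw [map_sub, hR.self₃₄, sub_zero]
    _ = R (v - u + u) u u v := by simp only [map_add, LinearMap.add_apply, hR.self₁₂, add_zero]
    _ = R v u u v := by rw [sub_add_cancel]

theorem IsCurvatureLike.abs_div_sub_div_le (hR : IsCurvatureLike R) {C L : ℝ} (hC : 0 ≤ C)
    (hbound : ∀ a b c d, |R a b c d| ≤ C * ‖a‖ * ‖b‖ * ‖c‖ * ‖d‖) (hL : 0 < L) {u v : E}
    (hu : ‖u‖ ≤ 1) (hv : ‖v‖ ≤ 1) (huv : u ≠ v) :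
    |R (v - u) u u (v - u) / (6 * ‖v - u‖) - R v u u v / (6 * L)|
      ≤ C / (3 * L) * |L - ‖v - u‖| := by
  have hpos : 0 < ‖v - u‖ := norm_pos_iff.2 (sub_ne_zero.2 huv.symm)
  have hR₂ : |R v u u v| ≤ C * ‖v - u‖ ^ 2 := by
    rw [← hR.sub_outer]
    calc _ ≤ C * ‖v - u‖ ^ 2 * (‖u‖ * ‖u‖) := (hbound _ _ _ _).trans_eq (by ring)
      _ ≤ _ := mul_le_of_le_one_right (by positivity) (mul_le_one₀ hu (norm_nonneg _) hu)
  have hquot : R v u u v / (6 * ‖v - u‖) - R v u u v / (6 * L)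
      = R v u u v * (L - ‖v - u‖) / (6 * L * ‖v - u‖) := by
    field
  rw [hR.sub_outer, hquot, abs_div, abs_mul, abs_of_pos (by positivity : 0 < 6 * L * ‖v - u‖),
    div_le_iff₀ (by positivity)]
  calc |R v u u v| * |L - ‖v - u‖| ≤ C * ‖v - u‖ ^ 2 * |L - ‖v - u‖| := by gcongr
    _ = C * |L - ‖v - u‖| * ‖v - u‖ * ‖v - u‖ := by ring
    _ ≤ C * |L - ‖v - u‖| * ‖v - u‖ * 2 := by
        gcongr
        exact (norm_sub_le v u).trans (by linarith)
    _ = _ := by field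

theorem distExpansion_smul (R : E →ₗ[ℝ] E →ₗ[ℝ] E →ₗ[ℝ] E →ₗ[ℝ] ℝ) {ρ : ℝ} (hρ : 0 ≤ ρ)
    (u v : E) : distExpansion R (ρ • u) (ρ • v)
      = ρ * ‖v - u‖ - ρ ^ 3 * (R (v - u) u u (v - u) / (6 * ‖v - u‖)) := by
  simp only [distExpansion, ← smul_sub, norm_smul, Real.norm_of_nonneg hρ, map_smul,
    LinearMap.smul_apply, smul_eq_mul]
  rcases hρ.eq_or_lt with rfl | hρ₀
  · simp
  rcases eq_or_ne ‖v - u‖ 0 with h | h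
  · simp [h]
  · field

theorem sum_distExpansion_smul (R : E →ₗ[ℝ] E →ₗ[ℝ] E →ₗ[ℝ] E →ₗ[ℝ] ℝ) {ι : Type*} [Fintype ι]
    {ρ : ℝ} (hρ : 0 ≤ ρ) (v : ι → E) :
    ∑ i, ∑ j, distExpansion R (ρ • v i) (ρ • v j) = ρ * ∑ i, ∑ j, ‖v j - v i‖
      - ρ ^ 3 * ∑ i, ∑ j, R (v j - v i) (v i) (v i) (v j - v i) / (6 * ‖v j - v i‖) := by
  simp_rw [distExpansion_smul R hρ, Finset.sum_sub_distrib, ← Finset.mul_sum]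

theorem distExpansion_zero_left (R : E →ₗ[ℝ] E →ₗ[ℝ] E →ₗ[ℝ] E →ₗ[ℝ] ℝ) (v : E) :
    distExpansion R 0 v = ‖v‖ := by
  simp [distExpansion]

end DistExpansionSum

section SimplexSum

variable {n : ℕ} {R : EuclideanSpace ℝ (Fin n) →ₗ[ℝ] EuclideanSpace ℝ (Fin n) →ₗ[ℝ]
  EuclideanSpace ℝ (Fin n) →ₗ[ℝ] EuclideanSpace ℝ (Fin n) →ₗ[ℝ] ℝ}

local notation "𝔼" => EuclideanSpace ℝ (Fin n)

/-- The sum of the expanded distances `distExpansion R` between the vertices of a regular simplex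
of radius `ρ`, where `s` is the scalar contraction of `R`. -/
def simplexSum (n : ℕ) (s ρ : ℝ) : ℝ :=
  n * (n + 1) * simplexEdge n * ρ
    - (((n : ℝ) + 1) / n) ^ 2 * s / (6 * simplexEdge n) * ρ ^ 3

theorem IsCurvatureLike.exists_abs_sum_div_sub_le (hn : 1 ≤ n) (hR : IsCurvatureLike R) :
    ∃ C, 0 ≤ C ∧ ∀ v : Fin (n + 1) → 𝔼, (∀ i, ‖v i‖ ≤ 1) →
      |∑ i, ∑ j, R (v j - v i) (v i) (v i) (v j - v i) / (6 * ‖v j - v i‖)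
        - (((n : ℝ) + 1) / n) ^ 2 * scalarContraction R / (6 * simplexEdge n)|
          ≤ C * √(simplexDefect v) := by
  obtain ⟨K, hK, hbound⟩ := exists_bound_of_quadrilinear R
  obtain ⟨C, hC, hsum⟩ := exists_abs_sum_sub_scalarContraction_le hn R
  have hL := simplexEdge_pos hn
  set L := simplexEdge n
  refine ⟨(n + 1) * ((n + 1) * (K / (3 * L))) + C / (6 * L), by positivity, fun v hv ↦ ?_⟩
  set Q := √(simplexDefect v)
  have hpair : ∀ i j, |R (v j - v i) (v i) (v i) (v j - v i) / (6 * ‖v j - v i‖)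
      - R (v j) (v i) (v i) (v j) / (6 * L)| ≤ K / (3 * L) * Q := by
    intro i j
    rcases eq_or_ne (v i) (v j) with hij | hij
    · rw [hij, sub_self, hR.self₁₂]
      simp only [norm_zero, mul_zero, div_zero, zero_div, sub_zero, abs_zero]
      positivity
    · refine (hR.abs_div_sub_div_le hK hbound hL (hv i) (hv j) hij).trans ?_
      gcongr
      exact Real.abs_le_sqrt (sq_simplexEdge_sub_le_simplexDefect hn hv (ne_of_apply_ne v hij))
  have hsplit : ∑ i, ∑ j, R (v j - v i) (v i) (v i) (v j - v i) / (6 * ‖v j - v i‖)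
      - (((n : ℝ) + 1) / n) ^ 2 * scalarContraction R / (6 * L)
      = ∑ i, ∑ j, (R (v j - v i) (v i) (v i) (v j - v i) / (6 * ‖v j - v i‖)
        - R (v j) (v i) (v i) (v j) / (6 * L))
      + (∑ i, ∑ j, R (v j) (v i) (v i) (v j) - (((n : ℝ) + 1) / n) ^ 2 * scalarContraction R)
        / (6 * L) := by
    simp_rw [Finset.sum_sub_distrib, ← Finset.sum_div]
    ring
  rw [hsplit]
  refine (abs_add_le _ _).trans ?_
  rw [abs_div, abs_of_pos (by positivity : 0 < 6 * L)]
  calc _ ≤ Fintype.card (Fin (n + 1)) * (Fintype.card (Fin (n + 1)) * (K / (3 * L) * Q))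
        + C * Q / (6 * L) := by
        gcongr
        · exact abs_sum_le_card_mul fun i ↦ abs_sum_le_card_mul fun j ↦ hpair i j
        · exact hsum v hv
    _ = _ := by
        simp only [Fintype.card_fin]
        push_cast
        ring

/-- The quadratic gain `simplexDefect` in the linear term absorbs the error of the cubic term,
which is only of the order of its square root. -/
theorem IsCurvatureLike.exists_sum_distExpansion_le (hn : 1 ≤ n) (hR : IsCurvatureLike R) :
    ∃ C, 0 ≤ C ∧ ∀ ρ, 0 < ρ → ∀ z : Fin (n + 1) → 𝔼, (∀ i, ‖z i‖ ≤ ρ) →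
      ∑ i, ∑ j, distExpansion R (z i) (z j)
        ≤ simplexSum n (scalarContraction R) ρ + C * ρ ^ 5 := by
  obtain ⟨C, -, hsum⟩ := hR.exists_abs_sum_div_sub_le hn
  have hL := simplexEdge_pos hn
  refine ⟨C ^ 2 * simplexEdge n / 2, by positivity, fun ρ hρ z hz ↦ ?_⟩
  obtain ⟨v, rfl⟩ : ∃ v : Fin (n + 1) → 𝔼, z = fun i ↦ ρ • v i :=
    ⟨fun i ↦ ρ⁻¹ • z i, by simp [smul_smul, hρ.ne']⟩
  have hv : ∀ i, ‖v i‖ ≤ 1 := by simpa [norm_smul, abs_of_pos hρ, hρ] using hz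
  set Y := (((n : ℝ) + 1) / n) ^ 2 * scalarContraction R / (6 * simplexEdge n) with hY
  set K := ∑ i, ∑ j, R (v j - v i) (v i) (v i) (v j - v i) / (6 * ‖v j - v i‖)
  set q := √(simplexDefect v) with hq
  have hdist : ∑ i, ∑ j, ‖v j - v i‖
      = n * (n + 1) * simplexEdge n - q ^ 2 / (2 * simplexEdge n) := by
    rw [hq, Real.sq_sqrt (simplexDefect_nonneg hn hv), simplexDefect]
    field
  have hcubic : ρ ^ 3 * (Y - C * q) ≤ ρ ^ 3 * K := by
    gcongr
    linarith [(abs_le.1 (hsum v hv)).1]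
  have hsquare : ρ * (q ^ 2 / (2 * simplexEdge n)) - ρ ^ 3 * (C * q)
      + C ^ 2 * simplexEdge n / 2 * ρ ^ 5
      = ρ / (2 * simplexEdge n) * (q - C * simplexEdge n * ρ ^ 2) ^ 2 := by
    field
  have hnonneg : 0 ≤ ρ / (2 * simplexEdge n) * (q - C * simplexEdge n * ρ ^ 2) ^ 2 := by positivity
  rw [sum_distExpansion_smul R hρ.le, hdist, simplexSum, ← hY]
  linarith

theorem IsCurvatureLike.sum_distExpansion_simplex (hn : 1 ≤ n) (hR : IsCurvatureLike R)
    {b : Fin (n + 1) → 𝔼} (hb : IsRegularSimplex b) {ρ : ℝ} (hρ : 0 ≤ ρ) :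
    ∑ i, ∑ j, distExpansion R (ρ • b i) (ρ • b j) = simplexSum n (scalarContraction R) ρ := by
  obtain ⟨C, -, hsum⟩ := hR.exists_abs_sum_div_sub_le hn
  have hcubic := hsum b fun i ↦ (hb.norm_eq_one i).le
  rw [hb.simplexDefect_eq_zero hn, Real.sqrt_zero, mul_zero, abs_nonpos_iff, sub_eq_zero] at hcubic
  rw [sum_distExpansion_smul R hρ, hb.sum_norm_sub hn, hcubic, simplexSum]
  ring

end SimplexSum

/-! ### Expansion of the extent -/

section SmallBalls

variable {E : Type*} [NormedAddCommGroup E] [InnerProductSpace ℝ E]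
  {R : E →ₗ[ℝ] E →ₗ[ℝ] E →ₗ[ℝ] E →ₗ[ℝ] ℝ} {X : Type*} [PseudoEMetricSpace X] {ψ : E → X} {C r : ℝ}

theorem tendsto_add_mul_pow_four_nhdsGT (c : ℝ) :
    Tendsto (fun ε : ℝ ↦ ε + c * ε ^ 4) (𝓝[>] 0) (𝓝[>] 0) := by
  have hcont {f : ℝ → ℝ} {a : ℝ} (hf : Continuous f) (ha : f 0 = a) : Tendsto f (𝓝[>] 0) (𝓝 a) :=
    (hf.tendsto' 0 a ha).mono_left nhdsWithin_le_nhds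
  refine tendsto_nhdsWithin_iff.2
    ⟨hcont (by fun_prop) (by simp), ?_⟩
  have hfactor : Tendsto (fun ε ↦ 1 + c * ε ^ 3) (𝓝[>] 0) (𝓝 1) :=
    hcont (by fun_prop) (by simp)
  filter_upwards [hfactor.eventually_const_lt one_pos, self_mem_nhdsWithin] with ε h hε
  rw [mem_Ioi, show ε + c * ε ^ 4 = ε * (1 + c * ε ^ 3) by ring]
  exact mul_pos hε h

namespace HasDistExpansion

theorem abs_toReal_edist_zero_sub_le (h : HasDistExpansion ψ R C r) {z : E} (hz : ‖z‖ ≤ r) :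
    |(edist (ψ 0) (ψ z)).toReal - ‖z‖| ≤ C * ‖z‖ ^ 4 := by
  have hdist := h.abs_sub_le ‖z‖ hz 0 z (by simp) le_rfl
  rwa [distExpansion_zero_left, sub_zero, mul_assoc, ← pow_succ] at hdist

theorem abs_sum_sub_le (h : HasDistExpansion ψ R C r) (hC : 0 ≤ C) {ι : Type*} [Fintype ι]
    {ρ : ℝ} (hρ : ρ ≤ r) {z : ι → E} (hz : ∀ i, ‖z i‖ ≤ ρ) :
    |∑ i, ∑ j, (edist (ψ (z i)) (ψ (z j))).toReal - ∑ i, ∑ j, distExpansion R (z i) (z j)|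
      ≤ (Fintype.card ι : ℝ) ^ 2 * (2 * C) * ρ ^ 4 := by
  simp_rw [← Finset.sum_sub_distrib]
  refine (abs_sum_le_card_mul fun i ↦ abs_sum_le_card_mul fun j ↦ ?_).trans_eq
    (b := Fintype.card ι * (Fintype.card ι * (C * ρ ^ 3 * (2 * ρ)))) (by ring)
  have hρ₀ : 0 ≤ ρ := (norm_nonneg _).trans (hz i)
  refine (h.abs_sub_le ρ hρ _ _ (hz i) (hz j)).trans ?_
  gcongr
  exact (norm_sub_le _ _).trans (by linarith [hz i, hz j])

theorem eventually_mapsTo_closedBall (h : HasDistExpansion ψ R C r) (hC : 0 ≤ C) (hr : 0 < r) :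
    ∀ᶠ ε in 𝓝[>] 0, MapsTo ψ (Metric.closedBall 0 (ε + -C * ε ^ 4))
      (Metric.closedEBall (ψ 0) (ENNReal.ofReal ε)) := by
  filter_upwards [Ioc_mem_nhdsGT hr] with ε ⟨hε, hεr⟩ z hz
  rw [mem_closedBall_zero_iff] at hz
  have hzε : ‖z‖ ≤ ε := hz.trans (by simpa using by positivity)
  have hrad := (abs_le.1 (h.abs_toReal_edist_zero_sub_le (hzε.trans hεr))).2
  have hpow : C * ‖z‖ ^ 4 ≤ C * ε ^ 4 := by gcongr
  rw [Metric.mem_closedEBall, edist_comm, ENNReal.le_ofReal_iff_toReal_le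
    (h.edist_ne_top 0 z (by simpa using hr.le) (hzε.trans hεr)) hε.le]
  linarith

theorem eventually_closedEBall_subset (h : HasDistExpansion ψ R C r) (hC : 0 ≤ C) (hr : 0 < r) :
    ∀ᶠ ε in 𝓝[>] 0, Metric.closedEBall (ψ 0) (ENNReal.ofReal ε)
      ⊆ ψ '' Metric.closedBall 0 (ε + 16 * C * ε ^ 4) := by
  have hsmall : ∀ᶠ ρ : ℝ in 𝓝[>] 0, C * ρ ^ 3 < 1 / 2 :=
    ((by fun_prop : Continuous fun ρ : ℝ ↦ C * ρ ^ 3).tendsto 0).mono_left nhdsWithin_le_nhds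
      |>.eventually_lt_const (by simp)
  obtain ⟨ρ, hCρ, hρ, hρr⟩ := (hsmall.and (Ioc_mem_nhdsGT hr)).exists
  obtain ⟨δ, hδ, hball⟩ := EMetric.mem_nhds_iff.1 (h.image_ball_mem_nhds ρ hρ)
  have hofReal : Tendsto ENNReal.ofReal (𝓝[>] 0) (𝓝 0) := by
    simpa using (ENNReal.continuous_ofReal.tendsto 0).mono_left nhdsWithin_le_nhds
  filter_upwards [hofReal.eventually_lt_const hδ, self_mem_nhdsWithin] with ε hεδ hε p hp
  obtain ⟨z, hz, rfl⟩ := hball (hp.trans_lt hεδ)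
  rw [mem_ball_zero_iff] at hz
  have hdist : (edist (ψ 0) (ψ z)).toReal ≤ ε :=
    ENNReal.toReal_le_of_le_ofReal (le_of_lt hε) (by rwa [edist_comm])
  have hrad := (abs_le.1 (h.abs_toReal_edist_zero_sub_le (hz.le.trans hρr))).1
  have hhalf : C * ‖z‖ ^ 4 ≤ 1 / 2 * ‖z‖ := by
    have hcube : C * ‖z‖ ^ 3 ≤ 1 / 2 := hCρ.le.trans' (by gcongr)
    calc C * ‖z‖ ^ 4 = C * ‖z‖ ^ 3 * ‖z‖ := by ring
      _ ≤ _ := by gcongr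
  have hpow : C * ‖z‖ ^ 4 ≤ C * (2 * ε) ^ 4 := by
    gcongr
    linarith
  exact ⟨z, mem_closedBall_zero_iff.2 (by linarith), rfl⟩

end HasDistExpansion

end SmallBalls

section SimplexSumBounds

variable {n : ℕ} {R : EuclideanSpace ℝ (Fin n) →ₗ[ℝ] EuclideanSpace ℝ (Fin n) →ₗ[ℝ]
  EuclideanSpace ℝ (Fin n) →ₗ[ℝ] EuclideanSpace ℝ (Fin n) →ₗ[ℝ] ℝ}
  {X : Type*} [PseudoEMetricSpace X] {ψ : EuclideanSpace ℝ (Fin n) → X} {C r : ℝ}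

local notation "𝔼" => EuclideanSpace ℝ (Fin n)

theorem toReal_extent_closedBall_one (hn : 1 ≤ n) :
    (extent (n + 1) (Metric.closedBall (0 : 𝔼) 1)).toReal = simplexEdge n := by
  have hL := simplexEdge_pos hn
  have hq : 2 ≤ n + 1 := by omega
  have hdist : ∀ u v : Metric.closedBall (0 : 𝔼) 1, (edist u v).toReal = ‖(v : 𝔼) - u‖ :=
    fun u v ↦ by rw [← dist_edist, Subtype.dist_eq, dist_comm, dist_eq_norm]
  have : Nonempty (Metric.closedBall (0 : 𝔼) 1) := ⟨0, by simp⟩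
  have hle := toReal_extent_le hq (X := Metric.closedBall (0 : 𝔼) 1) (B := simplexEdge n)
    (fun p i j ↦ edist_ne_top _ _) fun p ↦ by
      have h := simplexDefect_nonneg hn (v := fun i ↦ (p i : 𝔼))
        fun i ↦ mem_closedBall_zero_iff.1 (p i).2
      have := nonneg_of_mul_nonneg_right h (by positivity)
      simp_rw [hdist]
      rw [div_le_iff₀ (by simpa using by positivity)]
      push_cast
      linarith
  refine hle.2.antisymm ?_
  obtain ⟨b, hb⟩ := exists_isRegularSimplex hn
  have h := le_toReal_extent hq hle.1
    (p := fun i ↦ ⟨b i, mem_closedBall_zero_iff.2 (hb.norm_eq_one i).le⟩)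
    fun i j ↦ edist_ne_top _ _
  simp_rw [hdist, hb.sum_norm_sub hn] at h
  refine h.trans_eq' ?_
  push_cast
  rw [add_sub_cancel_right]
  field

theorem isBigO_simplexSum_add_sub (n : ℕ) (s c K : ℝ) :
    (fun ε ↦ simplexSum n s (ε + c * ε ^ 4) + K * (ε + c * ε ^ 4) ^ 4 - simplexSum n s ε)
      =O[𝓝[>] 0] fun ε ↦ ε ^ 4 := by
  set a : ℝ := n * (n + 1) * simplexEdge n
  set κ : ℝ := (((n : ℝ) + 1) / n) ^ 2 * s / (6 * simplexEdge n)
  let quot : ℝ → ℝ := fun ε ↦ a * c - κ * (3 * c * ε ^ 2 + 3 * c ^ 2 * ε ^ 5 + c ^ 3 * ε ^ 8)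
    + K * (1 + c * ε ^ 3) ^ 4
  have hquot : quot =O[𝓝[>] 0] fun _ ↦ (1 : ℝ) :=
    (((by fun_prop : Continuous quot).tendsto 0).mono_left nhdsWithin_le_nhds).isBigO_one ℝ
  refine ((isBigO_refl (fun ε : ℝ ↦ ε ^ 4) _).mul hquot).congr (fun ε ↦ ?_) fun ε ↦ mul_one _
  simp only [quot, simplexSum, a, κ]
  ring

theorem isBigO_of_eventually_mem_Icc {α : Type*} {l : Filter α} {f a b g : α → ℝ}
    (ha : a =O[l] g) (hb : b =O[l] g) (h : ∀ᶠ x in l, f x ∈ Icc (a x) (b x)) : f =O[l] g := by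
  refine (IsBigO.of_bound' ?_).trans (ha.norm_left.add hb.norm_left)
  filter_upwards [h] with x hx
  exact (abs_le_max_abs_abs hx.1 hx.2).trans ((max_le_add_of_nonneg (abs_nonneg _)
    (abs_nonneg _)).trans (le_abs_self _))

namespace HasDistExpansion

theorem exists_sum_edist_le (h : HasDistExpansion ψ R C r) (hn : 1 ≤ n)
    (hR : IsCurvatureLike R) (hC : 0 ≤ C) (hr : 0 < r) :
    ∃ K, ∀ᶠ ρ in 𝓝[>] 0, ∀ z : Fin (n + 1) → 𝔼, (∀ i, ‖z i‖ ≤ ρ) →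
      ∑ i, ∑ j, (edist (ψ (z i)) (ψ (z j))).toReal
        ≤ simplexSum n (scalarContraction R) ρ + K * ρ ^ 4 := by
  obtain ⟨K, hK, hsum⟩ := hR.exists_sum_distExpansion_le hn
  refine ⟨K + (Fintype.card (Fin (n + 1)) : ℝ) ^ 2 * (2 * C), ?_⟩
  filter_upwards [Ioc_mem_nhdsGT hr, Ioc_mem_nhdsGT one_pos] with ρ ⟨hρ, hρr⟩ ⟨_, hρ₁⟩ z hz
  have herror := (abs_le.1 (h.abs_sum_sub_le hC hρr hz)).2
  have hpow : K * ρ ^ 5 ≤ K * ρ ^ 4 :=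
    mul_le_mul_of_nonneg_left (pow_le_pow_of_le_one hρ.le hρ₁ (by simp)) hK
  linarith [hsum ρ hρ z hz]

theorem exists_le_sum_edist (h : HasDistExpansion ψ R C r) (hn : 1 ≤ n)
    (hR : IsCurvatureLike R) (hC : 0 ≤ C) (hr : 0 < r) :
    ∃ K, ∀ᶠ ρ in 𝓝[>] 0, ∃ z : Fin (n + 1) → 𝔼, (∀ i, ‖z i‖ ≤ ρ) ∧
      simplexSum n (scalarContraction R) ρ + K * ρ ^ 4
        ≤ ∑ i, ∑ j, (edist (ψ (z i)) (ψ (z j))).toReal := by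
  obtain ⟨b, hb⟩ := exists_isRegularSimplex hn
  refine ⟨-((Fintype.card (Fin (n + 1)) : ℝ) ^ 2 * (2 * C)), ?_⟩
  filter_upwards [Ioc_mem_nhdsGT hr] with ρ ⟨hρ, hρr⟩
  have hz : ∀ i, ‖ρ • b i‖ ≤ ρ := fun i ↦ by
    rw [norm_smul, hb.norm_eq_one, mul_one, Real.norm_of_nonneg hρ.le]
  have herror := (abs_le.1 (h.abs_sum_sub_le hC hρr hz)).1
  rw [hR.sum_distExpansion_simplex hn hb hρ.le] at herror
  exact ⟨_, hz, by linarith⟩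

/-- The two bounds for the distance sums are transported to metric balls, which differ from the
images of coordinate balls of the same radius by `O(ε ^ 4)` only. -/
theorem isBigO_extent_sub (h : HasDistExpansion ψ R C r) (hn : 1 ≤ n)
    (hR : IsCurvatureLike R) (hC : 0 ≤ C) (hr : 0 < r) :
    (fun ε ↦ n * (n + 1) * (extent (n + 1) (Metric.closedEBall (ψ 0) (ENNReal.ofReal ε))).toReal
      - simplexSum n (scalarContraction R) ε) =O[𝓝[>] 0] fun ε ↦ ε ^ 4 := by
  have hq : 2 ≤ n + 1 := by omega
  have hN : (((n + 1 : ℕ) : ℝ) * ((n + 1 : ℕ) - 1)) = n * (n + 1) := by push_cast; ring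
  have hN₀ : (0 : ℝ) < n * (n + 1) := by positivity
  obtain ⟨K₁, hupper⟩ := h.exists_sum_edist_le hn hR hC hr
  obtain ⟨K₂, hlower⟩ := h.exists_le_sum_edist hn hR hC hr
  refine isBigO_of_eventually_mem_Icc (isBigO_simplexSum_add_sub n (scalarContraction R) (-C) K₂)
    (isBigO_simplexSum_add_sub n (scalarContraction R) (16 * C) K₁) ?_
  filter_upwards [(tendsto_add_mul_pow_four_nhdsGT (-C)).eventually hlower,
    (tendsto_add_mul_pow_four_nhdsGT (16 * C)).eventually hupper,
    h.eventually_mapsTo_closedBall hC hr, h.eventually_closedEBall_subset hC hr,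
    (tendsto_add_mul_pow_four_nhdsGT (16 * C)).eventually (Ioc_mem_nhdsGT hr)]
    with ε ⟨z, hz, hsum⟩ hsum_le hmaps hsubset ⟨_, hεr⟩
  have : Nonempty (Metric.closedEBall (ψ 0) (ENNReal.ofReal ε)) :=
    ⟨⟨ψ 0, Metric.mem_closedEBall_self⟩⟩
  choose w hw hψw using fun p : Metric.closedEBall (ψ 0) (ENNReal.ofReal ε) ↦ hsubset p.2
  have hne : ∀ p q : Metric.closedEBall (ψ 0) (ENNReal.ofReal ε), edist p q ≠ ⊤ := fun p q ↦ by
    rw [Subtype.edist_eq, ← hψw p, ← hψw q]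
    exact h.edist_ne_top _ _ ((mem_closedBall_zero_iff.1 (hw p)).trans hεr)
      ((mem_closedBall_zero_iff.1 (hw q)).trans hεr)
  have hle := toReal_extent_le hq (fun p i j ↦ hne (p i) (p j))
      (B := (simplexSum n (scalarContraction R) (ε + 16 * C * ε ^ 4)
        + K₁ * (ε + 16 * C * ε ^ 4) ^ 4) / (n * (n + 1))) fun p ↦ by
    rw [hN, div_le_div_iff_of_pos_right hN₀]
    have := hsum_le (fun i ↦ w (p i)) fun i ↦ mem_closedBall_zero_iff.1 (hw (p i))
    simpa only [Subtype.edist_eq, hψw] using this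
  have hge := le_toReal_extent hq hle.1
    (p := fun i ↦ ⟨ψ (z i), hmaps (mem_closedBall_zero_iff.2 (hz i))⟩) fun i j ↦ hne _ _
  rw [hN, div_le_iff₀' hN₀] at hge
  rw [le_div_iff₀' hN₀] at hle
  exact ⟨by gcongr; exact hsum.trans hge, by gcongr; exact hle.2⟩

end HasDistExpansion

end SimplexSumBounds

/-! ### Metrics in a linear basis -/

section MatrixSmooth

variable {E ι : Type*} [NormedAddCommGroup E] [NormedSpace ℝ E] [Fintype ι] [DecidableEq ι]
  {m : E → Matrix ι ι ℝ} {k : ℕ∞ω} {y : E}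

theorem contDiffAt_matrix_det (h : ∀ i j, ContDiffAt ℝ k (fun z ↦ m z i j) y) :
    ContDiffAt ℝ k (fun z ↦ (m z).det) y := by
  simp_rw [Matrix.det_apply']
  exact ContDiffAt.sum fun σ _ ↦ contDiffAt_const.mul (contDiffAt_prod fun i _ ↦ h _ _)

theorem contDiffAt_matrix_inv (h : ∀ i j, ContDiffAt ℝ k (fun z ↦ m z i j) y)
    (hdet : (m y).det ≠ 0) (i j : ι) : ContDiffAt ℝ k (fun z ↦ (m z)⁻¹ i j) y := by
  have hadj : ContDiffAt ℝ k (fun z ↦ (m z).adjugate i j) y := by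
    simp_rw [Matrix.adjugate_apply]
    refine contDiffAt_matrix_det fun a b ↦ ?_
    by_cases hab : a = j
    · subst hab; simp only [Matrix.updateRow_self]; exact contDiffAt_const
    · simp only [Matrix.updateRow_ne hab]; exact h a b
  simp_rw [Matrix.inv_def, Ring.inverse_eq_inv', Matrix.smul_apply, smul_eq_mul]
  exact ((contDiffAt_matrix_det h).inv hdet).mul hadj

end MatrixSmooth

theorem sum_mul_eq_iff_eq_sum_inv_mul {ι 𝕜 : Type*} [Fintype ι] [DecidableEq ι] [CommRing 𝕜]
    {m : Matrix ι ι 𝕜} (hdet : IsUnit m.det) {f g : ι → 𝕜} :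
    (∀ q, ∑ l, m q l * f l = g q) ↔ ∀ l, f l = ∑ q, m⁻¹ l q * g q := by
  constructor <;> intro h
  · obtain rfl : m.mulVec f = g := funext h
    exact congrFun (g := m⁻¹.mulVec (m.mulVec f))
      (by rw [Matrix.mulVec_mulVec, Matrix.nonsing_inv_mul _ hdet, Matrix.one_mulVec])
  · obtain rfl : f = m⁻¹.mulVec g := funext h
    exact congrFun (f := m.mulVec (m⁻¹.mulVec g))
      (by rw [Matrix.mulVec_mulVec, Matrix.mul_nonsing_inv _ hdet, Matrix.one_mulVec])

section Gram

open scoped MatrixOrder Matrix.Norms.L2Operator in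
theorem exists_basis_gram_eq {ι : Type*} [Fintype ι] {m : Matrix ι ι ℝ} (hm : m.PosDef) :
    ∃ b : Module.Basis ι ℝ (EuclideanSpace ℝ ι), Matrix.gram ℝ b = m := by
  classical
  obtain ⟨B, hB⟩ := CStarAlgebra.nonneg_iff_eq_star_mul_self.1
    (Matrix.nonneg_iff_posSemidef.2 hm.posSemidef)
  let v : ι → EuclideanSpace ℝ ι := fun j ↦ WithLp.toLp 2 fun i ↦ B i j
  have hv : Matrix.gram ℝ v = m := by
    rw [hB, Matrix.gram_eq_conjTranspose_mul (EuclideanSpace.basisFun ι ℝ)]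
    rfl
  have hli : LinearIndependent ℝ v := Matrix.linearIndependent_of_posDef_gram (hv ▸ hm)
  refine ⟨.mk hli (hli.span_eq_top_of_card_eq_finrank' finrank_euclideanSpace.symm).ge, ?_⟩
  rwa [Module.Basis.coe_mk]

variable {E ι : Type*} [NormedAddCommGroup E] [InnerProductSpace ℝ E] [Fintype ι]
  (b : Module.Basis ι ℝ E)

local notation "⟪" x "," y "⟫" => inner ℝ x y

theorem inner_eq_sum_repr_mul_inner (v w : E) : ⟪v, w⟫ = ∑ l, b.repr v l * ⟪b l, w⟫ := by
  conv_lhs => rw [← b.sum_repr v, sum_inner]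
  simp only [real_inner_smul_left]

variable [DecidableEq ι]

theorem toBilin_gram (v w : E) : Matrix.toBilin b (Matrix.gram ℝ b) v w = ⟪v, w⟫ := by
  rw [Matrix.toBilin_apply, inner_eq_sum_repr_mul_inner b]
  refine Finset.sum_congr rfl fun i _ ↦ ?_
  rw [real_inner_comm, inner_eq_sum_repr_mul_inner b, Finset.mul_sum]
  refine Finset.sum_congr rfl fun j _ ↦ ?_
  rw [Matrix.gram_apply, real_inner_comm]
  ring

theorem repr_eq_sum_gram_inv_mul_inner (v : E) (l : ι) :
    b.repr v l = ∑ r, (Matrix.gram ℝ b)⁻¹ l r * ⟪b r, v⟫ := by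
  have hdet : IsUnit (Matrix.gram ℝ b).det :=
    isUnit_iff_ne_zero.2 (Matrix.det_gram_ne_zero_iff_linearIndependent.2 b.linearIndependent)
  refine (sum_mul_eq_iff_eq_sum_inv_mul hdet).1 (fun q ↦ ?_) l
  rw [real_inner_comm, inner_eq_sum_repr_mul_inner b]
  refine Finset.sum_congr rfl fun i _ ↦ ?_
  rw [Matrix.gram_apply, real_inner_comm, mul_comm]

theorem sum_gram_inv_mul_bilin {κ : Type*} [Fintype κ] (o : OrthonormalBasis κ ℝ E)
    (B : E →ₗ[ℝ] E →ₗ[ℝ] ℝ) :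
    ∑ i, ∑ j, (Matrix.gram ℝ b)⁻¹ i j * B (b i) (b j) = ∑ a, B (o a) (o a) := by
  calc ∑ i, ∑ j, (Matrix.gram ℝ b)⁻¹ i j * B (b i) (b j)
      = ∑ i, ∑ j, ∑ a, (Matrix.gram ℝ b)⁻¹ i j * ⟪b j, o a⟫ * B (b i) (o a) := by
        refine Finset.sum_congr rfl fun i _ ↦ Finset.sum_congr rfl fun j _ ↦ ?_
        rw [linearMap_apply_eq_sum o (B (b i)) (b j), Finset.mul_sum]
        exact Finset.sum_congr rfl fun a _ ↦ by rw [real_inner_comm, smul_eq_mul, mul_assoc]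
    _ = ∑ i, ∑ a, b.repr (o a) i * B (b i) (o a) := by
        refine Finset.sum_congr rfl fun i _ ↦ ?_
        rw [Finset.sum_comm]
        exact Finset.sum_congr rfl fun a _ ↦ by
          rw [repr_eq_sum_gram_inv_mul_inner, Finset.sum_mul]
    _ = ∑ a, B (o a) (o a) := by
        rw [Finset.sum_comm]
        refine Finset.sum_congr rfl fun a _ ↦ ?_
        conv_rhs => rw [← LinearMap.flip_apply, ← b.sum_repr (o a), map_sum]
        simp only [map_smul, smul_eq_mul, LinearMap.flip_apply, b.sum_repr]

end Gram

section Coefficients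

variable {E ι : Type*} [AddCommGroup E] [Module ℝ E] [Fintype ι] [DecidableEq ι]
  (b : Module.Basis ι ℝ E)

/-- The trilinear form with coefficients `d` in the basis `b`. -/
def trilinOfBasis (d : ι → Matrix ι ι ℝ) : E →ₗ[ℝ] E →ₗ[ℝ] E →ₗ[ℝ] ℝ :=
  b.constr ℝ fun i ↦ Matrix.toBilin b (d i)

/-- The quadrilinear form with coefficients `dd` in the basis `b`. -/
def quadrilinOfBasis (dd : ι → ι → Matrix ι ι ℝ) : E →ₗ[ℝ] E →ₗ[ℝ] E →ₗ[ℝ] E →ₗ[ℝ] ℝ :=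
  b.constr ℝ fun i ↦ trilinOfBasis b (dd i)

theorem toBilin_basis (m : Matrix ι ι ℝ) (i j : ι) : Matrix.toBilin b m (b i) (b j) = m i j := by
  simp [Matrix.toBilin_apply, Finsupp.single_apply]

theorem toBilin_comm {m : Matrix ι ι ℝ} (hm : ∀ i j, m i j = m j i) (v w : E) :
    Matrix.toBilin b m v w = Matrix.toBilin b m w v := by
  rw [Matrix.toBilin_apply, Matrix.toBilin_apply, Finset.sum_comm]
  refine Finset.sum_congr rfl fun i _ ↦ Finset.sum_congr rfl fun j _ ↦ ?_
  rw [hm]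
  ring

theorem trilinOfBasis_basis_left (d : ι → Matrix ι ι ℝ) (i : ι) :
    trilinOfBasis b d (b i) = Matrix.toBilin b (d i) :=
  b.constr_basis ℝ _ i

theorem trilinOfBasis_basis (d : ι → Matrix ι ι ℝ) (i j k : ι) :
    trilinOfBasis b d (b i) (b j) (b k) = d i j k := by
  rw [trilinOfBasis_basis_left, toBilin_basis]

theorem quadrilinOfBasis_basis_left (dd : ι → ι → Matrix ι ι ℝ) (i j : ι) :
    quadrilinOfBasis b dd (b i) (b j) = Matrix.toBilin b (dd i j) := by
  rw [quadrilinOfBasis, b.constr_basis, trilinOfBasis_basis_left]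

theorem quadrilinOfBasis_basis (dd : ι → ι → Matrix ι ι ℝ) (i j k l : ι) :
    quadrilinOfBasis b dd (b i) (b j) (b k) (b l) = dd i j k l := by
  rw [quadrilinOfBasis_basis_left, toBilin_basis]

end Coefficients

section SecondDerivative

variable {V F : Type*} [NormedAddCommGroup V] [NormedSpace ℝ V] [NormedAddCommGroup F]
  [NormedSpace ℝ F] {f : V → F} {x : V}

theorem differentiableAt_fderiv_of_contDiffAt (hf : ContDiffAt ℝ 2 f x) :
    DifferentiableAt ℝ (fderiv ℝ f) x :=
  (hf.fderiv_right (m := 1) (by norm_num)).differentiableAt one_ne_zero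

theorem fderiv_fderiv_apply (hf : ContDiffAt ℝ 2 f x) (v w : V) :
    fderiv ℝ (fderiv ℝ f) x v w = fderiv ℝ (fun z ↦ fderiv ℝ f z w) x v := by
  rw [fderiv_clm_apply (differentiableAt_fderiv_of_contDiffAt hf) (differentiableAt_const w)]
  simp

end SecondDerivative

section Jets

variable {E ι : Type*} [NormedAddCommGroup E] [InnerProductSpace ℝ E] [Fintype ι]
  [DecidableEq ι] (b : Module.Basis ι ℝ E)

/-- The coordinates with respect to the basis `b`. -/
def coordEquiv : E ≃L[ℝ] EuclideanSpace ℝ ι :=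
  b.equivFunL.trans (EuclideanSpace.equiv ι ℝ).symm

omit [DecidableEq ι] in
theorem coordEquiv_apply (v : E) (i : ι) : coordEquiv b v i = b.repr v i := rfl

theorem coordEquiv_self (i : ι) : coordEquiv b (b i) = EuclideanSpace.single i 1 := by
  ext j
  simp [coordEquiv_apply, Finsupp.single_apply, eq_comm]

/-- The partial derivative `∂_i m` of a matrix field. -/
def matrixDeriv (m : EuclideanSpace ℝ ι → Matrix ι ι ℝ) (i : ι) (y : EuclideanSpace ℝ ι) :
    Matrix ι ι ℝ :=
  Matrix.of fun j k ↦ fderiv ℝ (fun z ↦ m z j k) y (EuclideanSpace.single i 1)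

variable {m : EuclideanSpace ℝ ι → Matrix ι ι ℝ} {y : EuclideanSpace ℝ ι}

theorem differentiableAt_matrixDeriv (hm : ∀ j k, ContDiffAt ℝ 2 (fun z ↦ m z j k) y) (i j k : ι) :
    DifferentiableAt ℝ (fun z ↦ matrixDeriv m i z j k) y :=
  (differentiableAt_fderiv_of_contDiffAt (hm j k)).clm_apply (differentiableAt_const _)

theorem matrixDeriv_matrixDeriv_comm (hm : ∀ j k, ContDiffAt ℝ 2 (fun z ↦ m z j k) y) (i j : ι) :
    matrixDeriv (matrixDeriv m j) i y = matrixDeriv (matrixDeriv m i) j y := by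
  ext k l
  simp only [matrixDeriv, Matrix.of_apply]
  rw [← fderiv_fderiv_apply (hm k l), ← fderiv_fderiv_apply (hm k l)]
  exact ((hm k l).isSymmSndFDerivAt (by simp)).eq _ _

theorem contDiffAt_toBilin_comp {k : ℕ∞ω} (hm : ∀ i j, ContDiffAt ℝ k (fun z ↦ m z i j) y)
    (v w : E) : ContDiffAt ℝ k (fun z ↦ Matrix.toBilin b (m (y + coordEquiv b z)) v w) 0 := by
  simp_rw [Matrix.toBilin_apply]
  refine ContDiffAt.sum fun i _ ↦ ContDiffAt.sum fun j _ ↦ ?_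
  have hentry : ContDiffAt ℝ k (fun z ↦ m (y + coordEquiv b z) i j) 0 :=
    ContDiffAt.comp (0 : E) (by simpa using hm i j)
      (contDiff_const.add (coordEquiv b).contDiff).contDiffAt
  exact (contDiffAt_const.mul hentry).mul contDiffAt_const

theorem fderiv_toBilin_comp {z : E}
    (hm : ∀ i j, DifferentiableAt ℝ (fun z ↦ m z i j) (y + coordEquiv b z)) (i : ι) (v w : E) :
    fderiv ℝ (fun z ↦ Matrix.toBilin b (m (y + coordEquiv b z)) v w) z (b i)
      = Matrix.toBilin b (matrixDeriv m i (y + coordEquiv b z)) v w := by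
  have hentry : ∀ j k, HasFDerivAt (fun z ↦ b.repr v j * m (y + coordEquiv b z) j k * b.repr w k)
      (b.repr w k • b.repr v j • (fderiv ℝ (fun z ↦ m z j k) (y + coordEquiv b z)).comp
        (coordEquiv b : E →L[ℝ] EuclideanSpace ℝ ι)) z := fun j k ↦
    (((hm j k).hasFDerivAt.comp z ((coordEquiv b).hasFDerivAt.const_add y)).const_mul _).mul_const _
  simp_rw [Matrix.toBilin_apply]
  rw [(HasFDerivAt.fun_sum fun j _ ↦ HasFDerivAt.fun_sum fun k _ ↦ hentry j k).fderiv]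
  simp only [_root_.sum_apply, smul_apply, ContinuousLinearMap.comp_apply,
    ContinuousLinearEquiv.coe_coe, coordEquiv_self, smul_eq_mul, matrixDeriv, Matrix.of_apply]
  exact Finset.sum_congr rfl fun j _ ↦ Finset.sum_congr rfl fun k _ ↦ by ring

theorem fderiv_toBilin_comp_zero (hm : ∀ i j, DifferentiableAt ℝ (fun z ↦ m z i j) y) (a v w : E) :
    fderiv ℝ (fun z ↦ Matrix.toBilin b (m (y + coordEquiv b z)) v w) 0 a
      = trilinOfBasis b (fun i ↦ matrixDeriv m i y) a v w := by
  have hext : (fderiv ℝ (fun z ↦ Matrix.toBilin b (m (y + coordEquiv b z)) v w) 0 : E →ₗ[ℝ] ℝ)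
      = LinearMap.applyₗ w ∘ₗ LinearMap.applyₗ v ∘ₗ trilinOfBasis b fun i ↦ matrixDeriv m i y :=
    b.ext fun i ↦ by
      simpa [trilinOfBasis_basis_left] using
        fderiv_toBilin_comp b (z := 0) (by simpa using hm) i v w
  exact LinearMap.congr_fun hext a

theorem fderiv_fderiv_toBilin_comp_zero (hm : ∀ i j, ContDiffAt ℝ 2 (fun z ↦ m z i j) y)
    (a c v w : E) :
    fderiv ℝ (fderiv ℝ fun z ↦ Matrix.toBilin b (m (y + coordEquiv b z)) v w) 0 a c
      = quadrilinOfBasis b (fun i j ↦ matrixDeriv (matrixDeriv m j) i y) a c v w := by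
  have hev : ∀ᶠ z in 𝓝 (0 : E), ∀ j k,
      DifferentiableAt ℝ (fun z ↦ m z j k) (y + coordEquiv b z) := by
    have hc : Tendsto (fun z ↦ y + coordEquiv b z) (𝓝 0) (𝓝 y) :=
      ((coordEquiv b).continuous.const_add y).tendsto' 0 y (by simp)
    refine hc.eventually (eventually_all.2 fun j ↦ eventually_all.2 fun k ↦ ?_)
    filter_upwards [(hm j k).eventually (by simp)] with z hz
    exact hz.differentiableAt two_ne_zero
  have hext : (fderiv ℝ (fderiv ℝ fun z ↦ Matrix.toBilin b (m (y + coordEquiv b z)) v w)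
        0).toLinearMap₁₂
      = (quadrilinOfBasis b fun i j ↦ matrixDeriv (matrixDeriv m j) i y).compr₂
        (LinearMap.applyₗ w ∘ₗ LinearMap.applyₗ v) := LinearMap.ext_basis b b fun i j ↦ by
    calc fderiv ℝ (fderiv ℝ fun z ↦ Matrix.toBilin b (m (y + coordEquiv b z)) v w) 0 (b i) (b j)
        = fderiv ℝ (fun z ↦ Matrix.toBilin b (matrixDeriv m j (y + coordEquiv b z)) v w)
          0 (b i) := by
          rw [fderiv_fderiv_apply (contDiffAt_toBilin_comp b hm v w)]
          refine DFunLike.congr_fun (EventuallyEq.fderiv_eq (𝕜 := ℝ) ?_) (b i)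
          filter_upwards [hev] with z hz using fderiv_toBilin_comp b hz j v w
      _ = Matrix.toBilin b (matrixDeriv (matrixDeriv m j) i y) v w := by
          rw [fderiv_toBilin_comp_zero b (differentiableAt_matrixDeriv hm j),
            trilinOfBasis_basis_left]
      _ = quadrilinOfBasis b (fun i j ↦ matrixDeriv (matrixDeriv m j) i y) (b i) (b j) v w := by
          rw [quadrilinOfBasis_basis_left]
  exact LinearMap.congr_fun₂ hext a c

theorem hasMetricJet_toBilin_comp (hm : ∀ i j, ContDiffAt ℝ 3 (fun z ↦ m z i j) y)
    (hsymm : ∀ z i j, m z i j = m z j i) (hb : Matrix.gram ℝ b = m y) :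
    HasMetricJet (fun z ↦ Matrix.toBilin b (m (y + coordEquiv b z)))
      (trilinOfBasis b fun i ↦ matrixDeriv m i y)
      (quadrilinOfBasis b fun i j ↦ matrixDeriv (matrixDeriv m j) i y) where
  contDiffAt := contDiffAt_toBilin_comp b hm
  symm z := toBilin_comm b (hsymm _)
  zero v w := by rw [map_zero, add_zero, ← hb, toBilin_gram]
  fderiv := fderiv_toBilin_comp_zero b fun i j ↦ (hm i j).differentiableAt three_ne_zero
  fderiv₂ := fderiv_fderiv_toBilin_comp_zero b fun i j ↦ (hm i j).of_le (by norm_num)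

end Jets

section BasisCurvature

variable {E ι : Type*} [NormedAddCommGroup E] [InnerProductSpace ℝ E] [FiniteDimensional ℝ E]
  [Fintype ι] [DecidableEq ι] (b : Module.Basis ι ℝ E)

/-- Twice the Christoffel symbols of the first kind `Γ_{ij,l}` of a metric whose matrix has the
partial derivatives `d`. -/
def christoffelFirst {ι : Type*} (d : ι → Matrix ι ι ℝ) (i j l : ι) : ℝ :=
  d i j l + d j i l - d l i j

theorem curvatureOfJet_basis (d : ι → Matrix ι ι ℝ) (dd : ι → ι → Matrix ι ι ℝ) (i j k p : ι) :
    curvatureOfJet (trilinOfBasis b d) (quadrilinOfBasis b dd) (b i) (b j) (b k) (b p)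
    = 1 / 2 * (dd i k j p - dd i p j k - dd j k i p + dd j p i k)
      - ∑ l, (1 / 2 * ∑ r, (Matrix.gram ℝ b)⁻¹ l r * christoffelFirst d j k r)
        * (1 / 2 * christoffelFirst d i p l)
      + ∑ l, (1 / 2 * ∑ r, (Matrix.gram ℝ b)⁻¹ l r * christoffelFirst d i k r)
        * (1 / 2 * christoffelFirst d j p l) := by
  have hinner : ∀ a c l, inner ℝ (b l) (leviCivita (trilinOfBasis b d) (b a) (b c))
      = 1 / 2 * christoffelFirst d a c l := fun a c l ↦ by
    rw [real_inner_comm, inner_leviCivita]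
    simp only [trilinOfBasis_basis, christoffelFirst]
  have hrepr : ∀ a c l, b.repr (leviCivita (trilinOfBasis b d) (b a) (b c)) l
      = 1 / 2 * ∑ r, (Matrix.gram ℝ b)⁻¹ l r * christoffelFirst d a c r := fun a c l ↦ by
    rw [repr_eq_sum_gram_inv_mul_inner, Finset.mul_sum]
    exact Finset.sum_congr rfl fun r _ ↦ by rw [hinner]; ring
  rw [curvatureOfJet_apply, inner_eq_sum_repr_mul_inner b, inner_eq_sum_repr_mul_inner b]
  simp only [quadrilinOfBasis_basis, hinner, hrepr]

end BasisCurvature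

/-! ### Scalar curvature -/

section ScalarCurvature

open RiemannianCoord

variable {n : ℕ} {H : Type*} [TopologicalSpace H]
  {I : ModelWithCorners ℝ (EuclideanSpace ℝ (Fin n)) H}
  {M : Type*} [TopologicalSpace M] [ChartedSpace H M]

local notation "𝔼" => EuclideanSpace ℝ (Fin n)

theorem range_mem_nhds_of_mem_interior_target {x : M} {y : 𝔼}
    (hy : y ∈ interior (extChartAt I x).target) : range I ∈ 𝓝 y :=
  mem_of_superset (mem_interior_iff_mem_nhds.1 hy) (extChartAt_target_subset_range x)

theorem pderiv_eq_fderiv {x : M} {y : 𝔼} (hy : y ∈ interior (extChartAt I x).target) (i : Fin n)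
    (f : 𝔼 → ℝ) : pderiv I i f y = fderiv ℝ f y (EuclideanSpace.single i 1) := by
  rw [pderiv, fderivWithin_of_mem_nhds (range_mem_nhds_of_mem_interior_target hy)]

variable [RiemannianBundle (fun p : M ↦ TangentSpace I p)]

theorem matrixDeriv_metric_symm (x : M) (y : 𝔼) (i j k : Fin n) :
    matrixDeriv (metric I x) i y j k = matrixDeriv (metric I x) i y k j := by
  simp only [matrixDeriv, Matrix.of_apply]
  congr 2
  exact funext fun z ↦ metric_symm x z j k

theorem sum_metric_mul_riemann_expand (x : M) (y : 𝔼) (q k i j : Fin n) :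
    ∑ l, metric I x y q l * riemann I x l k i j y
      = ∑ l, metric I x y q l * pderiv I i (christoffel I x l j k) y
        - ∑ l, metric I x y q l * pderiv I j (christoffel I x l i k) y
        + ∑ l, metric I x y q l * ∑ m, christoffel I x l i m y * christoffel I x m j k y
        - ∑ l, metric I x y q l * ∑ m, christoffel I x l j m y * christoffel I x m i k y := by
  rw [← Finset.sum_sub_distrib, ← Finset.sum_add_distrib, ← Finset.sum_sub_distrib]
  refine Finset.sum_congr rfl fun l _ ↦ ?_
  rw [riemann, Finset.sum_sub_distrib]
  ring

variable {x : M} {y : EuclideanSpace ℝ (Fin n)} (hy : y ∈ interior (extChartAt I x).target)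
include hy

theorem christoffel_eq (k i j : Fin n) :
    christoffel I x k i j y = 1 / 2 * ∑ l, (metric I x y)⁻¹ k l
      * christoffelFirst (fun i ↦ matrixDeriv (metric I x) i y) i j l := by
  simp only [christoffel, pderiv_eq_fderiv hy, christoffelFirst, matrixDeriv, Matrix.of_apply]

variable [IsManifold I 1 M]

theorem isUnit_det_metric : IsUnit (metric I x y).det :=
  isUnit_iff_ne_zero.2 (posDef_metric x (interior_subset hy)).det_pos.ne'

theorem sum_metric_mul_christoffel (q i j : Fin n) :
    ∑ k, metric I x y q k * christoffel I x k i j y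
      = 1 / 2 * christoffelFirst (fun i ↦ matrixDeriv (metric I x) i y) i j q := by
  refine (sum_mul_eq_iff_eq_sum_inv_mul (isUnit_det_metric hy)
    (f := fun k ↦ christoffel I x k i j y)
    (g := fun q ↦ 1 / 2 * christoffelFirst (fun i ↦ matrixDeriv (metric I x) i y) i j q)).2
    (fun k ↦ ?_) q
  rw [christoffel_eq hy, Finset.mul_sum]
  exact Finset.sum_congr rfl fun l _ ↦ by ring

/-- `Γ_{im,q} Γ^m_{jk} - (∂_i g_{qm}) Γ^m_{jk} = -Γ_{iq,m} Γ^m_{jk}`, by metric compatibility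
`∂_i g_{qm} = Γ_{iq,m} + Γ_{im,q}`. -/
theorem sum_metric_mul_christoffel_mul_christoffel (i j k q : Fin n) :
    ∑ l, metric I x y q l * ∑ m, christoffel I x l i m y * christoffel I x m j k y
        - ∑ l, matrixDeriv (metric I x) i y q l * christoffel I x l j k y
      = -∑ l, christoffel I x l j k y
        * (1 / 2 * christoffelFirst (fun i ↦ matrixDeriv (metric I x) i y) i q l) := by
  have hlower : ∑ l, metric I x y q l * ∑ m, christoffel I x l i m y * christoffel I x m j k y
      = ∑ m, 1 / 2 * christoffelFirst (fun i ↦ matrixDeriv (metric I x) i y) i m q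
        * christoffel I x m j k y := by
    simp_rw [← sum_metric_mul_christoffel hy, Finset.mul_sum, Finset.sum_mul]
    rw [Finset.sum_comm]
    simp only [mul_assoc]
  rw [hlower, ← Finset.sum_sub_distrib, ← Finset.sum_neg_distrib]
  refine Finset.sum_congr rfl fun l _ ↦ ?_
  rw [christoffelFirst, christoffelFirst, matrixDeriv_metric_symm x y i q l,
    matrixDeriv_metric_symm x y l i q, matrixDeriv_metric_symm x y q i l]
  ring

variable [IsManifold I (2 + 1) M]
  [IsContMDiffRiemannianBundle I 2 (EuclideanSpace ℝ (Fin n)) (fun p : M ↦ TangentSpace I p)]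

theorem differentiableAt_matrixDeriv_metric (i j k : Fin n) :
    DifferentiableAt ℝ (fun z ↦ matrixDeriv (metric I x) i z j k) y :=
  differentiableAt_matrixDeriv (fun j k ↦ contDiffAt_metric (I := I) x hy j k) i j k

theorem differentiableAt_christoffel (k i j : Fin n) :
    DifferentiableAt ℝ (christoffel I x k i j) y := by
  have hev : christoffel I x k i j =ᶠ[𝓝 y] fun z ↦ 1 / 2 * ∑ l, (metric I x z)⁻¹ k l
      * christoffelFirst (fun i ↦ matrixDeriv (metric I x) i z) i j l := by
    filter_upwards [isOpen_interior.mem_nhds hy] with z hz using christoffel_eq hz k i j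
  refine DifferentiableAt.congr_of_eventuallyEq ?_ hev
  refine (DifferentiableAt.fun_sum fun l _ ↦ .fun_mul ?_ ?_).const_mul _
  · exact (contDiffAt_matrix_inv (fun a b ↦ contDiffAt_metric (I := I) (k := 2) x hy a b)
      (isUnit_det_metric hy).ne_zero k l).differentiableAt two_ne_zero
  · exact ((differentiableAt_matrixDeriv_metric hy i j l).fun_add
      (differentiableAt_matrixDeriv_metric hy j i l)).fun_sub
      (differentiableAt_matrixDeriv_metric hy l i j)

/-- The derivative of `g_{qk} Γ^k_{ij} = Γ_{ij,q}`. -/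
theorem sum_metric_mul_pderiv_christoffel (p q i j : Fin n) :
    ∑ k, matrixDeriv (metric I x) p y q k * christoffel I x k i j y
      + ∑ k, metric I x y q k * pderiv I p (christoffel I x k i j) y
    = 1 / 2 * (matrixDeriv (matrixDeriv (metric I x) i) p y j q
      + matrixDeriv (matrixDeriv (metric I x) j) p y i q
      - matrixDeriv (matrixDeriv (metric I x) q) p y i j) := by
  have hΓ : ∀ k, HasFDerivAt (christoffel I x k i j) _ y :=
    fun k ↦ (differentiableAt_christoffel hy k i j).hasFDerivAt
  have hg : ∀ k, HasFDerivAt (fun z ↦ metric I x z q k) _ y := fun k ↦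
    ((contDiffAt_metric (k := 2) x hy q k).differentiableAt two_ne_zero).hasFDerivAt
  have hd := fun a b c ↦ (differentiableAt_matrixDeriv_metric hy a b c).hasFDerivAt
  have hev : (fun z ↦ ∑ k, metric I x z q k * christoffel I x k i j z) =ᶠ[𝓝 y]
      fun z ↦ 1 / 2 * (matrixDeriv (metric I x) i z j q + matrixDeriv (metric I x) j z i q
        - matrixDeriv (metric I x) q z i j) := by
    filter_upwards [isOpen_interior.mem_nhds hy] with z hz using sum_metric_mul_christoffel hz q i j
  have hfderiv := (HasFDerivAt.fun_sum fun k (_ : k ∈ Finset.univ) ↦ (hg k).fun_mul (hΓ k)).unique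
    (((((hd i j q).fun_add (hd j i q)).fun_sub (hd q i j)).const_mul (1 / 2)).congr_of_eventuallyEq
      hev)
  have happly := DFunLike.congr_fun hfderiv (EuclideanSpace.single p 1)
  simp only [_root_.sum_apply, add_apply, smul_apply, sub_apply, smul_eq_mul] at happly
  simp only [pderiv_eq_fderiv hy]
  refine Eq.trans ?_ happly
  rw [← Finset.sum_add_distrib]
  refine Finset.sum_congr rfl fun k _ ↦ ?_
  rw [matrixDeriv, Matrix.of_apply]
  ring

theorem sum_metric_mul_riemann (q k i j : Fin n) :
    ∑ l, metric I x y q l * riemann I x l k i j y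
      = 1 / 2 * (matrixDeriv (matrixDeriv (metric I x) k) i y j q
          - matrixDeriv (matrixDeriv (metric I x) q) i y j k
          - matrixDeriv (matrixDeriv (metric I x) k) j y i q
          + matrixDeriv (matrixDeriv (metric I x) q) j y i k)
      - ∑ l, christoffel I x l j k y
        * (1 / 2 * christoffelFirst (fun i ↦ matrixDeriv (metric I x) i y) i q l)
      + ∑ l, christoffel I x l i k y
        * (1 / 2 * christoffelFirst (fun i ↦ matrixDeriv (metric I x) i y) j q l) := by
  have hcomm := congrFun (congrFun (matrixDeriv_matrixDeriv_comm (m := metric I x)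
    (fun a b ↦ contDiffAt_metric (I := I) (k := 2) x hy a b) i j) k) q
  linear_combination sum_metric_mul_riemann_expand (I := I) x y q k i j
    + sum_metric_mul_pderiv_christoffel hy i q j k - sum_metric_mul_pderiv_christoffel hy j q i k
    + sum_metric_mul_christoffel_mul_christoffel hy i j k q
    - sum_metric_mul_christoffel_mul_christoffel hy j i k q + 1 / 2 * hcomm

end ScalarCurvature

section CurvatureInBasis

open RiemannianCoord

variable {n : ℕ} {H : Type*} [TopologicalSpace H]
  {I : ModelWithCorners ℝ (EuclideanSpace ℝ (Fin n)) H}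
  {M : Type*} [TopologicalSpace M] [ChartedSpace H M]
  [RiemannianBundle (fun p : M ↦ TangentSpace I p)]

local notation "𝔼" => EuclideanSpace ℝ (Fin n)

variable (I) in
/-- The curvature tensor at `x` of the 2-jet of the metric there. The jet is transported to `𝔼` by
the linear coordinates of the basis `b`, in which the metric at `x` is the Euclidean one as soon as
its matrix is the Gram matrix of `b`. -/
def curvatureInBasis (x : M) (b : Module.Basis (Fin n) ℝ 𝔼) :
    𝔼 →ₗ[ℝ] 𝔼 →ₗ[ℝ] 𝔼 →ₗ[ℝ] 𝔼 →ₗ[ℝ] ℝ :=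
  curvatureOfJet
    (trilinOfBasis b fun i ↦ matrixDeriv (metric I x) i (extChartAt I x x))
    (quadrilinOfBasis b fun i j ↦ matrixDeriv (matrixDeriv (metric I x) j) i (extChartAt I x x))

variable [IsManifold I 1 M] [IsManifold I (2 + 1) M]
  [IsContMDiffRiemannianBundle I 2 (EuclideanSpace ℝ (Fin n)) (fun p : M ↦ TangentSpace I p)]
  {x : M} (hx : extChartAt I x x ∈ interior (extChartAt I x).target)
  {b : Module.Basis (Fin n) ℝ (EuclideanSpace ℝ (Fin n))}
  (hb : Matrix.gram ℝ b = metric I x (extChartAt I x x))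
include hx hb

theorem riemann_eq_sum_gram_inv_mul_curvatureInBasis (l k i j : Fin n) :
    riemann I x l k i j (extChartAt I x x)
      = ∑ q, (Matrix.gram ℝ b)⁻¹ l q * curvatureInBasis I x b (b i) (b j) (b k) (b q) := by
  rw [hb]
  refine (sum_mul_eq_iff_eq_sum_inv_mul (isUnit_det_metric hx)
    (f := fun l ↦ riemann I x l k i j (extChartAt I x x))).1 (fun q ↦ ?_) l
  simp only [sum_metric_mul_riemann hx, curvatureInBasis, curvatureOfJet_basis, hb,
    christoffel_eq hx]

theorem ricci_eq_sum_curvatureInBasis {κ : Type*} [Fintype κ] (e : OrthonormalBasis κ ℝ 𝔼)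
    (j k : Fin n) :
    ricci I x j k (extChartAt I x x)
      = ∑ a, curvatureInBasis I x b (e a) (b j) (b k) (e a) := by
  simp_rw [ricci, riemann_eq_sum_gram_inv_mul_curvatureInBasis hx hb]
  exact sum_gram_inv_mul_bilin b e (((curvatureInBasis I x b).flip (b j)).flip (b k))

theorem scalarCurvature_eq_scalarContraction :
    scalarCurvature I x = scalarContraction (curvatureInBasis I x b) := by
  let e := EuclideanSpace.basisFun (Fin n) ℝ
  have htrace : ∀ a, ∑ j, ∑ k, (Matrix.gram ℝ b)⁻¹ j k
        * curvatureInBasis I x b (e a) (b j) (b k) (e a)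
      = ∑ c, curvatureInBasis I x b (e a) (e c) (e c) (e a) := fun a ↦
    sum_gram_inv_mul_bilin b e ((curvatureInBasis I x b (e a)).compr₂ (LinearMap.applyₗ (e a)))
  calc scalarCurvature I x
      = ∑ j, ∑ k, ∑ a, (Matrix.gram ℝ b)⁻¹ j k
          * curvatureInBasis I x b (e a) (b j) (b k) (e a) := by
        simp_rw [scalarCurvature, ← hb, ricci_eq_sum_curvatureInBasis hx hb e, Finset.mul_sum]
    _ = ∑ a, ∑ j, ∑ k, (Matrix.gram ℝ b)⁻¹ j k
          * curvatureInBasis I x b (e a) (b j) (b k) (e a) :=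
        (Finset.sum_congr rfl fun j _ ↦ Finset.sum_comm).trans Finset.sum_comm
    _ = scalarContraction (curvatureInBasis I x b) := by
        simp_rw [htrace]
        simp [e, scalarContraction]

end CurvatureInBasis

section NormalParametrization

open RiemannianCoord

variable {n : ℕ} {H : Type*} [TopologicalSpace H]
  {I : ModelWithCorners ℝ (EuclideanSpace ℝ (Fin n)) H}
  {M : Type*} [TopologicalSpace M] [ChartedSpace H M]
  [RiemannianBundle (fun p : M ↦ TangentSpace I p)]

local notation "𝔼" => EuclideanSpace ℝ (Fin n)

theorem toBilin_eq_matrixBilin_coordEquiv (b : Module.Basis (Fin n) ℝ 𝔼)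
    (m : Matrix (Fin n) (Fin n) ℝ) (v w : 𝔼) :
    Matrix.toBilin b m v w = matrixBilin m (coordEquiv b v) (coordEquiv b w) := by
  rw [matrixBilin_apply, Matrix.toBilin_apply]
  exact Finset.sum_congr rfl fun i _ ↦ Finset.sum_congr rfl fun j _ ↦ by
    rw [coordEquiv_apply, coordEquiv_apply]
    ring

theorem fderiv_const_add_coordEquiv_comp (y : 𝔼) (b : Module.Basis (Fin n) ℝ 𝔼) {φ : 𝔼 → 𝔼} {z : 𝔼}
    (hφ : DifferentiableAt ℝ φ z) :
    fderiv ℝ (fun z ↦ y + coordEquiv b (φ z)) z = (coordEquiv b : 𝔼 →L[ℝ] 𝔼).comp (fderiv ℝ φ z) :=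
  (((coordEquiv b).hasFDerivAt.comp z hφ.hasFDerivAt).const_add y).fderiv

theorem pullbackForm_const_add_coordEquiv_comp (x : M) (y : 𝔼) (b : Module.Basis (Fin n) ℝ 𝔼)
    {φ : 𝔼 → 𝔼} {z : 𝔼} (hφ : DifferentiableAt ℝ φ z) (w : 𝔼) :
    pullbackForm I x (fun z ↦ y + coordEquiv b (φ z)) z w
      = Matrix.toBilin b (metric I x (y + coordEquiv b (φ z))) (fderiv ℝ φ z w)
        (fderiv ℝ φ z w) := by
  rw [toBilin_eq_matrixBilin_coordEquiv, pullbackForm, fderiv_const_add_coordEquiv_comp y b hφ]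
  rfl

/-- Composing the linear coordinates of a basis orthonormal at `x` with `normalMap` gives normal
coordinates up to order three. -/
theorem exists_normal_parametrization [IsManifold I 1 M] [IsManifold I 4 M]
    [IsContMDiffRiemannianBundle I 3 𝔼 (fun p : M ↦ TangentSpace I p)]
    {x : M} (hx : I.IsInteriorPoint x) :
    ∃ (R : 𝔼 →ₗ[ℝ] 𝔼 →ₗ[ℝ] 𝔼 →ₗ[ℝ] 𝔼 →ₗ[ℝ] ℝ) (Φ : 𝔼 → 𝔼) (Φ' : 𝔼 ≃L[ℝ] 𝔼),
      IsCurvatureLike R ∧ scalarContraction R = scalarCurvature I x ∧ ContDiff ℝ 1 Φ ∧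
      Φ 0 = extChartAt I x x ∧ fderiv ℝ Φ 0 = Φ' ∧
      ∃ C, 0 ≤ C ∧ ∀ᶠ z in 𝓝 0, ∀ w,
        |pullbackForm I x Φ z w - (‖w‖ ^ 2 - R w z z w / 3)| ≤ C * ‖z‖ ^ 3 * ‖w‖ ^ 2 := by
  have : IsManifold I (2 + 1) M := .of_le (n := 4) (by norm_num)
  have : IsManifold I (3 + 1) M := .of_le (n := 4) (by norm_num)
  have : IsContMDiffRiemannianBundle I 2 𝔼 (fun p : M ↦ TangentSpace I p) :=
    .of_le (n := 3) (by norm_num)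
  have hy : extChartAt I x x ∈ interior (extChartAt I x).target := I.isInteriorPoint_iff.1 hx
  obtain ⟨b, hb⟩ := exists_basis_gram_eq (posDef_metric x (interior_subset hy))
  have hjet := hasMetricJet_toBilin_comp b (fun i j ↦ contDiffAt_metric (k := 3) x hy i j)
    (metric_symm x) hb
  set y := extChartAt I x x
  set g₁ := trilinOfBasis b fun i ↦ matrixDeriv (metric I x) i y
  set g₂ := quadrilinOfBasis b fun i j ↦ matrixDeriv (matrixDeriv (metric I x) j) i y
  have hφ := (contDiff_normalMap g₁ g₂ (k := 1)).differentiable one_ne_zero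
  obtain ⟨C, hC, hexp⟩ := exists_normalMap_metric_expansion hjet
  refine ⟨curvatureInBasis I x b, fun z ↦ y + coordEquiv b (normalMap g₁ g₂ z), coordEquiv b,
    isCurvatureLike_curvatureOfJet g₁ g₂, (scalarCurvature_eq_scalarContraction hy hb).symm,
    contDiff_const.add ((coordEquiv b).contDiff.comp (contDiff_normalMap g₁ g₂)), ?_, ?_, C, hC, ?_⟩
  · simp [normalMap_zero]
  · rw [fderiv_const_add_coordEquiv_comp y b (hφ 0),
      fderiv_normalMap_zero g₂ hjet.symm₁]
    rfl
  · filter_upwards [hexp] with z hz w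
    rw [pullbackForm_const_add_coordEquiv_comp x y b (hφ z)]
    exact hz w

end NormalParametrization

section ExtentCoefficients

variable {n : ℕ}

theorem one_div_six_mul_sqrt_eq_simplexEdge_mul (hn : 1 ≤ n) :
    1 / 6 * √(((n : ℝ) + 1) / (2 * (n : ℝ) ^ 5)) = simplexEdge n * (1 / (12 * (n : ℝ) ^ 2)) := by
  have _ : (0 : ℝ) < n := by exact_mod_cast hn
  have hL := simplexEdge_pos hn
  have hsqrt : √(((n : ℝ) + 1) / (2 * (n : ℝ) ^ 5)) = simplexEdge n / (2 * (n : ℝ) ^ 2) := by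
    rw [Real.sqrt_eq_iff_eq_sq (by positivity) (by positivity), div_pow, simplexEdge_sq]
    field
  rw [hsqrt]
  field

theorem simplexSum_eq_mul_sub (hn : 1 ≤ n) (s ρ : ℝ) :
    simplexSum n s ρ = n * (n + 1)
      * (simplexEdge n * ρ - simplexEdge n * (1 / (12 * (n : ℝ) ^ 2)) * s * ρ ^ 3) := by
  have _ : (0 : ℝ) < n := by exact_mod_cast hn
  have hL := simplexEdge_pos hn
  have hsq := simplexEdge_sq (n := n)
  rw [simplexSum]
  field_simp at hsq ⊢
  linear_combination (6 * s * ρ ^ 3) * hsq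

theorem exists_eq_mul_one_sub_add_of_isBigO {f : ℝ → ℝ} {L a : ℝ} (hL : L ≠ 0)
    (hf : (fun ε ↦ f ε - (L * ε - L * a * ε ^ 3)) =O[𝓝[>] 0] fun ε ↦ ε ^ 4) :
    ∃ r : ℝ → ℝ, (r =O[𝓝[>] 0] fun ε ↦ ε ^ 3) ∧
      ∀ᶠ ε in 𝓝[>] 0, f ε = L * ε * (1 - a * ε ^ 2 + r ε) := by
  have hpos : ∀ᶠ ε : ℝ in 𝓝[>] 0, ε ≠ 0 := eventually_mem_nhdsWithin.mono fun _ hε ↦ ne_of_gt hε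
  refine ⟨fun ε ↦ L⁻¹ * ((f ε - (L * ε - L * a * ε ^ 3)) * ε⁻¹), ?_, ?_⟩
  · refine ((hf.mul (isBigO_refl (·⁻¹) _)).const_mul_left _).trans_eventuallyEq ?_
    filter_upwards [hpos] with ε hε
    field
  · filter_upwards [hpos] with ε hε
    field

end ExtentCoefficients

end

theorem theorem1p1_general {n : ℕ} (hn : 1 ≤ n) {H : Type*} [TopologicalSpace H]
    (I : ModelWithCorners ℝ (EuclideanSpace ℝ (Fin n)) H)
    {M : Type*} [PseudoEMetricSpace M] [ChartedSpace H M] [IsManifold I 1 M] [IsManifold I 4 M]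
    [RiemannianBundle (fun p : M ↦ TangentSpace I p)]
    [IsContMDiffRiemannianBundle I 3 (EuclideanSpace ℝ (Fin n)) (fun p : M ↦ TangentSpace I p)]
    [IsRiemannianManifold I M]
    (x : M) (hx : I.IsInteriorPoint x) :
    ((fun ε : ℝ ↦ (extent (n + 1) (Metric.closedEBall x (ENNReal.ofReal ε))).toReal
        - ((extent (n + 1) (Metric.closedBall (0 : EuclideanSpace ℝ (Fin n)) 1)).toReal * ε
          - 1 / 6 * √(((n : ℝ) + 1) / (2 * (n : ℝ) ^ 5)) * scalarCurvature I x * ε ^ 3))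
      =O[𝓝[>] 0] fun ε : ℝ ↦ ε ^ 4) ∧
    (∃ r : ℝ → ℝ, (r =O[𝓝[>] 0] fun ε : ℝ ↦ ε ^ 3) ∧
      ∀ᶠ ε : ℝ in 𝓝[>] 0,
        (extent (n + 1) (Metric.closedEBall x (ENNReal.ofReal ε))).toReal
          = √(2 * (((n : ℝ) + 1) / n)) * ε
            * (1 - 1 / (12 * (n : ℝ) ^ 2) * scalarCurvature I x * ε ^ 2 + r ε)) := by
  have hN : (n : ℝ) * (n + 1) ≠ 0 := by positivity
  obtain ⟨R, Φ, Φ', hR, hscal, hΦ, hΦ₀, hΦ', C₀, hC₀, hexp⟩ := exists_normal_parametrization hx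
  obtain ⟨C, hC, r, hr, hdist⟩ := exists_hasDistExpansion hx hΦ hΦ₀ hΦ' hR hC₀ hexp
  have hextent := hdist.isBigO_extent_sub hn hR hC hr
  have hψ₀ : (extChartAt I x).symm (Φ 0) = x := by simp [hΦ₀]
  rw [hψ₀] at hextent
  simp only [hscal, simplexSum_eq_mul_sub hn, ← mul_sub, isBigO_const_mul_left_iff hN]
    at hextent
  rw [toReal_extent_closedBall_one hn, one_div_six_mul_sqrt_eq_simplexEdge_mul hn, ← simplexEdge]
  refine ⟨hextent, exists_eq_mul_one_sub_add_of_isBigO (simplexEdge_pos hn).ne' ?_⟩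
  simpa only [mul_assoc] using hextent

theorem theorem1p1 {n : ℕ} (hn : 1 ≤ n) {H : Type*} [TopologicalSpace H]
    (I : ModelWithCorners ℝ (EuclideanSpace ℝ (Fin n)) H)
    {M : Type*} [EMetricSpace M] [ChartedSpace H M] [IsManifold I ∞ M]
    [RiemannianBundle (fun p : M ↦ TangentSpace I p)]
    [IsContMDiffRiemannianBundle I ∞ (EuclideanSpace ℝ (Fin n)) (fun p : M ↦ TangentSpace I p)]
    [IsRiemannianManifold I M]
    (x : M) (hx : I.IsInteriorPoint x) :
    ((fun ε : ℝ ↦ (extent (n + 1) (Metric.closedEBall x (ENNReal.ofReal ε))).toReal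
        - ((extent (n + 1) (Metric.closedBall (0 : EuclideanSpace ℝ (Fin n)) 1)).toReal * ε
          - 1 / 6 * √(((n : ℝ) + 1) / (2 * (n : ℝ) ^ 5)) * scalarCurvature I x * ε ^ 3))
      =O[𝓝[>] 0] fun ε : ℝ ↦ ε ^ 4) ∧
    (∃ r : ℝ → ℝ, (r =O[𝓝[>] 0] fun ε : ℝ ↦ ε ^ 3) ∧
      ∀ᶠ ε : ℝ in 𝓝[>] 0,
        (extent (n + 1) (Metric.closedEBall x (ENNReal.ofReal ε))).toReal
          = √(2 * (((n : ℝ) + 1) / n)) * ε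
            * (1 - 1 / (12 * (n : ℝ) ^ 2) * scalarCurvature I x * ε ^ 2 + r ε)) := by
  have : IsContMDiffRiemannianBundle I 3 (EuclideanSpace ℝ (Fin n))
      (fun p : M ↦ TangentSpace I p) := .of_le (n := ∞) ENat.LEInfty.out
  exact theorem1p1_general hn I x hx
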